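/- **Theorem 6.** An instance of $k$-Subset Edge Separator consists of a finite simple graph $G$ on $n\ge 1$ vertices, a set of terminals $R\subseteq V(G)$, and an integer $k\ge 1$. A feasible solution is a set $S\subseteq E(G)$ of edges such that every connected component of $G\setminus S$ contains at most $k$ vertices of $R$, and the task is to find a feasible solution of minimum size; $\mathsf{OPT}$ denotes this minimum size. An $\alpha$-approximation algorithm outputs a feasible solution of size at most $\alpha\cdot\mathsf{OPT}$. Let $\deg(G)$ be the maximum degree of $G$. The following deterministic algorithms for $k$-Subset Edge Separator exist, where $k$ and the rational number $\varepsilon>0$ are part of the input, running time is the number of steps of a word RAM (with words of logarithmic length in $n$, the numbers in the input and the running time), all constants hidden in $O(\cdot)$ are absolute, and each running time may in addition carry an absolute constant factor. (a) For the case $R=V(G)$, a $(2+\varepsilon)$-approximation algorithm that runs in time $2^{O(k\log(k/\min\{\varepsilon,1\}))}\,n^{O(1)}$; for $0<\varepsilon\le 1$ this is $2^{O(k\log(k/\varepsilon))}\,n^{O(1)}$. (b) A $2$-approximation algorithm that runs in time $n^{k+O(1)}$. (c) A $(2+\varepsilon)$-approximation algorithm that runs in time $2^{O(k^2\deg(G)/\varepsilon)}\,n^{O(1)}$.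 -/

import Mathlib

/-! ## Machine model: a word RAM with a step count -/

namespace WordRAM

/-- Memory: integer variables (registers), and arrays of unbounded length.
A program mentions only finitely many variables and finitely many arrays. -/
@[ext]
structure State where
  var : ℕ → ℕ
  arr : ℕ → ℕ → ℕ

/-- Arithmetic instructions (subtraction truncates at `0`, division rounds down). -/
inductive Op where
  | add
  | sub
  | mul
  | div

def Op.eval : Op → ℕ → ℕ → ℕ
  | .add, a, b => a + b
  | .sub, a, b => a - b
  | .mul, a, b => a * b
  | .div, a, b => a / b

def State.setVar (s : State) (x v : ℕ) : State :=
  ⟨Function.update s.var x v, s.arr⟩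

def State.setArr (s : State) (a i v : ℕ) : State :=
  ⟨s.var, Function.update s.arr a (Function.update (s.arr a) i v)⟩

/-- Programs. -/
inductive Prog where
  /-- do nothing -/
  | skip
  /-- `x := c` -/
  | const (x c : ℕ)
  /-- `x := y op z` -/
  | arith (o : Op) (x y z : ℕ)
  /-- `x := a[y]` -/
  | load (x a y : ℕ)
  /-- `a[x] := y` -/
  | store (a x y : ℕ)
  /-- `p; q` -/
  | seq (p q : Prog)
  /-- `if x ≠ 0 then p else q` -/
  | cond (x : ℕ) (p q : Prog)
  /-- `while x ≠ 0 do p` -/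
  | loop (x : ℕ) (p : Prog)

/-- `Exec W p s t s'`: started in `s`, the program `p` halts in `s'` after exactly `t` steps, and
every number it writes is at most `W`. Each elementary instruction and each test is one step. An
instruction whose result exceeds `W` (does not fit into a word) has no execution. -/
inductive Exec (W : ℕ) : Prog → State → ℕ → State → Prop where
  | skip (s : State) : Exec W .skip s 1 s
  | const (s : State) (x c : ℕ) (h : c ≤ W) : Exec W (.const x c) s 1 (s.setVar x c)
  | arith (s : State) (o : Op) (x y z : ℕ) (h : o.eval (s.var y) (s.var z) ≤ W) :
      Exec W (.arith o x y z) s 1 (s.setVar x (o.eval (s.var y) (s.var z)))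
  | load (s : State) (x a y : ℕ) (h : s.arr a (s.var y) ≤ W) :
      Exec W (.load x a y) s 1 (s.setVar x (s.arr a (s.var y)))
  | store (s : State) (a x y : ℕ) (h : s.var y ≤ W) :
      Exec W (.store a x y) s 1 (s.setArr a (s.var x) (s.var y))
  | seq {p q : Prog} {s s' s'' : State} {t t' : ℕ}
      (h₁ : Exec W p s t s') (h₂ : Exec W q s' t' s'') : Exec W (.seq p q) s (t + t') s''
  | condTrue {x : ℕ} {p : Prog} (q : Prog) {s s' : State} {t : ℕ}
      (hx : s.var x ≠ 0) (h : Exec W p s t s') : Exec W (.cond x p q) s (t + 1) s'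
  | condFalse {x : ℕ} (p : Prog) {q : Prog} {s s' : State} {t : ℕ}
      (hx : s.var x = 0) (h : Exec W q s t s') : Exec W (.cond x p q) s (t + 1) s'
  | loopDone {x : ℕ} (p : Prog) {s : State} (hx : s.var x = 0) : Exec W (.loop x p) s 1 s
  | loopStep {x : ℕ} {p : Prog} {s s' s'' : State} {t t' : ℕ} (hx : s.var x ≠ 0)
      (h₁ : Exec W p s t s') (h₂ : Exec W (.loop x p) s' t' s'') :
      Exec W (.loop x p) s (t + t' + 1) s''

/-- The machine is deterministic: final state and step count are functions of program and input. -/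
theorem Exec.deterministic {W W' : ℕ} {p : Prog} {s s₁ s₂ : State} {t₁ t₂ : ℕ}
    (h₁ : Exec W p s t₁ s₁) (h₂ : Exec W' p s t₂ s₂) : t₁ = t₂ ∧ s₁ = s₂ := by
  induction h₁ generalizing t₂ s₂ with
  | skip => cases h₂; exact ⟨rfl, rfl⟩
  | const => cases h₂; exact ⟨rfl, rfl⟩
  | arith => cases h₂; exact ⟨rfl, rfl⟩
  | load => cases h₂; exact ⟨rfl, rfl⟩
  | store => cases h₂; exact ⟨rfl, rfl⟩
  | seq _ _ ih₁ ih₂ =>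
    cases h₂ with
    | seq g₁ g₂ =>
      obtain ⟨rfl, rfl⟩ := ih₁ g₁
      obtain ⟨rfl, rfl⟩ := ih₂ g₂
      exact ⟨rfl, rfl⟩
  | condTrue _ hx _ ih =>
    cases h₂ with
    | condTrue _ _ g => obtain ⟨rfl, rfl⟩ := ih g; exact ⟨rfl, rfl⟩
    | condFalse _ hx' _ => exact absurd hx' hx
  | condFalse _ hx _ ih =>
    cases h₂ with
    | condTrue _ hx' _ => exact absurd hx hx'
    | condFalse _ _ g => obtain ⟨rfl, rfl⟩ := ih g; exact ⟨rfl, rfl⟩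
  | loopDone _ hx =>
    cases h₂ with
    | loopDone => exact ⟨rfl, rfl⟩
    | loopStep hx' _ _ => exact absurd hx hx'
  | loopStep hx _ _ ih₁ ih₂ =>
    cases h₂ with
    | loopDone _ hx' => exact absurd hx' hx
    | loopStep _ g₁ g₂ =>
      obtain ⟨rfl, rfl⟩ := ih₁ g₁
      obtain ⟨rfl, rfl⟩ := ih₂ g₂
      exact ⟨rfl, rfl⟩

end WordRAM

/-! ## The problem `k`-Subset Edge Separator -/

namespace SubsetEdgeSeparator

/-- `S` is a feasible solution: a set of edges of `G` after whose deletion every connected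
component contains at most `k` vertices of `R`. -/
def IsSolution {V : Type*} (G : SimpleGraph V) (R : Finset V) (k : ℕ)
    (S : Finset (Sym2 V)) : Prop :=
  (S : Set (Sym2 V)) ⊆ G.edgeSet ∧
    ∀ C : (G.deleteEdges (S : Set (Sym2 V))).ConnectedComponent,
      ((R : Set V) ∩ C.supp).ncard ≤ k

/-- `S` is an `α`-approximate solution: feasible, and at most `α` times as large as every
feasible solution, equivalently as a smallest one. -/
def IsApprox {V : Type*} (G : SimpleGraph V) (R : Finset V) (k : ℕ) (α : ℝ)
    (S : Finset (Sym2 V)) : Prop :=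
  IsSolution G R k S ∧ ∀ S' : Finset (Sym2 V), IsSolution G R k S' → (S.card : ℝ) ≤ α * S'.card

/-- The input on the machine: variable `0` holds the number `n` of vertices, variables `1, 2, …`
hold the numerical parameters, array `0` the adjacency matrix of `G` (row by row), array `1` the
indicator of `R`; everything else is `0`. -/
def inputState {n : ℕ} (G : SimpleGraph (Fin n)) [DecidableRel G.Adj] (R : Finset (Fin n))
    (params : List ℕ) : WordRAM.State where
  var := fun x => (n :: params).getD x 0
  arr := fun a i =>
    if a = 0 then (if ∃ u v : Fin n, G.Adj u v ∧ i = u.val * n + v.val then 1 else 0)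
    else if a = 1 then (if ∃ v ∈ R, i = v.val then 1 else 0)
    else 0

/-- The machine outputs the edge set `S` in array `2`, as the nonzero entries of an `n × n`
matrix. -/
def Outputs {n : ℕ} (s : WordRAM.State) (S : Finset (Sym2 (Fin n))) : Prop :=
  ∀ u v : Fin n, s(u, v) ∈ S ↔ s.arr 2 (u.val * n + v.val) ≠ 0

/-- On the instance `(G, R, k)`, with further numerical parameters `extra` (the rational number `ε`,
if there is one), the program `P` halts within `T` steps and outputs an `α`-approximate solution.
All numbers that it writes are at most `(n + sum of the parameters + T) ^ C`, that is, it works on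
words of `O(log (n + sum of the parameters + T))` bits. -/
def SolvesWithin {n : ℕ} (P : WordRAM.Prog) (C : ℕ) (G : SimpleGraph (Fin n))
    [DecidableRel G.Adj] (R : Finset (Fin n)) (k : ℕ) (extra : List ℕ) (α T : ℝ) : Prop :=
  ∃ (W t : ℕ) (s : WordRAM.State),
    WordRAM.Exec W P (inputState G R (k :: extra)) t s ∧
    (t : ℝ) ≤ T ∧
    (W : ℝ) ≤ ((n : ℝ) + ((k :: extra).sum : ℕ) + T) ^ C ∧
    ∃ S : Finset (Sym2 (Fin n)), IsApprox G R k α S ∧ Outputs s S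

/-- The positive rational `ε` as machine input: its numerator and denominator in lowest terms. -/
def encodeRat (ε : ℚ) : List ℕ := [ε.num.toNat, ε.den]

end SubsetEdgeSeparator

/-!
All three algorithms are local searches over edge sets `S`, starting with all edges. The move to a
set `W` of vertices removes from `S` the edges inside `W` and adds the edges that leave `W`
(`moveMat`). If `W` has at most `k` terminals, then `S` stays feasible (`Separates.moveMat`), because
a connected set without edges of `S` lies inside `W` or outside `W` after the move. If no move to a
component `O` that an optimal solution leaves shrinks `S`, then `S` has no more edges with an end in
`O` than there are edges leaving `O` (`touching_le_of_move`). In the sum over all components the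
latter count every edge of the optimal solution at most twice: `|S| ≤ 2 * OPT`
(`active_le_of_parts`).

For a prescribed set `A` of allowed terminals, the best move to a set `W` with terminals in `A` only
is a minimum cut, in a network with a unit from the source for each edge of `S` at a vertex, and
with the terminals outside `A` at the sink (`cutVal_eq_active`, `move_spec`); augmenting paths find
it (`flow_spec`). Each round over all candidates `A` shrinks `S` or certifies that no such move does
(`localSearch_spec`). What remains is a small family of candidates for every algorithm, given by a
number, the advice, whose digits control the construction of `A`. Put `K = min k n`.

* For the ratio `2` in time `n ^ (k + O(1))`, all sets of at most `K` vertices are candidates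
  (`exists_runDigits_insertNum`, `ratio_of_stable`).
* If all vertices are terminals, at most `K - 1` edges at a vertex are missing from a feasible
  solution. So the solution contains at least half of the edges at vertices of degree more than
  `3 * (K - 1)` (`sum_highDegree_le`), and all of these edges may be taken without exceeding the ratio
  `2`. The remaining graph has bounded degree, and all its connected sets of at most `K` vertices are
  reached from a start vertex with `(3 * K ^ 2) ^ (K - 1)` advice numbers
  (`exists_runDigits_expand`).
* For bounded degree `d`, a component with more than `b = 2 * K * d / ε` boundary edges is compared
  with the move to its nonterminals only: there are at most `K * d` edges at its terminals, less
  than an `ε / 2` fraction of its boundary (`ratio_of_stable_small`). The terminals of the components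
  with a smaller boundary are found by a branching in which each right decision increases a minimum cut, the number of
  terminals, or the number of boundary edges decided about, so that `3 * b + 2 * K + 2` binary
  decisions suffice (`Target.searchStep`, `exists_runDigits_searchStep`).

Edge sets are matrices with entries `0` and `1`, so that edges are counted as ordered pairs and every
cardinality is doubled.

The algorithms are written in a language of expressions, assignments and bounded loops, whose
compilation to the word RAM is proved correct (`Stmt.comp_exec`). The running time follows from
the nesting of the loops (`cost_le`), and the word length from a bound on the growth of the values
(`le_and_fits`); both are syntactic, and `Admissible.exec` combines them. Arrays are addressed by
number: `0` holds the graph, `1` the terminals, `2` the edge set `S`, `3` the graph in which the search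
takes place, `4` to `8` the flow network and its forest, `9` the candidate `A`. The variables `0` to
`3` hold `n`, `k` and the numerator and denominator of `ε`; `10` holds `n ^ 2 + 1`, `12` the value
`K`, `13` and `14` the number of digits and their base, and `28` the advice.
-/

/-! ### A language of bounded loops and its compilation to the word RAM -/

namespace LoopLang
open WordRAM

/-- Arithmetic expressions over variables, literals and array entries. -/
inductive Expr where
  | var (x : ℕ)
  | lit (c : ℕ)
  | get (a : ℕ) (e : Expr)
  | bin (o : Op) (e f : Expr)

namespace Expr

instance : Add Expr := ⟨bin .add⟩
instance : Sub Expr := ⟨bin .sub⟩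
instance : Mul Expr := ⟨bin .mul⟩
instance : Div Expr := ⟨bin .div⟩

/-- The value in a state, with the truncated arithmetic of the machine and no word limit. -/
def eval : Expr → State → ℕ
  | var x, s => s.var x
  | lit c, _ => c
  | get a e, s => s.arr a (e.eval s)
  | bin o e f, s => o.eval (e.eval s) (f.eval s)

/-- Number of leaves, an exponent for the size of intermediate values. -/
def size : Expr → ℕ
  | var _ => 1
  | lit _ => 1
  | get _ e => e.size
  | bin _ e f => e.size + f.size

/-- Number of machine steps of an evaluation. -/
def time : Expr → ℕ
  | var _ => 2
  | lit _ => 1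
  | get _ e => e.time + 1
  | bin _ e f => e.time + f.time + 1

/-- A strict upper bound on the variables that occur. -/
def bound : Expr → ℕ
  | var x => x + 1
  | lit _ => 0
  | get _ e => e.bound
  | bin _ e f => max e.bound f.bound

/-- An upper bound on the literals that occur. -/
def lits : Expr → ℕ
  | var _ => 0
  | lit c => c
  | get _ e => e.lits
  | bin _ e f => max e.lits f.lits

/-- Does the value depend on the variable `x`? -/
def usesVar (x : ℕ) : Expr → Bool
  | var y => x == y
  | lit _ => false
  | get _ e => e.usesVar x
  | bin _ e f => e.usesVar x || f.usesVar x

/-- Does the value depend on the array `a`? -/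
def usesArr (a : ℕ) : Expr → Bool
  | var _ => false
  | lit _ => false
  | get b e => a == b || e.usesArr a
  | bin _ e f => e.usesArr a || f.usesArr a

/-- All intermediate values are at most `W`. -/
def Fits (W : ℕ) : Expr → State → Prop
  | var x, s => s.var x ≤ W
  | lit c, _ => c ≤ W
  | get a e, s => e.Fits W s ∧ s.arr a (e.eval s) ≤ W
  | bin o e f, s => e.Fits W s ∧ f.Fits W s ∧ o.eval (e.eval s) (f.eval s) ≤ W

/-- Code that leaves the value in register `k`, using no register below `k`. -/
def comp : Expr → ℕ → Prog
  | var x, k => .seq (.const k 0) (.arith .add k x k)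
  | lit c, k => .const k c
  | get a e, k => .seq (e.comp k) (.load k a k)
  | bin o e f, k => .seq (.seq (e.comp k) (f.comp (k + 1))) (.arith o k k (k + 1))

theorem eval_congr {e : Expr} {s s' : State} (hv : ∀ x, e.usesVar x → s.var x = s'.var x)
    (ha : ∀ a, e.usesArr a → s.arr a = s'.arr a) : e.eval s = e.eval s' := by
  induction e with
  | var x => exact hv x (by simp [usesVar])
  | lit c => rfl
  | get a e ih =>
    rw [eval, eval, ih hv (fun b hb => ha b (by simp [usesArr, hb])), ha a (by simp [usesArr])]
  | bin o e f ihe ihf =>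
    rw [eval, eval, ihe (fun x hx => hv x (by simp [usesVar, hx]))
      (fun b hb => ha b (by simp [usesArr, hb])), ihf (fun x hx => hv x (by simp [usesVar, hx]))
      (fun b hb => ha b (by simp [usesArr, hb]))]

theorem lt_bound_of_usesVar {e : Expr} {x : ℕ} (h : e.usesVar x) : x < e.bound := by
  induction e with
  | var y => simp [usesVar] at h; simp [bound, h]
  | lit c => simp [usesVar] at h
  | get a e ih => exact ih h
  | bin o e f ihe ihf =>
    simp only [usesVar, Bool.or_eq_true] at h
    rcases h with h | h
    · exact lt_max_of_lt_left (ihe h)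
    · exact lt_max_of_lt_right (ihf h)

theorem eval_congr_bound {e : Expr} {s s' : State} {k : ℕ} (hk : e.bound ≤ k)
    (hv : ∀ x < k, s.var x = s'.var x) (ha : s.arr = s'.arr) : e.eval s = e.eval s' :=
  eval_congr (fun x hx => hv x ((lt_bound_of_usesVar hx).trans_le hk)) (fun a _ => by rw [ha])

theorem fits_congr {W : ℕ} {e : Expr} {s s' : State} {k : ℕ} (hk : e.bound ≤ k)
    (hv : ∀ x < k, s.var x = s'.var x) (ha : s.arr = s'.arr) (h : e.Fits W s) : e.Fits W s' := by
  induction e with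
  | var x => simpa [Fits, ← hv x (by simp [bound] at hk; omega)] using h
  | lit c => exact h
  | get a e ih =>
    have he : e.eval s = e.eval s' := eval_congr_bound (e := e) hk hv ha
    refine ⟨ih hk h.1, ?_⟩
    rw [← he, ← ha]; exact h.2
  | bin o e f ihe ihf =>
    have h1 : e.bound ≤ k := (le_max_left _ _).trans hk
    have h2 : f.bound ≤ k := (le_max_right _ _).trans hk
    refine ⟨ihe h1 h.1, ihf h2 h.2.1, ?_⟩
    rw [← eval_congr_bound h1 hv ha, ← eval_congr_bound h2 hv ha]; exact h.2.2

theorem comp_exec {W : ℕ} (e : Expr) : ∀ (k : ℕ) (m : State), e.bound ≤ k → e.Fits W m →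
    ∃ m', Exec W (e.comp k) m e.time m' ∧ m'.var k = e.eval m ∧
      (∀ x < k, m'.var x = m.var x) ∧ m'.arr = m.arr := by
  induction e with
  | var x =>
    intro k m hk hf
    simp only [bound] at hk
    have hx : x ≠ k := by omega
    refine ⟨_, .seq (.const m k 0 (Nat.zero_le _)) (.arith _ .add k x k ?_), ?_, ?_, ?_⟩
    · simpa [State.setVar, Op.eval, hx, Fits] using hf
    · simp [State.setVar, Op.eval, eval, hx]
    · intro y hy
      simp [State.setVar, Function.update_of_ne hy.ne]
    · rfl
  | lit c =>
    intro k m hk hf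
    refine ⟨_, .const m k c hf, by simp [State.setVar, eval], ?_, rfl⟩
    intro y hy
    simp [State.setVar, Function.update_of_ne hy.ne]
  | get a e ih =>
    intro k m hk hf
    obtain ⟨m1, h1, hv, hlow, harr⟩ := ih k m hk hf.1
    refine ⟨_, .seq h1 (.load m1 k a k ?_), ?_, ?_, ?_⟩
    · rw [hv, harr]; exact hf.2
    · simp [State.setVar, eval, hv, harr]
    · intro y hy
      simp [State.setVar, Function.update_of_ne hy.ne, hlow y hy]
    · simpa [State.setVar] using harr
  | bin o e f ihe ihf =>
    intro k m hk hf
    have hke : e.bound ≤ k := (le_max_left _ _).trans hk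
    have hkf : f.bound ≤ k := (le_max_right _ _).trans hk
    obtain ⟨m1, h1, hv1, hlow1, harr1⟩ := ihe k m hke hf.1
    obtain ⟨m2, h2, hv2, hlow2, harr2⟩ := ihf (k + 1) m1 (by omega)
      (fits_congr hkf (fun x hx => (hlow1 x hx).symm) harr1.symm hf.2.1)
    have e2 : m2.var (k + 1) = f.eval m := by
      rw [hv2]; exact eval_congr_bound hkf hlow1 harr1
    have e1 : m2.var k = e.eval m := by rw [hlow2 k (by omega), hv1]
    refine ⟨_, .seq (.seq h1 h2) (.arith m2 o k k (k + 1) ?_), ?_, ?_, ?_⟩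
    · rw [e1, e2]; exact hf.2.2
    · simp [State.setVar, eval, e1, e2]
    · intro y hy
      simp [State.setVar, Function.update_of_ne hy.ne, hlow2 y (by omega), hlow1 y hy]
    · simp [State.setVar, harr2, harr1]

theorem size_pos (e : Expr) : 1 ≤ e.size := by
  induction e with
  | var x => exact le_rfl
  | lit c => exact le_rfl
  | get a e ih => exact ih
  | bin o e f ihe ihf => simp only [size]; omega

/-- Values grow at most polynomially, with the size of the expression as exponent. -/
theorem eval_le_and_fits {X : ℕ} {e : Expr} {s : State} (hX : 2 ≤ X) (hv : ∀ x, s.var x ≤ X)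
    (ha : ∀ a i, s.arr a i ≤ X) (hl : e.lits ≤ X) :
    e.eval s ≤ X ^ e.size ∧ e.Fits (X ^ e.size) s := by
  suffices h : e.eval s ≤ X ^ e.size ∧ ∀ j, e.size ≤ j → e.Fits (X ^ j) s from
    ⟨h.1, h.2 _ le_rfl⟩
  have hself : ∀ j, 1 ≤ j → X ≤ X ^ j := fun j hj => Nat.le_self_pow (by omega) X
  induction e with
  | var x => exact ⟨by simpa [size, eval] using hv x, fun j hj => (hv x).trans (hself j hj)⟩
  | lit c => exact ⟨by simpa [size, eval, lits] using hl, fun j hj => le_trans hl (hself j hj)⟩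
  | get a e ih =>
    have := ih hl
    exact ⟨(ha _ _).trans (hself _ (size_pos e)),
      fun j hj => ⟨this.2 j hj, (ha _ _).trans (hself _ ((size_pos e).trans hj))⟩⟩
  | bin o e f ihe ihf =>
    obtain ⟨h1, h1'⟩ := ihe ((le_max_left _ _).trans hl)
    obtain ⟨h2, h2'⟩ := ihf ((le_max_right _ _).trans hl)
    have key : o.eval (e.eval s) (f.eval s) ≤ X ^ (e.size + f.size) := by
      have h3 : X ^ e.size ≤ X ^ (e.size + f.size) := Nat.pow_le_pow_right (by omega) (by omega)
      cases o with
      | add =>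
        have a1 : 2 ≤ X ^ e.size := hX.trans (hself _ (size_pos e))
        have a2 : 2 ≤ X ^ f.size := hX.trans (hself _ (size_pos f))
        calc e.eval s + f.eval s ≤ X ^ e.size + X ^ f.size := add_le_add h1 h2
          _ ≤ X ^ e.size * X ^ f.size := by nlinarith
          _ = _ := (pow_add ..).symm
      | sub => exact (Nat.sub_le _ _).trans (h1.trans h3)
      | mul =>
        calc e.eval s * f.eval s ≤ X ^ e.size * X ^ f.size := Nat.mul_le_mul h1 h2
          _ = _ := (pow_add ..).symm
      | div => exact (Nat.div_le_self _ _).trans (h1.trans h3)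
    refine ⟨key, fun j hj => ?_⟩
    simp only [size] at hj
    exact ⟨h1' j (by omega), h2' j (by omega),
      key.trans (Nat.pow_le_pow_right (by omega) hj)⟩

theorem Fits.mono {W W' : ℕ} (h : W ≤ W') {e : Expr} {s : State} (he : e.Fits W s) :
    e.Fits W' s := by
  induction e with
  | var x => exact le_trans he h
  | lit c => exact le_trans he h
  | get a e ih => exact ⟨ih he.1, he.2.trans h⟩
  | bin o e f ihe ihf => exact ⟨ihe he.1, ihf he.2.1, he.2.2.trans h⟩

theorem eval_le_of_fits {W : ℕ} {e : Expr} {s : State} (h : e.Fits W s) : e.eval s ≤ W := by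
  cases e with
  | var x => exact h
  | lit c => exact h
  | get a e => exact h.2
  | bin o e f => exact h.2.2

/-- The value is at most the largest value in memory or the largest literal: the leftmost leaf
bounds a difference or a quotient. -/
def small : Expr → Bool
  | var _ => true
  | lit _ => true
  | get _ _ => true
  | bin .sub e _ => e.small
  | bin .div e _ => e.small
  | bin .add _ _ => false
  | bin .mul _ _ => false

/-- `small`, or the successor of a small expression. -/
def small1 : Expr → Bool
  | bin .add e (lit 1) => e.small
  | e => e.small

theorem eval_le_of_small {X : ℕ} {e : Expr} {s : State} (hs : e.small) (hv : ∀ x, s.var x ≤ X)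
    (ha : ∀ a i, s.arr a i ≤ X) (hl : e.lits ≤ X) : e.eval s ≤ X := by
  induction e with
  | var x => exact hv x
  | lit c => exact hl
  | get a e ih => exact ha _ _
  | bin o e f ihe ihf =>
    have hl' : e.lits ≤ X := (le_max_left _ _).trans hl
    cases o with
    | add => simp [small] at hs
    | mul => simp [small] at hs
    | sub => exact (Nat.sub_le _ _).trans (ihe hs hl')
    | div => exact (Nat.div_le_self _ _).trans (ihe hs hl')

theorem eval_le_of_small1 {X : ℕ} {e : Expr} {s : State} (hs : e.small1) (hv : ∀ x, s.var x ≤ X)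
    (ha : ∀ a i, s.arr a i ≤ X) (hl : e.lits ≤ X) : e.eval s ≤ X + 1 := by
  unfold small1 at hs
  split at hs
  · rename_i e
    simpa [eval, Op.eval] using eval_le_of_small hs hv ha ((le_max_left _ _).trans hl)
  · exact (eval_le_of_small hs hv ha hl).trans (Nat.le_succ _)

end Expr

/-- Statements. The number of rounds of a loop is fixed when it is entered. -/
inductive Stmt where
  | skip
  /-- `x := e` -/
  | set (x : ℕ) (e : Expr)
  /-- `a[e] := f` -/
  | put (a : ℕ) (e f : Expr)
  | seq (p q : Stmt)
  /-- `if e ≠ 0 then p else q` -/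
  | ite (e : Expr) (p q : Stmt)
  /-- `for x = 0, …, y - 1 do p` -/
  | loop (x y : ℕ) (p : Stmt)

namespace Stmt

/-- Sequential composition. -/
scoped infixr:60 " ;; " => Stmt.seq

/-- Iteration `i = 0, …, N - 1` of a state transformer. -/
def iter (f : ℕ → State → State) : ℕ → State → State
  | 0, s => s
  | N + 1, s => f N (iter f N s)

/-- The state transformation computed by a statement. -/
def den : Stmt → State → State
  | skip, s => s
  | set x e, s => s.setVar x (e.eval s)
  | put a e f, s => s.setArr a (e.eval s) (f.eval s)
  | seq p q, s => q.den (p.den s)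
  | ite e p q, s => if e.eval s ≠ 0 then p.den s else q.den s
  | loop x y p, s => iter (fun i s' => p.den (s'.setVar x i)) (s.var y) s

/-- An upper bound on the number of machine steps. -/
def cost : Stmt → State → ℕ
  | skip, _ => 1
  | set _ e, _ => e.time + 2
  | put _ e f, _ => e.time + f.time + 1
  | seq p q, s => p.cost s + q.cost (p.den s)
  | ite e p q, s => e.time + 1 + (if e.eval s ≠ 0 then p.cost s else q.cost s)
  | loop x y p, s => 4 + ∑ i ∈ Finset.range (s.var y),
      (p.cost ((iter (fun i s' => p.den (s'.setVar x i)) i s).setVar x i) + 7)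

/-- All values that are computed on the way are at most `W`. -/
def Fits (W : ℕ) : Stmt → State → Prop
  | skip, _ => True
  | set _ e, s => e.Fits W s
  | put _ e f, s => e.Fits W s ∧ f.Fits W s
  | seq p q, s => p.Fits W s ∧ q.Fits W (p.den s)
  | ite e p q, s => e.Fits W s ∧ if e.eval s ≠ 0 then p.Fits W s else q.Fits W s
  | loop x y p, s => s.var y ≤ W ∧ ∀ i < s.var y,
      p.Fits W ((iter (fun i s' => p.den (s'.setVar x i)) i s).setVar x i)

/-- A strict upper bound on the variables that occur. -/
def bound : Stmt → ℕ
  | skip => 0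
  | set x e => max (x + 1) e.bound
  | put _ e f => max e.bound f.bound
  | seq p q => max p.bound q.bound
  | ite e p q => max e.bound (max p.bound q.bound)
  | loop x y p => max (max (x + 1) (y + 1)) p.bound

/-- Code for a statement, using only registers from `k` on as scratch space. -/
def comp : Stmt → ℕ → Prog
  | skip, _ => .skip
  | set x e, k => .seq (e.comp k) (.seq (.const (k + 1) 0) (.arith .add x k (k + 1)))
  | put a e f, k => .seq (e.comp k) (.seq (f.comp (k + 1)) (.store a k (k + 1)))
  | seq p q, k => .seq (p.comp k) (q.comp k)
  | ite e p q, k => .seq (e.comp k) (.cond k (p.comp k) (q.comp k))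
  | loop x y p, k =>
    .seq (.seq (.const (k + 1) 0) (.arith .add k y (k + 1)))
      (.loop k (.seq (.seq (.const (k + 2) 0) (.arith .add x (k + 1) (k + 2)))
        (.seq (p.comp (k + 2)) (.seq (.const (k + 2) 1)
          (.seq (.arith .add (k + 1) (k + 1) (k + 2)) (.arith .sub k k (k + 2)))))))

/-- The machine state `m` represents `s` on the program variables. -/
def Rep (k₀ : ℕ) (s m : State) : Prop := (∀ x < k₀, s.var x = m.var x) ∧ s.arr = m.arr

theorem iter_succ (f : ℕ → State → State) (N : ℕ) (s : State) :
    iter f (N + 1) s = f N (iter f N s) := rfl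

theorem comp_exec {W k₀ : ℕ} (p : Stmt) : ∀ (k : ℕ) (s m : State), p.bound ≤ k₀ → k₀ ≤ k → 1 ≤ W →
    Rep k₀ s m → p.Fits W s →
    ∃ m' t, Exec W (p.comp k) m t m' ∧ t ≤ p.cost s ∧ Rep k₀ (p.den s) m' ∧
      ∀ x, k₀ ≤ x → x < k → m'.var x = m.var x := by
  induction p with
  | skip =>
    intro k s m _ _ _ hr _
    exact ⟨m, 1, .skip m, le_rfl, hr, fun _ _ _ => rfl⟩
  | set x e =>
    intro k s m hb hk hW hr hf
    have hbe : e.bound ≤ k₀ := (le_max_right _ _).trans hb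
    have hx : x < k₀ := lt_of_lt_of_le (Nat.lt_succ_self x) ((le_max_left _ _).trans hb)
    have hev := Expr.eval_congr_bound hbe hr.1 hr.2
    obtain ⟨m1, h1, hv1, hl1, ha1⟩ := e.comp_exec k m (hbe.trans hk)
      (Expr.fits_congr hbe hr.1 hr.2 hf)
    have hle : e.eval s ≤ W := Expr.eval_le_of_fits hf
    refine ⟨_, _, .seq h1 (.seq (.const m1 (k + 1) 0 (Nat.zero_le _))
      (.arith _ .add x k (k + 1) ?_)), ?_, ⟨?_, ?_⟩, ?_⟩
    · simpa [State.setVar, Op.eval, hv1, ← hev] using hle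
    · simp only [cost]; omega
    · intro y hy
      by_cases hyx : y = x
      · subst hyx; simp [State.setVar, Op.eval, den, hv1, hev]
      · have : y ≠ k + 1 := by omega
        simp [State.setVar, den, hyx, this, hl1 y (by omega), hr.1 y hy]
    · simp [State.setVar, den, ha1, hr.2]
    · intro y hy1 hy2
      have : y ≠ k + 1 := by omega
      have h2 : y ≠ x := by omega
      simp [State.setVar, this, h2, hl1 y hy2]
  | put a e f =>
    intro k s m hb hk hW hr hf
    have hbe : e.bound ≤ k₀ := (le_max_left _ _).trans hb
    have hbf : f.bound ≤ k₀ := (le_max_right _ _).trans hb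
    have hev := Expr.eval_congr_bound hbe hr.1 hr.2
    have hfv := Expr.eval_congr_bound hbf hr.1 hr.2
    obtain ⟨m1, h1, hv1, hl1, ha1⟩ := e.comp_exec k m (hbe.trans hk)
      (Expr.fits_congr hbe hr.1 hr.2 hf.1)
    have hr1 : Rep k₀ s m1 := ⟨fun x hx => by rw [hl1 x (by omega), hr.1 x hx], by rw [ha1, hr.2]⟩
    have hfv1 := Expr.eval_congr_bound hbf hr1.1 hr1.2
    obtain ⟨m2, h2, hv2, hl2, ha2⟩ := f.comp_exec (k + 1) m1 (by omega)
      (Expr.fits_congr hbf hr1.1 hr1.2 hf.2)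
    have hle : f.eval s ≤ W := Expr.eval_le_of_fits hf.2
    have hk2 : m2.var k = e.eval s := by rw [hl2 k (by omega), hv1, hev]
    refine ⟨_, _, .seq h1 (.seq h2 (.store m2 a k (k + 1) ?_)), ?_, ⟨?_, ?_⟩, ?_⟩
    · rw [hv2, ← hfv1]; exact hle
    · simp only [cost]; omega
    · intro y hy
      simp [State.setArr, den, hl2 y (by omega), hl1 y (by omega), hr.1 y hy]
    · simp [State.setArr, den, ha2, ha1, hr.2, hk2, hv2, ← hfv1]
    · intro y hy1 hy2
      simp [State.setArr, hl2 y (by omega), hl1 y hy2]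
  | seq p q ihp ihq =>
    intro k s m hb hk hW hr hf
    obtain ⟨m1, t1, h1, ht1, hr1, hl1⟩ := ihp k s m ((le_max_left _ _).trans hb) hk hW hr hf.1
    obtain ⟨m2, t2, h2, ht2, hr2, hl2⟩ := ihq k _ m1 ((le_max_right _ _).trans hb) hk hW hr1 hf.2
    exact ⟨m2, _, .seq h1 h2, by simp only [cost]; omega, hr2,
      fun x hx hx' => by rw [hl2 x hx hx', hl1 x hx hx']⟩
  | ite e p q ihp ihq =>
    intro k s m hb hk hW hr hf
    have hbe : e.bound ≤ k₀ := (le_max_left _ _).trans hb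
    have hbp : p.bound ≤ k₀ := ((le_max_left _ _).trans (le_max_right _ _)).trans hb
    have hbq : q.bound ≤ k₀ := ((le_max_right _ _).trans (le_max_right _ _)).trans hb
    have hev := Expr.eval_congr_bound hbe hr.1 hr.2
    obtain ⟨m1, h1, hv1, hl1, ha1⟩ := e.comp_exec k m (hbe.trans hk)
      (Expr.fits_congr hbe hr.1 hr.2 hf.1)
    have hr1 : Rep k₀ s m1 := ⟨fun x hx => by rw [hl1 x (by omega), hr.1 x hx], by rw [ha1, hr.2]⟩
    by_cases h0 : e.eval s = 0
    · have hf2 := hf.2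
      rw [if_neg (by simpa using h0)] at hf2
      obtain ⟨m2, t2, h2, ht2, hr2, hl2⟩ := ihq k s m1 hbq hk hW hr1 hf2
      refine ⟨m2, _, .seq h1 (.condFalse _ (by rw [hv1, ← hev, h0]) h2), ?_, ?_, ?_⟩
      · simp only [cost, h0]; simp; omega
      · simpa [den, h0] using hr2
      · intro x hx hx'; rw [hl2 x hx hx', hl1 x hx']
    · have hf2 := hf.2
      rw [if_pos h0] at hf2
      obtain ⟨m2, t2, h2, ht2, hr2, hl2⟩ := ihp k s m1 hbp hk hW hr1 hf2
      refine ⟨m2, _, .seq h1 (.condTrue _ (by rw [hv1, ← hev]; exact h0) h2), ?_, ?_, ?_⟩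
      · simp only [cost, if_pos h0]; omega
      · simpa [den, h0] using hr2
      · intro x hx hx'; rw [hl2 x hx hx', hl1 x hx']
  | loop x y p ih =>
    intro k s m hb hk hW hr hf
    have hbp : p.bound ≤ k₀ := (le_max_right _ _).trans hb
    have hx : x < k₀ := lt_of_lt_of_le (Nat.lt_succ_self x)
      (((le_max_left _ _).trans (le_max_left _ _)).trans hb)
    have hy : y < k₀ := lt_of_lt_of_le (Nat.lt_succ_self y)
      (((le_max_right _ _).trans (le_max_left _ _)).trans hb)
    set N := s.var y with hN
    set g := fun i s' => p.den (State.setVar s' x i) with hg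
    set c := fun i => p.cost ((iter g i s).setVar x i) + 7 with hcdef
    have hcost : (loop x y p).cost s = 4 + ∑ i ∈ Finset.range N, c i := rfl
    -- the loop proper, started with `j` rounds to go
    have main : ∀ j i (m : State), i + j = N → Rep k₀ (iter g i s) m → m.var k = j →
        m.var (k + 1) = i → ∃ m' t, Exec W (.loop k (.seq (.seq (.const (k + 2) 0)
          (.arith .add x (k + 1) (k + 2))) (.seq (p.comp (k + 2)) (.seq (.const (k + 2) 1)
          (.seq (.arith .add (k + 1) (k + 1) (k + 2)) (.arith .sub k k (k + 2))))))) m t m' ∧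
        t ≤ 1 + ∑ l ∈ Finset.Ico i N, c l ∧ Rep k₀ (iter g N s) m' ∧
        ∀ z, k₀ ≤ z → z < k → m'.var z = m.var z := by
      intro j
      induction j with
      | zero =>
        intro i m hij hr hj hi
        refine ⟨m, 1, .loopDone _ hj, by omega, ?_, fun _ _ _ => rfl⟩
        rwa [← hij]
      | succ j ihj =>
        intro i m hij hr hj hi
        have hiN : i < N := by omega
        have hNW : N ≤ W := hf.1
        -- the state in which the body starts
        set m1 := ((m.setVar (k + 2) 0).setVar x i) with hm1
        have hr1 : Rep k₀ ((iter g i s).setVar x i) m1 := by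
          refine ⟨fun z hz => ?_, by simp [hm1, State.setVar, hr.2]⟩
          by_cases hzx : z = x
          · subst hzx; simp [hm1, State.setVar]
          · have : z ≠ k + 2 := by omega
            simp [hm1, State.setVar, hzx, this, hr.1 z hz]
        obtain ⟨m2, t2, h2, ht2, hr2, hl2⟩ := ih (k + 2) _ m1 hbp (by omega) hW hr1 (hf.2 i hiN)
        have hm1k : m1.var k = j + 1 := by
          have h1 : k ≠ x := by omega
          simp [hm1, State.setVar, h1, hj]
        have hm1k1 : m1.var (k + 1) = i := by
          have h1 : k + 1 ≠ x := by omega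
          simp [hm1, State.setVar, h1, hi]
        have hm2k : m2.var k = j + 1 := by rw [hl2 k hk (by omega), hm1k]
        have hm2k1 : m2.var (k + 1) = i := by rw [hl2 (k + 1) (by omega) (by omega), hm1k1]
        replace hr2 : Rep k₀ (iter g (i + 1) s) m2 := hr2
        set m3 := ((m2.setVar (k + 2) 1).setVar (k + 1) (i + 1)).setVar k j with hm3
        have hr3 : Rep k₀ (iter g (i + 1) s) m3 := by
          refine ⟨fun z hz => ?_, by simpa [hm3, State.setVar] using hr2.2⟩
          have h1 : z ≠ k := by omega
          have h2 : z ≠ k + 1 := by omega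
          have h3 : z ≠ k + 2 := by omega
          simpa [hm3, State.setVar, h1, h2, h3] using hr2.1 z hz
        obtain ⟨m4, t4, h4, ht4, hr4, hl4⟩ := ihj (i + 1) m3 (by omega) hr3
          (by simp [hm3, State.setVar]) (by simp [hm3, State.setVar])
        have body : Exec W (.seq (.seq (.const (k + 2) 0) (.arith .add x (k + 1) (k + 2)))
            (.seq (p.comp (k + 2)) (.seq (.const (k + 2) 1)
            (.seq (.arith .add (k + 1) (k + 1) (k + 2)) (.arith .sub k k (k + 2))))))
            m (1 + 1 + (t2 + (1 + (1 + 1)))) m3 := by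
          refine .seq (s' := m1) (.seq (.const m (k + 2) 0 (Nat.zero_le _)) ?_)
            (.seq h2 (.seq (.const m2 (k + 2) 1 hW)
              (.seq (s' := (m2.setVar (k + 2) 1).setVar (k + 1) (i + 1)) ?_ ?_)))
          · have := Exec.arith (W := W) (m.setVar (k + 2) 0) .add x (k + 1) (k + 2)
              (by simp [State.setVar, Op.eval, hi]; omega)
            simpa [State.setVar, Op.eval, hi, hm1] using this
          · have := Exec.arith (W := W) (m2.setVar (k + 2) 1) .add (k + 1) (k + 1) (k + 2)
              (by simp [State.setVar, Op.eval, hm2k1]; omega)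
            simpa [State.setVar, Op.eval, hm2k1] using this
          · have := Exec.arith (W := W) ((m2.setVar (k + 2) 1).setVar (k + 1) (i + 1)) .sub k k
              (k + 2) (by simp [State.setVar, Op.eval, hm2k]; omega)
            simpa [State.setVar, Op.eval, hm2k, hm3] using this
        refine ⟨m4, _, .loopStep (by rw [hj]; omega) body h4, ?_, hr4, ?_⟩
        · rw [Finset.sum_eq_sum_Ico_succ_bot hiN]
          have : c i = p.cost ((iter g i s).setVar x i) + 7 := rfl
          omega
        · intro z hz hzk
          have h1 : z ≠ k := by omega
          have h2 : z ≠ k + 1 := by omega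
          have h3 : z ≠ k + 2 := by omega
          have h5 : z ≠ x := by omega
          rw [hl4 z hz hzk]
          have : m3.var z = m2.var z := by simp [hm3, State.setVar, h1, h2, h3]
          rw [this, hl2 z hz (by omega)]
          simp [hm1, State.setVar, h3, h5]
    set m0 := (m.setVar (k + 1) 0).setVar k N with hm0
    have hr0 : Rep k₀ (iter g 0 s) m0 := by
      refine ⟨fun z hz => ?_, by simpa [hm0, State.setVar, iter] using hr.2⟩
      have h1 : z ≠ k := by omega
      have h2 : z ≠ k + 1 := by omega
      simpa [hm0, State.setVar, h1, h2, iter] using hr.1 z hz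
    obtain ⟨m', t, h, ht, hr', hl'⟩ := main N 0 m0 (by omega) hr0 (by simp [hm0, State.setVar])
      (by simp [hm0, State.setVar])
    refine ⟨m', 1 + 1 + t, .seq (s' := m0) (.seq (.const m (k + 1) 0 (Nat.zero_le _)) ?_) h, ?_, hr', ?_⟩
    · have hyk : y ≠ k + 1 := by omega
      have := Exec.arith (W := W) (m.setVar (k + 1) 0) .add k y (k + 1)
        (by simpa [State.setVar, Op.eval, hyk, ← hr.1 y hy] using hf.1)
      simpa [State.setVar, Op.eval, hyk, ← hr.1 y hy, hm0, hN] using this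
    · rw [hcost]; rw [Finset.range_eq_Ico]; omega
    · intro z hz hzk
      have h1 : z ≠ k := by omega
      have h2 : z ≠ k + 1 := by omega
      rw [hl' z hz hzk]; simp [hm0, State.setVar, h1, h2]

end Stmt
end LoopLang

namespace LoopLang
open WordRAM
namespace Stmt

/-! ### Static analysis: frames, step counts and the growth of values -/

/-- May the statement write the variable `x`? -/
def writesVar (x : ℕ) : Stmt → Bool
  | skip => false
  | set y _ => x == y
  | put _ _ _ => false
  | seq p q => p.writesVar x || q.writesVar x
  | ite _ p q => p.writesVar x || q.writesVar x
  | loop y _ p => x == y || p.writesVar x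

/-- May the statement write the array `a`? -/
def writesArr (a : ℕ) : Stmt → Bool
  | skip => false
  | set _ _ => false
  | put b _ _ => a == b
  | seq p q => p.writesArr a || q.writesArr a
  | ite _ p q => p.writesArr a || q.writesArr a
  | loop _ _ p => p.writesArr a

theorem iter_induct {f : ℕ → State → State} {I : ℕ → State → Prop} {N : ℕ} {s : State}
    (h0 : I 0 s) (hs : ∀ i < N, ∀ s', I i s' → I (i + 1) (f i s')) : I N (iter f N s) := by
  induction N with
  | zero => exact h0
  | succ N ih => exact hs N (Nat.lt_succ_self N) _ (ih fun i hi => hs i (by omega))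

theorem loop_induct {I : ℕ → State → Prop} {x y : ℕ} {p : Stmt} {s : State} (h0 : I 0 s)
    (hs : ∀ i < s.var y, ∀ s', I i s' → I (i + 1) (p.den (s'.setVar x i))) :
    I (s.var y) ((loop x y p).den s) :=
  iter_induct h0 hs

theorem den_var {p : Stmt} {x : ℕ} (h : p.writesVar x = false) (s : State) :
    (p.den s).var x = s.var x := by
  induction p generalizing s with
  | skip => rfl
  | set y e =>
    have : x ≠ y := by simpa [writesVar] using h
    simp [den, State.setVar, this]
  | put a e f => rfl
  | seq p q ihp ihq =>
    simp only [writesVar, Bool.or_eq_false_iff] at h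
    rw [den, ihq h.2, ihp h.1]
  | ite e p q ihp ihq =>
    simp only [writesVar, Bool.or_eq_false_iff] at h
    rw [den]
    split
    · exact ihp h.1 s
    · exact ihq h.2 s
  | loop y z p ih =>
    simp only [writesVar, Bool.or_eq_false_iff] at h
    refine loop_induct (I := fun _ s' => s'.var x = s.var x) rfl fun i _ s' hs' => ?_
    have : x ≠ y := by simpa using h.1
    rw [ih h.2]
    simpa [State.setVar, this] using hs'

theorem den_arr {p : Stmt} {a : ℕ} (h : p.writesArr a = false) (s : State) :
    (p.den s).arr a = s.arr a := by
  induction p generalizing s with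
  | skip => rfl
  | set y e => rfl
  | put b e f =>
    have : a ≠ b := by simpa [writesArr] using h
    simp [den, State.setArr, this]
  | seq p q ihp ihq =>
    simp only [writesArr, Bool.or_eq_false_iff] at h
    rw [den, ihq h.2, ihp h.1]
  | ite e p q ihp ihq =>
    simp only [writesArr, Bool.or_eq_false_iff] at h
    rw [den]
    split
    · exact ihp h.1 s
    · exact ihq h.2 s
  | loop y z p ih =>
    refine loop_induct (I := fun _ s' => s'.arr a = s.arr a) rfl fun i _ s' hs' => ?_
    rw [ih h]
    simpa [State.setVar] using hs'

/-- No loop bound in `p` is written by `q`. -/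
def boundsFixedBy (q : Stmt) : Stmt → Bool
  | skip => true
  | set _ _ => true
  | put _ _ _ => true
  | seq p p' => boundsFixedBy q p && boundsFixedBy q p'
  | ite _ p p' => boundsFixedBy q p && boundsFixedBy q p'
  | loop _ y p => !q.writesVar y && boundsFixedBy q p

/-- The length of the program text, a bound on the cost of one pass. -/
def weight : Stmt → ℕ
  | skip => 1
  | set _ e => e.time + 2
  | put _ e f => e.time + f.time + 1
  | seq p q => p.weight + q.weight
  | ite e p q => e.time + 1 + (p.weight + q.weight)
  | loop _ _ p => p.weight + 11

/-- The nesting depth of loops. -/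
def depth : Stmt → ℕ
  | skip => 0
  | set _ _ => 0
  | put _ _ _ => 0
  | seq p q => max p.depth q.depth
  | ite _ p q => max p.depth q.depth
  | loop _ _ p => p.depth + 1

/-- All loop bounds in `p` are at most `X` in the state `s`. -/
def BoundsLe (X : ℕ) : Stmt → State → Prop
  | skip, _ => True
  | set _ _, _ => True
  | put _ _ _, _ => True
  | seq p q, s => p.BoundsLe X s ∧ q.BoundsLe X s
  | ite _ p q, s => p.BoundsLe X s ∧ q.BoundsLe X s
  | loop _ y p, s => s.var y ≤ X ∧ p.BoundsLe X s

theorem BoundsLe.congr {X : ℕ} {q p : Stmt} (hq : boundsFixedBy q p) {s s' : State}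
    (hs : ∀ x, q.writesVar x = false → s'.var x = s.var x) (h : p.BoundsLe X s) :
    p.BoundsLe X s' := by
  induction p with
  | skip => trivial
  | set y e => trivial
  | put b e f => trivial
  | seq p q ihp ihq =>
    simp only [boundsFixedBy, Bool.and_eq_true] at hq
    exact ⟨ihp hq.1 h.1, ihq hq.2 h.2⟩
  | ite e p q ihp ihq =>
    simp only [boundsFixedBy, Bool.and_eq_true] at hq
    exact ⟨ihp hq.1 h.1, ihq hq.2 h.2⟩
  | loop y z p ih =>
    simp only [boundsFixedBy, Bool.and_eq_true, Bool.not_eq_true'] at hq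
    exact ⟨by rw [hs z hq.1]; exact h.1, ih hq.2 h.2⟩

/-- If the loop bounds do not change during the execution and are at most `X`, then the cost is
bounded by a polynomial in `X` whose degree is the nesting depth. -/
theorem cost_le {X : ℕ} (hX : 1 ≤ X) {q : Stmt} (p : Stmt) : ∀ s : State, boundsFixedBy q p →
    (∀ x, q.writesVar x = false → p.writesVar x = false) → p.BoundsLe X s →
    p.cost s ≤ p.weight * X ^ p.depth := by
  induction p with
  | skip => intro s _ _ _; simp [cost, weight, depth]
  | set y e => intro s _ _ _; simp [cost, weight, depth]
  | put b e f => intro s _ _ _; simp [cost, weight, depth]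
  | seq p p' ihp ihq =>
    intro s hq hw h
    simp only [boundsFixedBy, Bool.and_eq_true] at hq
    simp only [writesVar, Bool.or_eq_false_iff] at hw
    have h1 := ihp s hq.1 (fun x hx => (hw x hx).1) h.1
    have h2 := ihq (p.den s) hq.2 (fun x hx => (hw x hx).2)
      (h.2.congr hq.2 fun x hx => den_var (hw x hx).1 s)
    have e1 : X ^ p.depth ≤ X ^ (max p.depth p'.depth) := Nat.pow_le_pow_right hX (le_max_left _ _)
    have e2 : X ^ p'.depth ≤ X ^ (max p.depth p'.depth) :=
      Nat.pow_le_pow_right hX (le_max_right _ _)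
    simp only [cost, weight, depth]
    nlinarith [Nat.mul_le_mul_left p.weight e1, Nat.mul_le_mul_left p'.weight e2]
  | ite e p p' ihp ihq =>
    intro s hq hw h
    simp only [boundsFixedBy, Bool.and_eq_true] at hq
    simp only [writesVar, Bool.or_eq_false_iff] at hw
    have h1 := ihp s hq.1 (fun x hx => (hw x hx).1) h.1
    have h2 := ihq s hq.2 (fun x hx => (hw x hx).2) h.2
    have e0 : 1 ≤ X ^ (max p.depth p'.depth) := Nat.one_le_pow _ _ hX
    have e1 : X ^ p.depth ≤ X ^ (max p.depth p'.depth) := Nat.pow_le_pow_right hX (le_max_left _ _)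
    have e2 : X ^ p'.depth ≤ X ^ (max p.depth p'.depth) :=
      Nat.pow_le_pow_right hX (le_max_right _ _)
    have f1 := Nat.mul_le_mul_left p.weight e1
    have f2 := Nat.mul_le_mul_left p'.weight e2
    have f0 := Nat.mul_le_mul_left (e.time + 1) e0
    simp only [cost, weight, depth]
    rw [add_mul (e.time + 1), add_mul p.weight]
    split <;> omega
  | loop y z p ih =>
    intro s hq hw h
    simp only [boundsFixedBy, Bool.and_eq_true, Bool.not_eq_true'] at hq
    simp only [writesVar, Bool.or_eq_false_iff] at hw
    have hst : ∀ i x, q.writesVar x = false →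
        (iter (fun i s' => p.den (State.setVar s' y i)) i s).var x = s.var x := fun i x hx => by
      refine iter_induct (I := fun _ s' => s'.var x = s.var x) rfl fun i _ s' hs' => ?_
      have : x ≠ y := by simpa using (hw x hx).1
      rw [den_var (hw x hx).2]
      simpa [State.setVar, this] using hs'
    have hi : ∀ i, p.cost ((iter (fun i s' => p.den (State.setVar s' y i)) i s).setVar y i) + 7 ≤
        p.weight * X ^ p.depth + 7 := fun i => by
      refine Nat.add_le_add_right (ih _ hq.2 (fun x hx => (hw x hx).2)
        (h.2.congr hq.2 fun x hx => ?_)) 7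
      have : x ≠ y := by simpa using (hw x hx).1
      simp only [State.setVar, Function.update_of_ne this]
      exact hst i x hx
    have e0 : 1 ≤ X ^ p.depth := Nat.one_le_pow _ _ hX
    simp only [cost, weight, depth]
    calc 4 + ∑ i ∈ Finset.range (s.var z),
          (p.cost ((iter (fun i s' => p.den (State.setVar s' y i)) i s).setVar y i) + 7)
        ≤ 4 + s.var z * (p.weight * X ^ p.depth + 7) := by
          refine Nat.add_le_add_left ((Finset.sum_le_card_nsmul _ _ _ fun i _ => hi i).trans ?_) 4
          simp
      _ ≤ 4 + X * (p.weight * X ^ p.depth + 7) :=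
          Nat.add_le_add_left (Nat.mul_le_mul_right _ h.1) 4
      _ ≤ (p.weight + 11) * X ^ (p.depth + 1) := by
          rw [pow_succ]
          nlinarith [Nat.mul_le_mul e0 hX]

/-- Every value written is small, so that each assignment raises the largest value in memory by
at most one. -/
def small : Stmt → Bool
  | skip => true
  | set _ e => e.small1
  | put _ _ f => f.small1
  | seq p q => p.small && q.small
  | ite _ p q => p.small && q.small
  | loop _ _ p => p.small

/-- The largest literal. -/
def lits : Stmt → ℕ
  | skip => 0
  | set _ e => e.lits
  | put _ e f => max e.lits f.lits
  | seq p q => max p.lits q.lits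
  | ite e p q => max e.lits (max p.lits q.lits)
  | loop _ _ p => p.lits

/-- The largest size of an expression. -/
def width : Stmt → ℕ
  | skip => 1
  | set _ e => e.size
  | put _ e f => max e.size f.size
  | seq p q => max p.width q.width
  | ite e p q => max e.size (max p.width q.width)
  | loop _ _ p => p.width

/-- All values in memory are at most `X`. -/
def _root_.WordRAM.State.Le (s : State) (X : ℕ) : Prop :=
  (∀ x, s.var x ≤ X) ∧ ∀ a i, s.arr a i ≤ X

theorem _root_.WordRAM.State.Le.mono {s : State} {X Y : ℕ} (h : s.Le X) (hXY : X ≤ Y) : s.Le Y :=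
  ⟨fun x => (h.1 x).trans hXY, fun a i => (h.2 a i).trans hXY⟩

theorem _root_.WordRAM.State.Le.setVar {s : State} {X x v : ℕ} (h : s.Le X) (hv : v ≤ X) :
    (s.setVar x v).Le X := by
  refine ⟨fun y => ?_, h.2⟩
  by_cases hy : y = x
  · subst hy; simpa [State.setVar] using hv
  · simpa [State.setVar, hy] using h.1 y

theorem _root_.WordRAM.State.Le.setArr {s : State} {X a i v : ℕ} (h : s.Le X) (hv : v ≤ X) :
    (s.setArr a i v).Le X := by
  refine ⟨h.1, fun b j => ?_⟩
  by_cases hb : b = a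
  · subst hb
    by_cases hj : j = i
    · subst hj; simpa [State.setArr] using hv
    · simpa [State.setArr, hj] using h.2 b j
  · simpa [State.setArr, hb] using h.2 b j

theorem iter_le {f : ℕ → State → State} {c : ℕ → ℕ} {N X : ℕ} {s : State} (hs : s.Le X)
    (h : ∀ i < N, (iter f i s).Le (X + ∑ l ∈ Finset.range i, c l) →
      (iter f (i + 1) s).Le (X + ∑ l ∈ Finset.range i, c l + c i)) :
    ∀ i ≤ N, (iter f i s).Le (X + ∑ l ∈ Finset.range i, c l) := by
  intro i
  induction i with
  | zero => intro _; simpa [iter] using hs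
  | succ i ih =>
    intro hi
    rw [Finset.sum_range_succ, ← add_assoc]
    exact h i (by omega) (ih (by omega))

/-- A small statement that starts with values at most `X` ends with values at most `X` plus its
cost, and all values on the way are polynomial in this. -/
theorem le_and_fits {Y W E : ℕ} (hY : 2 ≤ Y) (hW : Y ^ E ≤ W) (p : Stmt) :
    ∀ (X : ℕ) (s : State), p.small → p.lits ≤ X → p.width ≤ E → s.Le X → X + p.cost s ≤ Y →
      p.Fits W s ∧ (p.den s).Le (X + p.cost s) := by
  have hE : ∀ {e : Expr} {s : State}, s.Le Y → e.lits ≤ Y → e.size ≤ E → e.Fits W s :=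
    fun hs hl he => (Expr.eval_le_and_fits hY hs.1 hs.2 hl).2.mono
      ((Nat.pow_le_pow_right (by omega) he).trans hW)
  induction p with
  | skip =>
    intro X s _ _ _ hs _
    exact ⟨trivial, hs.mono (by omega)⟩
  | set y e =>
    intro X s hsm hl hw hs hX
    simp only [cost] at hX ⊢
    refine ⟨hE (hs.mono (by omega)) (hl.trans (by omega)) hw, (hs.mono (by omega)).setVar ?_⟩
    have ht : 1 ≤ e.time := by cases e <;> simp [Expr.time]
    have := Expr.eval_le_of_small1 hsm hs.1 hs.2 hl
    omega
  | put a e f =>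
    intro X s hsm hl hw hs hX
    simp only [cost] at hX ⊢
    have hl1 := (le_max_left _ _).trans hl
    have hl2 := (le_max_right _ _).trans hl
    refine ⟨⟨hE (hs.mono (by omega)) (hl1.trans (by omega)) ((le_max_left _ _).trans hw),
      hE (hs.mono (by omega)) (hl2.trans (by omega)) ((le_max_right _ _).trans hw)⟩,
      (hs.mono (by omega)).setArr ?_⟩
    have ht : 1 ≤ e.time := by cases e <;> simp [Expr.time]
    have := Expr.eval_le_of_small1 hsm hs.1 hs.2 hl2
    omega
  | seq p q ihp ihq =>
    intro X s hsm hl hw hs hX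
    simp only [small, Bool.and_eq_true] at hsm
    simp only [cost] at hX ⊢
    obtain ⟨h1, h2⟩ := ihp X s hsm.1 ((le_max_left _ _).trans hl) ((le_max_left _ _).trans hw) hs
      (by omega)
    obtain ⟨h3, h4⟩ := ihq _ _ hsm.2 (((le_max_right _ _).trans hl).trans (by omega)) ((le_max_right _ _).trans hw) h2
      (by omega)
    exact ⟨⟨h1, h3⟩, by rw [← add_assoc]; exact h4⟩
  | ite e p q ihp ihq =>
    intro X s hsm hl hw hs hX
    simp only [small, Bool.and_eq_true] at hsm
    simp only [lits, width] at hl hw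
    simp only [cost] at hX
    by_cases h0 : e.eval s ≠ 0
    · rw [if_pos h0] at hX
      obtain ⟨h1, h2⟩ := ihp X s hsm.1 (by omega) (by omega) hs (by omega)
      refine ⟨⟨hE (hs.mono (by omega)) (by omega) (by omega), by rwa [if_pos h0]⟩, ?_⟩
      rw [den, cost, if_pos h0, if_pos h0]; exact h2.mono (by omega)
    · rw [if_neg h0] at hX
      obtain ⟨h1, h2⟩ := ihq X s hsm.2 (by omega) (by omega) hs (by omega)
      refine ⟨⟨hE (hs.mono (by omega)) (by omega) (by omega), by rwa [if_neg h0]⟩, ?_⟩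
      rw [den, cost, if_neg h0, if_neg h0]; exact h2.mono (by omega)
  | loop y z p ih =>
    intro X s hsm hl hw hs hX
    set g := fun i s' => p.den (State.setVar s' y i) with hg
    set c := fun i => p.cost ((iter g i s).setVar y i) + 7 with hc
    have hcost : (loop y z p).cost s = 4 + ∑ i ∈ Finset.range (s.var z), c i := rfl
    rw [hcost] at hX ⊢
    have hsum : ∀ i ≤ s.var z, ∑ l ∈ Finset.range i, c l ≤ ∑ l ∈ Finset.range (s.var z), c l :=
      fun i hi => Finset.sum_le_sum_of_subset (Finset.range_mono hi)
    have hilen : ∀ i, i ≤ ∑ l ∈ Finset.range i, c l := fun i => by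
      calc i = ∑ l ∈ Finset.range i, 1 := by simp
        _ ≤ _ := Finset.sum_le_sum fun l _ => by simp only [hc]; omega
    have step : ∀ i < s.var z, (iter g i s).Le (X + ∑ l ∈ Finset.range i, c l) →
        p.Fits W ((iter g i s).setVar y i) ∧
        (iter g (i + 1) s).Le (X + ∑ l ∈ Finset.range i, c l + c i) := by
      intro i hi h
      have h1 : ((iter g i s).setVar y i).Le (X + ∑ l ∈ Finset.range i, c l) :=
        h.setVar ((hilen i).trans (Nat.le_add_left _ _))
      have h2 := hsum (i + 1) hi
      rw [Finset.sum_range_succ] at h2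
      have h3 : c i = p.cost ((iter g i s).setVar y i) + 7 := rfl
      obtain ⟨h4, h5⟩ := ih _ _ hsm (hl.trans (by omega)) hw h1 (by omega)
      exact ⟨h4, h5.mono (by omega)⟩
    have all := iter_le hs fun i hi h => (step i hi h).2
    refine ⟨⟨?_, fun i hi => (step i hi (all i hi.le)).1⟩, (all _ le_rfl).mono (by omega)⟩
    have hE1 : 1 ≤ E := by
      have : ∀ p : Stmt, 1 ≤ p.width := fun p => by
        induction p with
        | skip => exact le_rfl
        | set _ e => exact e.size_pos
        | put _ e f => exact e.size_pos.trans (le_max_left _ _)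
        | seq _ _ h _ => exact h.trans (le_max_left _ _)
        | ite e _ _ _ _ => exact e.size_pos.trans (le_max_left _ _)
        | loop _ _ _ h => exact h
      exact (this _).trans hw
    calc s.var z ≤ X := hs.1 z
      _ ≤ Y := by omega
      _ ≤ Y ^ E := Nat.le_self_pow (by omega) Y
      _ ≤ W := hW

end Stmt
end LoopLang

namespace LoopLang
open WordRAM

/-! ### Loop patterns: filling arrays, counting, searching -/

instance (c : ℕ) : OfNat Expr c := ⟨.lit c⟩

/-- The entry `(u, v)` of the matrix stored row by row in array `a`, where `u` and `v` are variables
and variable `0` holds the dimension. -/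
def Expr.mat (a u v : ℕ) : Expr := .get a (.var u * .var 0 + .var v)

/-- The entry of array `a` at the index held by the variable `u`. -/
def Expr.ent (a u : ℕ) : Expr := .get a (.var u)

section
variable {e f : Expr} {s : State} {x y a u v : ℕ}
@[simp] theorem Expr.eval_var : (Expr.var x).eval s = s.var x := rfl
@[simp] theorem Expr.eval_two : (2 : Expr).eval s = 2 := rfl
@[simp] theorem Expr.eval_three : (3 : Expr).eval s = 3 := rfl
@[simp] theorem Expr.eval_zero : (0 : Expr).eval s = 0 := rfl
@[simp] theorem Expr.eval_one : (1 : Expr).eval s = 1 := rfl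
@[simp] theorem Expr.eval_add : (e + f).eval s = e.eval s + f.eval s := rfl
@[simp] theorem Expr.eval_sub : (e - f).eval s = e.eval s - f.eval s := rfl
@[simp] theorem Expr.eval_mul : (e * f).eval s = e.eval s * f.eval s := rfl
@[simp] theorem Expr.eval_div : (e / f).eval s = e.eval s / f.eval s := rfl
@[simp] theorem Expr.eval_mat : (Expr.mat a u v).eval s = s.arr a (s.var u * s.var 0 + s.var v) :=
  rfl
@[simp] theorem Expr.eval_ent : (Expr.ent a u).eval s = s.arr a (s.var u) := rfl

@[simp] theorem setVar_var_self {w : ℕ} : (s.setVar x w).var x = w := by simp [State.setVar]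
theorem setVar_var_of_ne {w : ℕ} (h : y ≠ x) : (s.setVar x w).var y = s.var y := by
  simp [State.setVar, h]
@[simp] theorem setVar_var {w : ℕ} : (s.setVar x w).var y = if y = x then w else s.var y := by
  simp [State.setVar, Function.update_apply]
@[simp] theorem setVar_arr {w : ℕ} : (s.setVar x w).arr = s.arr := rfl
@[simp] theorem setArr_var {i w : ℕ} : (s.setArr a i w).var = s.var := rfl
@[simp] theorem setArr_arr_self {i w : ℕ} :
    (s.setArr a i w).arr a = Function.update (s.arr a) i w := by
  simp [State.setArr]
theorem setArr_arr_of_ne {b i w : ℕ} (h : b ≠ a) : (s.setArr a i w).arr b = s.arr b := by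
  simp [State.setArr, h]
@[simp] theorem setArr_arr {b i w : ℕ} :
    (s.setArr a i w).arr b = if b = a then Function.update (s.arr a) i w else s.arr b := by
  split
  · subst b; simp
  · exact setArr_arr_of_ne ‹_›
end

namespace Stmt

@[simp] theorem den_skip (s : State) : skip.den s = s := rfl
@[simp] theorem den_set (x : ℕ) (e : Expr) (s : State) : (set x e).den s = s.setVar x (e.eval s) :=
  rfl
@[simp] theorem den_put (a : ℕ) (e f : Expr) (s : State) :
    (put a e f).den s = s.setArr a (e.eval s) (f.eval s) := rfl
@[simp] theorem den_seq (p q : Stmt) (s : State) : (p ;; q).den s = q.den (p.den s) := rfl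
theorem den_ite (e : Expr) (p q : Stmt) (s : State) :
    (ite e p q).den s = if e.eval s ≠ 0 then p.den s else q.den s := rfl

/-- `a[x] := e` for all `x < n`. -/
def fill (x a : ℕ) (e : Expr) : Stmt := loop x 0 (put a (.var x) e)

/-- `a[x * n + y] := e` for all `x, y < n`. -/
def fill2 (x y a : ℕ) (e : Expr) : Stmt :=
  loop x 0 (loop y 0 (put a (.var x * .var 0 + .var y) e))

/-- Add to `z` the number of `x < n` with `c ≠ 0`. -/
def count (x z : ℕ) (c : Expr) : Stmt := loop x 0 (ite c (set z (.var z + 1)) skip)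

/-- Set `z` to `x + 1` for the last `x < n` with `c ≠ 0`, if there is one. -/
def find (x z : ℕ) (c : Expr) : Stmt := loop x 0 (ite c (set z (.var x + 1)) skip)

theorem fill_arr {x a : ℕ} {e : Expr} {s : State} (ha : e.usesArr a = false) {i : ℕ}
    (hi : i < s.var 0) : ((fill x a e).den s).arr a i = e.eval (s.setVar x i) := by
  have := loop_induct (x := x) (y := 0) (p := put a (.var x) e) (s := s)
    (I := fun j s' => (∀ z ≠ x, s'.var z = s.var z) ∧ (∀ b ≠ a, s'.arr b = s.arr b) ∧
      ∀ i < j, s'.arr a i = e.eval (s.setVar x i))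
    ⟨fun _ _ => rfl, fun _ _ => rfl, fun i hi => absurd hi (Nat.not_lt_zero i)⟩ ?_
  · exact this.2.2 i hi
  · rintro j hj s' ⟨h1, h2, h3⟩
    refine ⟨fun z hz => by simp [hz, h1 z hz], fun b hb => by simp [hb, h2 b hb], fun i hi => ?_⟩
    have he : e.eval (s'.setVar x j) = e.eval (s.setVar x j) := by
      refine Expr.eval_congr (fun z _ => ?_) (fun b hb => h2 b ?_)
      · by_cases hz : z = x <;> simp [hz, h1]
      · rintro rfl; simp [ha] at hb
    rcases Nat.lt_succ_iff_lt_or_eq.1 hi with hi | rfl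
    · simp [Function.update_of_ne hi.ne, h3 i hi]
    · simp [he]

theorem mul_add_inj {n u v u' v' : ℕ} (hv : v < n) (hv' : v' < n) :
    u * n + v = u' * n + v' ↔ u = u' ∧ v = v' := by
  refine ⟨fun h => ?_, fun ⟨h, h'⟩ => by rw [h, h']⟩
  have h1 := congrArg (· % n) h
  have h2 := congrArg (· / n) h
  simp only [Nat.mul_add_mod_self_right, Nat.mod_eq_of_lt hv, Nat.mod_eq_of_lt hv'] at h1
  have hn : 0 < n := by omega
  rw [Nat.add_comm, Nat.add_comm (u' * n)] at h2
  simp only [Nat.add_mul_div_right _ _ hn, Nat.div_eq_of_lt hv, Nat.div_eq_of_lt hv'] at h2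
  omega

theorem fill2_arr {x y a : ℕ} {e : Expr} {s : State} (hx : x ≠ 0) (hy : y ≠ 0) (hxy : x ≠ y)
    (ha : e.usesArr a = false) {i j : ℕ} (hi : i < s.var 0) (hj : j < s.var 0) :
    ((fill2 x y a e).den s).arr a (i * s.var 0 + j) =
      e.eval ((s.setVar x i).setVar y j) := by
  set n := s.var 0 with hn
  -- the entries processed before the pair `(k, l)`
  let J (k l : ℕ) (s' : State) : Prop :=
    (∀ z, z ≠ x → z ≠ y → s'.var z = s.var z) ∧ (∀ b ≠ a, s'.arr b = s.arr b) ∧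
      ∀ i j, j < n → (i < k ∨ i = k ∧ j < l) →
        s'.arr a (i * n + j) = e.eval ((s.setVar x i).setVar y j)
  have := loop_induct (x := x) (y := 0) (p := loop y 0 (put a (.var x * .var 0 + .var y) e))
    (s := s) (I := fun k s' => J k 0 s')
    ⟨fun _ _ _ => rfl, fun _ _ => rfl, fun i j _ h => by omega⟩ ?_
  · exact this.2.2 i j hj (Or.inl hi)
  rintro k hk s' ⟨h1, h2, h3⟩
  have h0 : (s'.setVar x k).var 0 = n := by
    rw [setVar_var_of_ne hx.symm, h1 0 hx.symm hy.symm]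
  have := loop_induct (x := y) (y := 0) (p := put a (.var x * .var 0 + .var y) e)
    (s := s'.setVar x k) (I := fun l s' => s'.var x = k ∧ J k l s')
    ⟨by simp, fun z hz hz' => by simp [hz, h1 z hz hz'], h2, h3⟩ ?_
  · refine ⟨this.2.1, this.2.2.1, fun i j hj h => this.2.2.2 i j hj ?_⟩
    rw [h0]; omega
  rw [h0]
  rintro l hl t ⟨g0, g1, g2, g3⟩
  have ht0 : t.var 0 = n := by rw [g1 0 hx.symm hy.symm]
  refine ⟨by simp [hxy, g0], fun z hz hz' => by simp [hz', g1 z hz hz'],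
    fun b hb => by simp [hb, g2 b hb], fun i j hj h => ?_⟩
  have he : e.eval (t.setVar y l) = e.eval ((s.setVar x k).setVar y l) := by
    refine Expr.eval_congr (fun z _ => ?_) (fun b hb => g2 b ?_)
    · by_cases hz : z = y
      · simp [hz]
      · by_cases hz' : z = x
        · simp [hz', hxy, g0]
        · simp [hz, hz', g1 z hz' hz]
    · rintro rfl; simp [ha] at hb
  have hval : ((put a (.var x * .var 0 + .var y) e).den (t.setVar y l)).arr a =
      Function.update (t.arr a) (k * n + l) (e.eval ((s.setVar x k).setVar y l)) := by
    simp [hxy, hy.symm, g0, ht0, he]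
  rw [hval]
  by_cases hij : i = k ∧ j = l
  · rw [hij.1, hij.2, Function.update_self]
  · rw [Function.update_of_ne (fun hh => hij ((mul_add_inj hj hl).1 hh)), g3 i j hj (by omega)]

theorem count_var {x z : ℕ} {c : Expr} {s : State} (hxz : x ≠ z)
    (hc : c.usesVar z = false) :
    ((count x z c).den s).var z = s.var z +
      ((Finset.range (s.var 0)).filter fun i => c.eval (s.setVar x i) ≠ 0).card := by
  have := loop_induct (x := x) (y := 0) (p := ite c (set z (.var z + 1)) skip) (s := s)
    (I := fun j s' => (∀ w, w ≠ x → w ≠ z → s'.var w = s.var w) ∧ s'.arr = s.arr ∧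
      s'.var z = s.var z +
        ((Finset.range j).filter fun i => c.eval (s.setVar x i) ≠ 0).card)
    ⟨fun _ _ _ => rfl, rfl, by simp⟩ ?_
  · exact this.2.2
  · rintro j hj s' ⟨h1, h2, h3⟩
    have he : c.eval (s'.setVar x j) = c.eval (s.setVar x j) := by
      refine Expr.eval_congr (fun w hw => ?_) (fun b hb => by simp [h2])
      by_cases hwx : w = x
      · simp [hwx]
      · have : w ≠ z := by rintro rfl; simp [hc] at hw
        simp [hwx, h1 w hwx this]
    rw [den_ite, he, Finset.range_add_one, Finset.filter_insert]
    split
    · refine ⟨fun w hw hw' => by simp [hw, hw', h1 w hw hw'], by simpa using h2, ?_⟩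
      rw [Finset.card_insert_of_notMem (by simp)]
      simp [hxz.symm, h3]; ring
    · exact ⟨fun w hw hw' => by simp [hw, h1 w hw hw'], by simpa using h2,
        by simp [hxz.symm, h3]⟩

theorem find_var {x z : ℕ} {c : Expr} {s : State} (hxz : x ≠ z) (hc : c.usesVar z = false) :
    (((find x z c).den s).var z = s.var z ∧ ∀ i < s.var 0, c.eval (s.setVar x i) = 0) ∨
    ∃ i < s.var 0, ((find x z c).den s).var z = i + 1 ∧ c.eval (s.setVar x i) ≠ 0 ∧
      ∀ j < s.var 0, c.eval (s.setVar x j) ≠ 0 → j ≤ i := by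
  have := loop_induct (x := x) (y := 0) (p := ite c (set z (.var x + 1)) skip) (s := s)
    (I := fun k s' => (∀ w, w ≠ x → w ≠ z → s'.var w = s.var w) ∧ s'.arr = s.arr ∧
      ((s'.var z = s.var z ∧ ∀ i < k, c.eval (s.setVar x i) = 0) ∨
      ∃ i < k, s'.var z = i + 1 ∧ c.eval (s.setVar x i) ≠ 0 ∧
        ∀ j < k, c.eval (s.setVar x j) ≠ 0 → j ≤ i))
    ⟨fun _ _ _ => rfl, rfl, Or.inl ⟨rfl, fun i hi => absurd hi (Nat.not_lt_zero i)⟩⟩ ?_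
  · exact this.2.2
  · rintro k hk s' ⟨h1, h2, h3⟩
    have he : c.eval (s'.setVar x k) = c.eval (s.setVar x k) := by
      refine Expr.eval_congr (fun w hw => ?_) (fun b hb => by simp [h2])
      by_cases hwx : w = x
      · simp [hwx]
      · have : w ≠ z := by rintro rfl; simp [hc] at hw
        simp [hwx, h1 w hwx this]
    rw [den_ite, he]
    split
    · rename_i h0
      refine ⟨fun w hw hw' => by simp [hw, hw', h1 w hw hw'], by simpa using h2, Or.inr
        ⟨k, by omega, by simp, h0, fun j hj _ => by omega⟩⟩
    · rename_i h0
      refine ⟨fun w hw hw' => by simp [hw, h1 w hw hw'], by simpa using h2, ?_⟩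
      rcases h3 with ⟨h3, h4⟩ | ⟨i, hi, h3, h4, h5⟩
      · refine Or.inl ⟨by simp [hxz.symm, h3], fun i hi => ?_⟩
        rcases Nat.lt_succ_iff_lt_or_eq.1 hi with hi | rfl
        · exact h4 i hi
        · simpa using h0
      · refine Or.inr ⟨i, by omega, by simp [hxz.symm, h3], h4, fun j hj hj' => ?_⟩
        rcases Nat.lt_succ_iff_lt_or_eq.1 hj with hj | rfl
        · exact h5 j hj hj'
        · exact absurd hj' h0

end Stmt
end LoopLang

/-! ### Minimum cuts by augmenting paths -/

section Cuts
variable {V : Type*} [Fintype V] [DecidableEq V]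

/-- The capacity of the cut `W` in a network with residual capacities `src v` from the source to
`v` and `r u v` from `u` to `v`: the source lies on the side of `W`. -/
def cutVal (src : V → ℕ) (r : V → V → ℕ) (W : Finset V) : ℕ :=
  ∑ v ∈ Wᶜ, src v + ∑ u ∈ W, ∑ v ∈ Wᶜ, r u v

/-- `Z` contains everything that can be reached from the source along positive capacities. -/
def FlowClosed (src : V → ℕ) (r : V → V → ℕ) (Z : Finset V) : Prop :=
  (∀ v, src v ≠ 0 → v ∈ Z) ∧ ∀ u ∈ Z, ∀ v, r u v ≠ 0 → v ∈ Z

theorem cutVal_eq_zero {src : V → ℕ} {r : V → V → ℕ} {Z : Finset V} :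
    cutVal src r Z = 0 ↔ FlowClosed src r Z := by
  simp only [cutVal, Nat.add_eq_zero_iff, Finset.sum_eq_zero_iff, Finset.mem_compl, FlowClosed]
  constructor
  · rintro ⟨h1, h2⟩
    exact ⟨fun v hv => by_contra fun h => hv (h1 v h),
      fun u hu v hv => by_contra fun h => hv (h2 u hu v h)⟩
  · rintro ⟨h1, h2⟩
    exact ⟨fun v hv => by_contra fun h => hv (h1 v h),
      fun u hu v hv => by_contra fun h => hv (h2 u hu v h)⟩

/-- Send one unit of flow along the pair `(p, w)`. -/
def pushUnit (r : V → V → ℕ) (p w : V) : V → V → ℕ := fun u v =>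
  if u = w ∧ v = p then r u v + 1 else if u = p ∧ v = w then r u v - 1 else r u v

/-- A unit of flow along `(p, w)` shifts the capacity of a cut by whether `p` and `w` lie in it, so
that along a path only the ends of the path count. -/
theorem cutVal_pushUnit {src : V → ℕ} {r : V → V → ℕ} {p w : V} (hpw : p ≠ w) (hr : r p w ≠ 0)
    (W : Finset V) :
    cutVal src (pushUnit r p w) W + (if p ∈ W then 1 else 0) =
      cutVal src r W + (if w ∈ W then 1 else 0) := by
  have key : ∀ u v, pushUnit r p w u v + (if u = p then if v = w then 1 else 0 else 0) =
      r u v + (if u = w then if v = p then 1 else 0 else 0) := by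
    intro u v
    unfold pushUnit
    by_cases h1 : u = w ∧ v = p
    · obtain ⟨rfl, rfl⟩ := h1
      simp [hpw.symm]
    · rw [if_neg h1]
      by_cases h2 : u = p ∧ v = w
      · obtain ⟨rfl, rfl⟩ := h2
        simp [hpw]; omega
      · rw [if_neg h2]
        have e1 : (if u = p then if v = w then 1 else 0 else 0) = 0 := by
          split_ifs <;> simp_all
        have e2 : (if u = w then if v = p then 1 else 0 else 0) = 0 := by
          split_ifs <;> simp_all
        rw [e1, e2]
  have hsum : ∑ u ∈ W, ∑ v ∈ Wᶜ, pushUnit r p w u v +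
      (if p ∈ W then if w ∈ W then 0 else 1 else 0) =
      ∑ u ∈ W, ∑ v ∈ Wᶜ, r u v + (if w ∈ W then if p ∈ W then 0 else 1 else 0) := by
    have := Finset.sum_congr (rfl : W = W) fun u _ =>
      Finset.sum_congr (rfl : Wᶜ = Wᶜ) fun v _ => key u v
    simp only [Finset.sum_add_distrib] at this
    have aux : ∀ a b : V, ∑ u ∈ W, ∑ v ∈ Wᶜ, (if u = a then if v = b then 1 else 0 else 0) =
        if a ∈ W then if b ∈ W then 0 else 1 else 0 := by
      intro a b
      have h1 : ∀ u, ∑ v ∈ Wᶜ, (if u = a then if v = b then 1 else 0 else 0) =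
          if u = a then if b ∈ W then 0 else 1 else 0 := by
        intro u
        split_ifs with h2 h3
        · simp [h3]
        · simp [h3]
        · simp
      rw [Finset.sum_congr rfl fun u _ => h1 u]
      simp
    rw [aux, aux] at this
    exact this
  unfold cutVal
  by_cases h1 : p ∈ W <;> by_cases h2 : w ∈ W <;> simp only [h1, h2, if_true, if_false] at hsum ⊢ <;>
    omega

/-- Decrease the capacity from the source to `w` by one. -/
theorem cutVal_update_src {src : V → ℕ} {r : V → V → ℕ} {w : V} (hw : src w ≠ 0) (W : Finset V) :
    cutVal (Function.update src w (src w - 1)) r W + 1 =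
      cutVal src r W + (if w ∈ W then 1 else 0) := by
  unfold cutVal
  by_cases h : w ∈ W
  · have : ∑ v ∈ Wᶜ, Function.update src w (src w - 1) v = ∑ v ∈ Wᶜ, src v :=
      Finset.sum_congr rfl fun v hv => Function.update_of_ne (by
        rintro rfl; exact (Finset.mem_compl.1 hv) h) _ _
    rw [this, if_pos h]
  · have hw' : w ∈ Wᶜ := Finset.mem_compl.2 h
    rw [← Finset.add_sum_erase _ _ hw', ← Finset.add_sum_erase _ src hw']
    have : ∑ v ∈ Wᶜ.erase w, Function.update src w (src w - 1) v = ∑ v ∈ Wᶜ.erase w, src v :=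
      Finset.sum_congr rfl fun v hv => Function.update_of_ne (Finset.ne_of_mem_erase hv) _ _
    rw [this, if_neg h, Function.update_self]
    omega

/-- `k` and `par` describe a forest of paths from the source: `k v = 0` if `v` is not in the forest,
`k v = 1` if `v` is a root, and otherwise `par v` precedes `v` and `k v` is the position on the
path. -/
structure IsForest {n : ℕ} (src : Fin n → ℕ) (r : Fin n → Fin n → ℕ) (k par : Fin n → ℕ) :
    Prop where
  root : ∀ v, src v ≠ 0 → k v ≠ 0
  src_ne : ∀ v, k v = 1 → src v ≠ 0
  parent : ∀ v, 2 ≤ k v → ∃ p : Fin n, par v = p ∧ k p + 1 = k v ∧ r p v ≠ 0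
  card : ∀ v, k v ≤ (Finset.univ.filter fun u => k u ≠ 0).card

theorem IsForest.mem_of_flowClosed {n : ℕ} {src : Fin n → ℕ} {r : Fin n → Fin n → ℕ}
    {k par : Fin n → ℕ} (h : IsForest src r k par) {Z : Finset (Fin n)} (hZ : FlowClosed src r Z)
    {v : Fin n} (hv : k v ≠ 0) : v ∈ Z := by
  suffices ∀ j v, k v = j + 1 → v ∈ Z from this (k v - 1) v (by omega)
  intro j
  induction j with
  | zero => exact fun v hv => hZ.1 v (h.src_ne v hv)
  | succ j ih =>
    intro v hv
    obtain ⟨p, -, hp, hr⟩ := h.parent v (by omega)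
    exact hZ.2 p (ih p (by omega)) v hr

/-- Attach a new leaf `v` below `u`. -/
theorem IsForest.attach {n : ℕ} {src : Fin n → ℕ} {r : Fin n → Fin n → ℕ}
    {k par : Fin n → ℕ} (h : IsForest src r k par) {u v : Fin n} (hu : k u ≠ 0) (hv : k v = 0)
    (hr : r u v ≠ 0) :
    IsForest src r (Function.update k v (k u + 1)) (Function.update par v u) := by
  have huv : u ≠ v := by rintro rfl; exact hu hv
  refine ⟨fun w hw => ?_, fun w hw => ?_, fun w hw => ?_, fun w => ?_⟩
  · by_cases hwv : w = v
    · subst hwv; simp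
    · simpa [hwv] using h.root w hw
  · by_cases hwv : w = v
    · subst hwv; simp at hw; exact absurd hw hu
    · exact h.src_ne w (by simpa [hwv] using hw)
  · by_cases hwv : w = v
    · subst hwv; exact ⟨u, by simp, by simp [huv], hr⟩
    · rw [Function.update_of_ne hwv] at hw
      obtain ⟨p, h1, h2, h3⟩ := h.parent w hw
      have hpv : p ≠ v := by rintro rfl; omega
      exact ⟨p, by simp [hwv, h1], by simp [hpv, hwv, h2], h3⟩
  · have hs : (Finset.univ.filter fun w => Function.update k v (k u + 1) w ≠ 0) =
        insert v (Finset.univ.filter fun w => k w ≠ 0) := by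
      ext w
      by_cases hwv : w = v <;> simp [hwv]
    rw [hs, Finset.card_insert_of_notMem (by simp [hv])]
    by_cases hwv : w = v
    · subst hwv; simpa using h.card u
    · simpa [hwv] using (h.card w).trans (Nat.le_succ _)

end Cuts

namespace LoopLang
open WordRAM

/-- The first `n` entries of array `a`. -/
def row (s : State) (a n : ℕ) : Fin n → ℕ := fun v => s.arr a v

/-- The `n × n` matrix stored row by row in array `a`. -/
def grid (s : State) (a n : ℕ) : Fin n → Fin n → ℕ := fun u v => s.arr a (u * n + v)

theorem row_setArr {s : State} {a b n : ℕ} (v : Fin n) (w : ℕ) :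
    row (s.setArr a v w) b n = if b = a then Function.update (row s a n) v w else row s b n := by
  ext i
  by_cases h : b = a
  · subst h
    by_cases hi : i = v
    · subst hi; simp [row]
    · have : (i : ℕ) ≠ v := fun h => hi (Fin.ext h)
      simp [row, hi, this]
  · simp [row, h]

theorem grid_setArr {s : State} {a b n : ℕ} (u v : Fin n) (w : ℕ) :
    grid (s.setArr a (u * n + v) w) b n =
      if b = a then fun i j => if i = u ∧ j = v then w else grid s a n i j else grid s b n := by
  ext i j
  by_cases h : b = a
  · subst h
    by_cases hi : i = u ∧ j = v
    · obtain ⟨rfl, rfl⟩ := hi; simp [grid]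
    · have : (i : ℕ) * n + j ≠ u * n + v := fun h => hi <| by
        have := (Stmt.mul_add_inj j.2 v.2).1 h
        exact ⟨Fin.ext this.1, Fin.ext this.2⟩
      simp [grid, hi, this]
  · simp [grid, h]

theorem row_congr {s t : State} {a b n : ℕ} (h : s.arr a = t.arr b) : row s a n = row t b n := by
  ext i; simp [row, h]

theorem grid_congr {s t : State} {a b n : ℕ} (h : s.arr a = t.arr b) : grid s a n = grid t b n := by
  ext i j; simp [grid, h]

namespace Stmt
open LoopLang.Expr

/-- If `u` is reached (array `7`) and has positive capacity (array `5`) to `v`, which is not, then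
reach `v` from `u`. The vertices are in the variables `20` and `21`. -/
def relax : Stmt :=
  ite (ent 7 20 * mat 5 20 21 * (1 - ent 7 21))
    (put 7 (.var 21) (ent 7 20 + 1) ;; put 8 (.var 21) (.var 20)) skip

/-- Compute in arrays `7` and `8` a forest of paths from the source that spans everything which can
be reached. The capacities are in arrays `4` and `5`. -/
def reach : Stmt :=
  fill 20 7 (1 - (1 - ent 4 20)) ;; loop 22 0 (loop 20 0 (loop 21 0 relax))

/-- The arrays `7` and `8` hold a forest for the network in arrays `4` and `5`. -/
def HasForest (n : ℕ) (src : Fin n → ℕ) (r : Fin n → Fin n → ℕ) (s : State) : Prop :=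
  s.var 0 = n ∧ row s 4 n = src ∧ grid s 5 n = r ∧ IsForest src r (row s 7 n) (row s 8 n)

/-- The vertices with nonzero entry in array `a`. -/
def supp (s : State) (a n : ℕ) : Finset (Fin n) := Finset.univ.filter fun v => row s a n v ≠ 0

theorem mem_supp {s : State} {a n : ℕ} {v : Fin n} : v ∈ supp s a n ↔ s.arr a v ≠ 0 := by
  rw [supp, Finset.mem_filter]
  exact ⟨fun h => h.2, fun h => ⟨Finset.mem_univ _, h⟩⟩

theorem supp_congr {s t : State} {a b n : ℕ} (h : s.arr a = t.arr b) : supp s a n = supp t b n := by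
  simp [supp, row_congr h]

theorem relax_spec {n : ℕ} {src : Fin n → ℕ} {r : Fin n → Fin n → ℕ} {s : State}
    (h : HasForest n src r s) {u v : Fin n} (hu : s.var 20 = u) (hv : s.var 21 = v) :
    HasForest n src r (relax.den s) ∧ supp s 7 n ⊆ supp (relax.den s) 7 n ∧
      (u ∈ supp s 7 n → r u v ≠ 0 → v ∈ supp (relax.den s) 7 n) := by
  obtain ⟨h0, h1, h2, h3⟩ := h
  have hr : s.arr 5 (u * n + v) = r u v := by rw [← h2]; rfl
  have hc : (ent 7 20 * mat 5 20 21 * (1 - ent 7 21)).eval s =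
      row s 7 n u * r u v * (1 - row s 7 n v) := by
    simp [hu, hv, h0, hr, row]
  rw [relax, den_ite, hc]
  split
  · rename_i hne
    have hku : row s 7 n u ≠ 0 := by intro h; simp [h] at hne
    have hruv : r u v ≠ 0 := by intro h; simp [h] at hne
    have hkv : row s 7 n v = 0 := by
      by_contra h
      have : 1 - row s 7 n v = 0 := by omega
      simp [this] at hne
    have e : (put 7 (.var 21) (ent 7 20 + 1) ;; put 8 (.var 21) (.var 20)).den s =
        (s.setArr 7 v (row s 7 n u + 1)).setArr 8 v u := by
      simp [hu, hv, row]
    rw [e]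
    refine ⟨⟨h0, ?_, ?_, ?_⟩, ?_, ?_⟩
    · simp [row_setArr, h1]
    · rw [← h2]; exact grid_congr (by simp)
    · have := h3.attach hku hkv hruv
      simpa [row_setArr] using this
    · intro w
      simp only [supp, row_setArr, Finset.mem_filter, Finset.mem_univ, true_and]
      by_cases hw : w = v <;> simp [hw]
    · intro _ _
      simp [supp, row_setArr]
  · rename_i hne
    refine ⟨⟨h0, h1, h2, h3⟩, Finset.Subset.refl _, fun hu hr => ?_⟩
    by_contra hv
    simp only [supp, Finset.mem_filter, Finset.mem_univ, true_and, not_not] at hu hv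
    rw [den_skip] at hv
    simp [hv, hu, hr] at hne

theorem relax_round {n : ℕ} {src : Fin n → ℕ} {r : Fin n → Fin n → ℕ} {s : State}
    (h : HasForest n src r s) :
    HasForest n src r ((loop 20 0 (loop 21 0 relax)).den s) ∧
      supp s 7 n ⊆ supp ((loop 20 0 (loop 21 0 relax)).den s) 7 n ∧
      ∀ u ∈ supp s 7 n, ∀ v, r u v ≠ 0 → v ∈ supp ((loop 20 0 (loop 21 0 relax)).den s) 7 n := by
  have hset : ∀ {s : State} {x w : ℕ}, x ≠ 0 → HasForest n src r s → HasForest n src r (s.setVar x w) :=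
    fun hx h => ⟨by rw [setVar_var_of_ne hx.symm, h.1], h.2⟩
  have := loop_induct (x := 20) (y := 0) (p := loop 21 0 relax) (s := s)
    (I := fun i s' => HasForest n src r s' ∧ supp s 7 n ⊆ supp s' 7 n ∧
      ∀ u ∈ supp s 7 n, (u : ℕ) < i → ∀ v, r u v ≠ 0 → v ∈ supp s' 7 n)
    ⟨h, Finset.Subset.refl _, fun u _ hu => absurd hu (Nat.not_lt_zero _)⟩ ?_
  · exact ⟨this.1, this.2.1, fun u hu => this.2.2 u hu (by rw [h.1]; exact u.2)⟩
  rintro i hi s1 ⟨g1, g2, g3⟩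
  rw [h.1] at hi
  have h0 : (s1.setVar 20 i).var 0 = n := (hset (by omega) g1).1
  have := loop_induct (x := 21) (y := 0) (p := relax) (s := s1.setVar 20 i)
    (I := fun j s' => s'.var 20 = i ∧ HasForest n src r s' ∧ supp s1 7 n ⊆ supp s' 7 n ∧
      ((⟨i, hi⟩ : Fin n) ∈ supp s 7 n → ∀ v : Fin n, (v : ℕ) < j → r ⟨i, hi⟩ v ≠ 0 →
        v ∈ supp s' 7 n))
    ⟨by simp, hset (by omega) g1, Finset.Subset.refl _, fun _ v hv => absurd hv (Nat.not_lt_zero _)⟩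
    ?_
  · obtain ⟨-, f1, f2, f3⟩ := this
    refine ⟨f1, g2.trans f2, fun u hu hui v hv => ?_⟩
    rcases Nat.lt_succ_iff_lt_or_eq.1 hui with hui | rfl
    · exact f2 (g3 u hu hui v hv)
    · exact f3 hu v (by rw [h0]; exact v.2) hv
  rintro j hj s2 ⟨f0, f1, f2, f3⟩
  rw [h0] at hj
  obtain ⟨e1, e2, e3⟩ := relax_spec (hset (x := 21) (w := j) (by omega) f1) (u := ⟨i, hi⟩)
    (v := ⟨j, hj⟩) (by simpa using f0) (by simp)
  refine ⟨?_, e1, f2.trans e2, fun hu v hvj hv => ?_⟩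
  · rw [den_var rfl]; simpa using f0
  · rcases Nat.lt_succ_iff_lt_or_eq.1 hvj with hvj | hvj
    · exact e2 (f3 hu v hvj hv)
    · obtain rfl : v = ⟨j, hj⟩ := Fin.ext hvj
      exact e3 (f2 (g2 hu)) hv

theorem reach_spec {n : ℕ} {src : Fin n → ℕ} {r : Fin n → Fin n → ℕ} {s : State}
    (h0 : s.var 0 = n) (hsrc : row s 4 n = src) (hr : grid s 5 n = r) :
    HasForest n src r (reach.den s) ∧ FlowClosed src r (supp (reach.den s) 7 n) := by
  set s1 := (fill 20 7 (1 - (1 - ent 4 20))).den s with hs1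
  have hk : ∀ v : Fin n, row s1 7 n v = 1 - (1 - src v) := fun v => by
    rw [row, hs1, fill_arr rfl (by rw [h0]; exact v.2), ← hsrc]
    simp [row]
  have h1 : HasForest n src r s1 := by
    refine ⟨by rw [den_var rfl, h0], by rw [← hsrc]; exact row_congr (den_arr rfl s),
      by rw [← hr]; exact grid_congr (den_arr rfl s), ?_⟩
    refine ⟨fun v hv => by rw [hk]; omega, fun v hv => by rw [hk] at hv; omega,
      fun v hv => by rw [hk] at hv; omega, fun v => ?_⟩
    by_cases hv : row s1 7 n v = 0
    · rw [hv]; exact Nat.zero_le _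
    · calc row s1 7 n v ≤ 1 := by rw [hk]; omega
        _ ≤ _ := Finset.card_pos.2 ⟨v, by simpa using hv⟩
  have := loop_induct (x := 22) (y := 0) (p := loop 20 0 (loop 21 0 relax)) (s := s1)
    (I := fun i s' => HasForest n src r s' ∧
      (FlowClosed src r (supp s' 7 n) ∨ i ≤ (supp s' 7 n).card)) ⟨h1, Or.inr (Nat.zero_le _)⟩ ?_
  · refine ⟨this.1, this.2.elim id fun h => ?_⟩
    have hall : supp ((loop 22 0 (loop 20 0 (loop 21 0 relax))).den s1) 7 n = Finset.univ := by
      refine Finset.eq_univ_of_card _ (le_antisymm (Finset.card_le_univ _) ?_)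
      rw [h1.1] at h
      simpa using h
    change FlowClosed src r (supp ((loop 22 0 (loop 20 0 (loop 21 0 relax))).den s1) 7 n)
    rw [hall]
    exact ⟨fun _ _ => Finset.mem_univ _, fun _ _ _ _ => Finset.mem_univ _⟩
  · rintro i hi s' ⟨g1, g2⟩
    have g1' : HasForest n src r (s'.setVar 22 i) :=
      ⟨by rw [setVar_var_of_ne (by omega), g1.1], g1.2⟩
    obtain ⟨f1, f2, f3⟩ := relax_round g1'
    refine ⟨f1, ?_⟩
    by_cases hcl : FlowClosed src r (supp s' 7 n)
    · left
      have : supp ((loop 20 0 (loop 21 0 relax)).den (s'.setVar 22 i)) 7 n = supp s' 7 n :=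
        Finset.Subset.antisymm
          (fun v hv => f1.2.2.2.mem_of_flowClosed hcl (by simpa [supp] using hv)) f2
      rwa [this]
    · right
      have hroot : ∀ v, src v ≠ 0 → v ∈ supp s' 7 n := fun v hv => by
        simpa [supp] using g1.2.2.2.root v hv
      obtain ⟨u, hu, v, hv, hvn⟩ : ∃ u ∈ supp s' 7 n, ∃ v, r u v ≠ 0 ∧ v ∉ supp s' 7 n := by
        by_contra hcon
        push Not at hcon
        exact hcl ⟨hroot, hcon⟩
      have hlt := Finset.card_lt_card (Finset.ssubset_iff_subset_ne.2
        ⟨f2, fun h => hvn (by have h' := f3 u hu v hv; rw [← h] at h'; exact h')⟩)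
      have := g2.resolve_left hcl
      have e : supp (s'.setVar 22 i) 7 n = supp s' 7 n := rfl
      rw [e] at hlt
      omega

/-- One step back along the forest from the vertex in variable `24`, pushing a unit of flow. -/
def walkStep : Stmt :=
  ite (ent 7 24 - 1) (set 25 (ent 8 24) ;;
    put 5 (.var 25 * .var 0 + .var 24) (mat 5 25 24 - 1) ;;
    put 5 (.var 24 * .var 0 + .var 25) (mat 5 24 25 + 1) ;; set 24 (.var 25)) skip

/-- If the forest contains a sink (array `6`), push one unit of flow along the path to it. -/
def augment : Stmt :=
  set 23 0 ;; find 20 23 (ent 7 20 * ent 6 20) ;;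
  ite (.var 23) (set 24 (.var 23 - 1) ;; loop 22 0 walkStep ;; put 4 (.var 24) (ent 4 24 - 1)) skip

/-- Find a minimum cut by `n ^ 2 + 1` (variable `10`) augmentations: on exit, the support of
array `7` is the set that can be reached from the source in the residual network. -/
def flow : Stmt := loop 26 10 (reach ;; augment) ;; reach

/-- The state of the walk back from the sink `t` when it stands in `w`, after `i` steps. -/
structure WalkInv {n : ℕ} (src : Fin n → ℕ) (r : Fin n → Fin n → ℕ) (k par : Fin n → ℕ)
    (t : Fin n) (i : ℕ) (s : State) (w : Fin n) : Prop where
  dim : s.var 0 = n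
  src_eq : row s 4 n = src
  rank_eq : row s 7 n = k
  par_eq : row s 8 n = par
  here : s.var 24 = w
  pos : k w ≠ 0
  dec : k w = 1 ∨ k w + i ≤ k t
  le : ∀ u v, k v ≤ k w → r u v ≤ grid s 5 n u v
  cut : ∀ W, t ∉ W → cutVal src (grid s 5 n) W + (if w ∈ W then 1 else 0) = cutVal src r W

theorem walkStep_spec {n : ℕ} {src : Fin n → ℕ} {r : Fin n → Fin n → ℕ} {k par : Fin n → ℕ}
    (hf : IsForest src r k par) {t : Fin n} {i : ℕ} {s : State} {w : Fin n}
    (h : WalkInv src r k par t i s w) : ∃ w', WalkInv src r k par t (i + 1) (walkStep.den s) w' := by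
  have hkw : s.arr 7 w = k w := by rw [← h.rank_eq]; rfl
  rw [walkStep, den_ite]
  split
  · rename_i hc
    have hk2 : 2 ≤ k w := by
      simp [h.here, hkw] at hc; omega
    obtain ⟨p, hp, hkp, hr⟩ := hf.parent w hk2
    have hpw : p ≠ w := by rintro rfl; omega
    have hpar : s.arr 8 w = p := by rw [← hp, ← h.par_eq]; rfl
    have hg : ∀ u v : Fin n, s.arr 5 (u * n + v) = grid s 5 n u v := fun _ _ => rfl
    set s' := (set 25 (ent 8 24) ;;
      put 5 (.var 25 * .var 0 + .var 24) (mat 5 25 24 - 1) ;;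
      put 5 (.var 24 * .var 0 + .var 25) (mat 5 24 25 + 1) ;; set 24 (.var 25)).den s with hs'
    have hidx : (w : ℕ) * n + p ≠ p * n + w := fun hh =>
      hpw (Fin.ext ((mul_add_inj p.2 w.2).1 hh).2)
    have he : s' = ((((s.setVar 25 p).setArr 5 (p * n + w) (grid s 5 n p w - 1)).setArr 5
        (w * n + p) (grid s 5 n w p + 1)).setVar 24 p) := by
      simp [hs', h.here, hpar, h.dim, hg, hidx]
    have hgrid : grid s' 5 n = pushUnit (grid s 5 n) p w := by
      rw [he]
      have : ∀ (s : State) x v, grid (s.setVar x v) 5 n = grid s 5 n := fun _ _ _ => rfl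
      rw [this, grid_setArr, if_pos rfl, grid_setArr, if_pos rfl]
      ext u v
      simp only [pushUnit, this]
      by_cases h1 : u = w ∧ v = p
      · obtain ⟨rfl, rfl⟩ := h1; simp
      · simp only [h1, if_false]
        by_cases h2 : u = p ∧ v = w
        · obtain ⟨rfl, rfl⟩ := h2; simp
        · simp [h2]
    have hle := h.le p w le_rfl
    refine ⟨p, ⟨by simp [he, h.dim], ?_, ?_, ?_, by simp [he], by omega, ?_, ?_, ?_⟩⟩
    · rw [← h.src_eq]; exact row_congr (by simp [he])
    · rw [← h.rank_eq]; exact row_congr (by simp [he])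
    · rw [← h.par_eq]; exact row_congr (by simp [he])
    · have := h.dec; omega
    · intro u v hv
      rw [hgrid, pushUnit]
      have h1 := h.le u v (by omega)
      split
      · omega
      · rw [if_neg (by rintro ⟨rfl, rfl⟩; omega)]; exact h1
    · intro W hW
      have h1 := cutVal_pushUnit (src := src) hpw (r := grid s 5 n) (by omega) W
      have h2 := h.cut W hW
      rw [hgrid]; omega
  · rename_i hc
    have hk1 : k w = 1 := by
      have := h.pos
      simp [h.here, hkw] at hc; omega
    exact ⟨w, { h with dec := Or.inl hk1 }⟩

/-- Either no vertex at the sink, array `6`, is reached and the capacities stay the same, or every cut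
loses one unit of capacity. -/
theorem augment_spec {n : ℕ} {src : Fin n → ℕ} {r : Fin n → Fin n → ℕ} {s : State}
    (h : HasForest n src r s) :
    (Disjoint (supp s 7 n) (supp s 6 n) ∧ row (augment.den s) 4 n = src ∧
      grid (augment.den s) 5 n = r) ∨
    ∀ W, Disjoint W (supp s 6 n) →
      cutVal (row (augment.den s) 4 n) (grid (augment.den s) 5 n) W + 1 = cutVal src r W := by
  obtain ⟨h0, h4, h5, hf⟩ := h
  set s1 := (find 20 23 (ent 7 20 * ent 6 20)).den (s.setVar 23 0) with hs1
  have harr : s1.arr = s.arr := by ext a : 1; rw [hs1, den_arr rfl]; rfl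
  have hs10 : s1.var 0 = n := by rw [hs1, den_var rfl]; simpa using h0
  have he : augment.den s = (ite (.var 23)
    (set 24 (.var 23 - 1) ;; loop 22 0 walkStep ;; put 4 (.var 24) (ent 4 24 - 1)) skip).den s1 := rfl
  have hn : (s.setVar 23 0).var 0 = n := by simpa using h0
  rcases find_var (x := 20) (z := 23) (c := ent 7 20 * ent 6 20) (s := s.setVar 23 0) (by omega)
    rfl with ⟨hz, hno⟩ | ⟨i, hi, hz, hc, -⟩
  · left
    have hz' : s1.var 23 = 0 := by rw [hs1, hz]; simp
    have he' : augment.den s = s1 := by rw [he, den_ite]; simp [hz']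
    rw [he', hn] at *
    refine ⟨Finset.disjoint_left.2 fun v hv hv' => ?_, ?_, ?_⟩
    · have := hno v v.2
      rw [mem_supp] at hv hv'
      simp at this
      omega
    · rw [← h4]; exact row_congr (by rw [harr])
    · rw [← h5]; exact grid_congr (by rw [harr])
  · right
    rw [hn] at hi
    intro W hW
    set t : Fin n := ⟨i, hi⟩ with ht
    have hz' : s1.var 23 = i + 1 := hz
    have hc' : s.arr 7 t ≠ 0 ∧ s.arr 6 t ≠ 0 := by simpa [ht] using hc
    have htW : t ∉ W := fun h => Finset.disjoint_left.1 hW h (mem_supp.2 hc'.2)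
    have hw0 : WalkInv src r (row s 7 n) (row s 8 n) t 0 (s1.setVar 24 t) t := by
      refine ⟨by simpa using hs10, ?_, ?_, ?_, by simp, hc'.1, Or.inr le_rfl, ?_, ?_⟩
      · rw [← h4]; exact row_congr (by simp [harr])
      · exact row_congr (by simp [harr])
      · exact row_congr (by simp [harr])
      · intro u v _; rw [← h5]; exact (congrFun (congrFun (grid_congr (by simp [harr])) u) v).le
      · intro W hW
        have : grid (s1.setVar 24 t) 5 n = r := by rw [← h5]; exact grid_congr (by simp [harr])
        rw [this, if_neg hW, add_zero]
    obtain ⟨w, hw⟩ := loop_induct (x := 22) (y := 0) (p := walkStep) (s := s1.setVar 24 t)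
      (I := fun i s' => ∃ w, WalkInv src r (row s 7 n) (row s 8 n) t i s' w) ⟨t, hw0⟩ (by
        rintro i _ s' ⟨w, hw⟩
        refine walkStep_spec hf (w := w) { hw with dim := ?_, here := ?_ }
        · simpa using hw.dim
        · simpa using hw.here)
    set s2 := (loop 22 0 walkStep).den (s1.setVar 24 t) with hs2
    have hk1 : row s 7 n w = 1 := by
      have h1 := hw.dec
      rw [hw0.dim] at h1
      have h2 := hf.card t
      have h3 : (Finset.univ.filter fun u => row s 7 n u ≠ 0).card ≤ n :=
        (Finset.card_le_univ _).trans (by simp)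
      have := hw.pos
      omega
    have he' : augment.den s = s2.setArr 4 w (src w - 1) := by
      rw [he, den_ite, if_pos (by simp [hz'])]
      simp only [den_seq, den_set, den_put, eval_sub, eval_var, eval_one, hz', Nat.add_sub_cancel]
      have e1 : s1.setVar 24 i = s1.setVar 24 t := rfl
      rw [e1, ← hs2, eval_ent, hw.here]
      congr 2
      rw [← hw.src_eq]; rfl
    rw [he', row_setArr, if_pos rfl, hw.src_eq]
    have hg : grid (s2.setArr 4 w (src w - 1)) 5 n = grid s2 5 n := grid_congr (by simp)
    rw [hg, cutVal_update_src (hf.src_ne w hk1)]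
    exact hw.cut W htW

/-- If the number of rounds, variable `10`, exceeds the capacity of some cut, then the vertices that are
reached in the end form the least minimum cut, with respect to the capacities before. -/
theorem flow_spec {n : ℕ} {s : State} (h0 : s.var 0 = n)
    (hN : ∃ W, Disjoint W (supp s 6 n) ∧ cutVal (row s 4 n) (grid s 5 n) W < s.var 10) :
    Disjoint (supp (flow.den s) 7 n) (supp s 6 n) ∧ ∀ W, Disjoint W (supp s 6 n) →
      cutVal (row s 4 n) (grid s 5 n) (supp (flow.den s) 7 n) ≤
          cutVal (row s 4 n) (grid s 5 n) W ∧
        (cutVal (row s 4 n) (grid s 5 n) W ≤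
          cutVal (row s 4 n) (grid s 5 n) (supp (flow.den s) 7 n) →
          supp (flow.den s) 7 n ⊆ W) := by
  set X := supp s 6 n with hX
  set src := row s 4 n
  set r := grid s 5 n
  set s1 := (loop 26 10 (reach ;; augment)).den s with hs1
  have hinv := loop_induct (x := 26) (y := 10) (p := reach ;; augment) (s := s)
    (I := fun i s' => s'.var 0 = n ∧ s'.arr 6 = s.arr 6 ∧ ∃ j,
      (∀ W, Disjoint W X → cutVal (row s' 4 n) (grid s' 5 n) W + j = cutVal src r W) ∧
      (j = i ∨ ∃ Z, FlowClosed (row s' 4 n) (grid s' 5 n) Z ∧ Disjoint Z X))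
    ⟨h0, rfl, 0, fun _ _ => rfl, Or.inl rfl⟩ (by
      rintro i hi s' ⟨g0, g6, j, g1, g2⟩
      have hs' : (s'.setVar 26 i).var 0 = n := by simpa using g0
      obtain ⟨f1, f2⟩ := reach_spec (s := s'.setVar 26 i) hs' rfl rfl
      set s2 := reach.den (s'.setVar 26 i) with hs2
      have f6 : s2.arr 6 = s.arr 6 := by rw [hs2, den_arr rfl]; exact g6
      have hX2 : supp s2 6 n = X := supp_congr f6
      refine ⟨by rw [den_seq, den_var rfl]; exact f1.1, by rw [den_seq, den_arr rfl]; exact f6, ?_⟩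
      have e4 : row (s'.setVar 26 i) 4 n = row s' 4 n := rfl
      have e5 : grid (s'.setVar 26 i) 5 n = grid s' 5 n := rfl
      rw [e4, e5] at f1 f2
      rcases augment_spec f1 with ⟨d1, d2, d3⟩ | d
      · refine ⟨j, fun W hW => ?_, Or.inr ⟨supp s2 7 n, ?_, ?_⟩⟩
        · rw [den_seq, d2, d3]; exact g1 W hW
        · rw [den_seq, d2, d3]; exact f2
        · rw [← hX2]; exact d1
      · rw [hX2] at d
        refine ⟨j + 1, fun W hW => ?_, Or.inl ?_⟩
        · have := d W hW
          rw [den_seq, ← g1 W hW, ← this]; ring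
        · rcases g2 with g2 | ⟨Z, hZ, hZX⟩
          · rw [g2]
          · have := d Z hZX
            rw [cutVal_eq_zero.2 hZ] at this
            omega)
  rw [← hs1] at hinv
  obtain ⟨g0, g6, j, g1, g2⟩ := hinv
  obtain ⟨f1, f2⟩ := reach_spec (s := s1) g0 rfl rfl
  have hfl : flow.den s = reach.den s1 := rfl
  rw [hfl]
  obtain ⟨Z, hZ, hZX⟩ : ∃ Z, FlowClosed (row s1 4 n) (grid s1 5 n) Z ∧ Disjoint Z X := by
    refine g2.resolve_left fun hj => ?_
    obtain ⟨W, hW, hlt⟩ := hN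
    have := g1 W hW
    omega
  have hsub : ∀ Z, FlowClosed (row s1 4 n) (grid s1 5 n) Z → supp (reach.den s1) 7 n ⊆ Z :=
    fun Z hZ v hv => f1.2.2.2.mem_of_flowClosed hZ (by simpa [supp] using hv)
  have hd : Disjoint (supp (reach.den s1) 7 n) X := Finset.disjoint_of_subset_left (hsub Z hZ) hZX
  have hz := g1 _ hd
  rw [cutVal_eq_zero.2 f2] at hz
  refine ⟨hd, fun W hW => ?_⟩
  have hw := g1 W hW
  refine ⟨by omega, fun hle => hsub W (cutVal_eq_zero.1 (by omega))⟩

end Stmt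
end LoopLang

/-! ### The local search move -/

section MoveMatrix
variable {V : Type*} [DecidableEq V]

/-- The edge set `S` (as a matrix) after the move to `W`: among the edges `adj`, those inside `W` are
taken out of `S` and those that leave `W` are put in. -/
def moveMat (adj S : V → V → ℕ) (W : Finset V) : V → V → ℕ := fun u v =>
  if adj u v = 0 then S u v else if u ∈ W ∧ v ∈ W then 0 else if u ∈ W ∨ v ∈ W then 1 else S u v

/-- The number of ordered pairs in `S` that are edges of `adj`. -/
def active [Fintype V] (adj S : V → V → ℕ) : ℕ := ∑ u, ∑ v, adj u v * S u v

/-- A symmetric matrix with entries `0` and `1`. -/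
structure IsSym01 (M : V → V → ℕ) : Prop where
  symm : ∀ u v, M u v = M v u
  le : ∀ u v, M u v ≤ 1

theorem IsSym01.moveMat {adj S : V → V → ℕ} (ha : IsSym01 adj) (hS : IsSym01 S) (W : Finset V) :
    IsSym01 (moveMat adj S W) := by
  constructor
  · intro u v
    simp only [_root_.moveMat, ha.symm u v, hS.symm u v, and_comm (a := u ∈ W),
      or_comm (a := u ∈ W)]
  · intro u v
    unfold _root_.moveMat
    have := hS.le u v
    split_ifs <;> omega

theorem sum_sum_split [Fintype V] (f : V → V → ℕ) (W : Finset V) :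
    ∑ u, ∑ v, f u v = (∑ u ∈ W, ∑ v ∈ W, f u v + ∑ u ∈ W, ∑ v ∈ Wᶜ, f u v) +
      (∑ u ∈ Wᶜ, ∑ v ∈ W, f u v + ∑ u ∈ Wᶜ, ∑ v ∈ Wᶜ, f u v) := by
  rw [← Finset.sum_add_sum_compl W, ← Finset.sum_add_distrib, ← Finset.sum_add_distrib]
  simp_rw [Finset.sum_add_sum_compl]

/-- The network in which cuts have the size of the edge sets after the corresponding moves. -/
theorem cutVal_eq_active [Fintype V] {adj S : V → V → ℕ} (ha : IsSym01 adj) (hS : IsSym01 S) (W : Finset V) :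
    cutVal (fun v => ∑ x, adj v x * S v x) (fun u v => 2 - 2 * (1 - adj u v) - S u v) W =
      active adj (moveMat adj S W) := by
  have hpt : ∀ u v, (2 - 2 * (1 - adj u v) - S u v) + adj u v * S u v = adj u v + adj u v := by
    intro u v
    have h1 := ha.le u v
    have h2 := hS.le u v
    interval_cases adj u v <;> interval_cases S u v <;> rfl
  have hsw : ∀ f : V → V → ℕ, (∀ u v, f u v = f v u) →
      ∑ u ∈ Wᶜ, ∑ v ∈ W, f u v = ∑ u ∈ W, ∑ v ∈ Wᶜ, f u v := fun f hf => by
    rw [Finset.sum_comm]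
    exact Finset.sum_congr rfl fun u _ => Finset.sum_congr rfl fun v _ => hf v u
  have e1 : ∑ u ∈ W, ∑ v ∈ W, adj u v * moveMat adj S W u v = 0 :=
    Finset.sum_eq_zero fun u hu => Finset.sum_eq_zero fun v hv => by
      unfold moveMat; split_ifs <;> simp_all
  have e2 : ∑ u ∈ W, ∑ v ∈ Wᶜ, adj u v * moveMat adj S W u v = ∑ u ∈ W, ∑ v ∈ Wᶜ, adj u v :=
    Finset.sum_congr rfl fun u hu => Finset.sum_congr rfl fun v hv => by
      rw [Finset.mem_compl] at hv
      unfold moveMat; split_ifs <;> simp_all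
  have e3 : ∑ u ∈ Wᶜ, ∑ v ∈ W, adj u v * moveMat adj S W u v = ∑ u ∈ W, ∑ v ∈ Wᶜ, adj u v := by
    rw [hsw _ fun u v => by rw [ha.symm, (IsSym01.moveMat ha hS W).symm], e2]
  have e4 : ∑ u ∈ Wᶜ, ∑ v ∈ Wᶜ, adj u v * moveMat adj S W u v =
      ∑ u ∈ Wᶜ, ∑ v ∈ Wᶜ, adj u v * S u v :=
    Finset.sum_congr rfl fun u hu => Finset.sum_congr rfl fun v hv => by
      rw [Finset.mem_compl] at hu hv
      unfold moveMat; split_ifs <;> simp_all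
  have e5 : ∑ u ∈ Wᶜ, ∑ v, adj u v * S u v = ∑ u ∈ W, ∑ v ∈ Wᶜ, adj u v * S u v +
      ∑ u ∈ Wᶜ, ∑ v ∈ Wᶜ, adj u v * S u v := by
    rw [← hsw _ fun u v => by rw [ha.symm, hS.symm], ← Finset.sum_add_distrib]
    simp_rw [Finset.sum_add_sum_compl]
  have e6 : ∑ u ∈ W, ∑ v ∈ Wᶜ, (2 - 2 * (1 - adj u v) - S u v) +
      ∑ u ∈ W, ∑ v ∈ Wᶜ, adj u v * S u v =
      ∑ u ∈ W, ∑ v ∈ Wᶜ, adj u v + ∑ u ∈ W, ∑ v ∈ Wᶜ, adj u v := by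
    simp only [← Finset.sum_add_distrib]
    exact Finset.sum_congr rfl fun u _ => Finset.sum_congr rfl fun v _ => hpt u v
  rw [active, sum_sum_split _ W, e1, e2, e3, e4, cutVal, e5]
  omega

theorem moveMat_empty (adj S : V → V → ℕ) : moveMat adj S ∅ = S := by
  ext u v; simp [moveMat]

end MoveMatrix

namespace LoopLang
open WordRAM
namespace Stmt
open LoopLang.Expr

/-- `a[x] :=` the number of `y < n` with `c ≠ 0`, with `z` as counter. -/
def tally (x y z a : ℕ) (c : Expr) : Stmt :=
  loop x 0 (set z 0 ;; count y z c ;; put a (.var x) (.var z))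

theorem tally_arr {x y z a : ℕ} {c : Expr} {s : State} (hx : x ≠ 0) (hy : y ≠ 0) (hz : z ≠ 0)
    (hxy : x ≠ y) (hxz : x ≠ z) (hyz : y ≠ z) (hcz : c.usesVar z = false)
    (hca : c.usesArr a = false) {i : ℕ} (hi : i < s.var 0) :
    ((tally x y z a c).den s).arr a i =
      ((Finset.range (s.var 0)).filter fun j => c.eval ((s.setVar x i).setVar y j) ≠ 0).card := by
  have := loop_induct (x := x) (y := 0) (p := set z 0 ;; count y z c ;; put a (.var x) (.var z))
    (s := s) (I := fun k s' => (∀ w, w ≠ x → w ≠ y → w ≠ z → s'.var w = s.var w) ∧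
      (∀ b ≠ a, s'.arr b = s.arr b) ∧ ∀ i < k, s'.arr a i = ((Finset.range (s.var 0)).filter
        fun j => c.eval ((s.setVar x i).setVar y j) ≠ 0).card)
    ⟨fun _ _ _ _ => rfl, fun _ _ => rfl, fun i hi => absurd hi (Nat.not_lt_zero i)⟩ ?_
  · exact this.2.2 i hi
  rintro k hk s' ⟨h1, h2, h3⟩
  set t := (s'.setVar x k).setVar z 0 with ht
  set t' := (count y z c).den t with ht'
  have h0 : t.var 0 = s.var 0 := by simp [ht, hz.symm, hx.symm, h1 0 hx.symm hy.symm hz.symm]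
  have harr : t'.arr = s'.arr := by
    ext b : 1
    rw [ht', den_arr (by simp [count, writesArr])]
    rfl
  have hfr : ∀ w, w ≠ y → w ≠ z → t'.var w = t.var w := fun w hw hw' =>
    den_var (by simp [count, writesVar, hw, hw']) _
  have hev : ∀ j, c.eval (t.setVar y j) = c.eval ((s.setVar x k).setVar y j) := fun j => by
    refine Expr.eval_congr (fun w hw => ?_) (fun b hb => h2 b ?_)
    · have hwz : w ≠ z := by rintro rfl; simp [hcz] at hw
      by_cases hwy : w = y
      · simp [hwy]
      · by_cases hwx : w = x
        · simp [ht, hwx, hxy, hxz]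
        · simp [ht, hwx, hwy, hwz, h1 w hwx hwy hwz]
    · rintro rfl; simp [hca] at hb
  have hz' : t'.var z = ((Finset.range (s.var 0)).filter
        fun j => c.eval ((s.setVar x k).setVar y j) ≠ 0).card := by
    rw [ht', count_var hyz hcz, h0]
    simp only [hev]
    simp [ht]
  have hx' : t'.var x = k := by rw [hfr x hxy hxz]; simp [ht, hxz]
  have hden : (set z 0 ;; count y z c ;; put a (.var x) (.var z)).den (s'.setVar x k) =
      t'.setArr a k (t'.var z) := by
    simp only [den_seq, den_set, den_put, eval_var, eval_zero, ← ht, ← ht', hx']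
  rw [hden]
  refine ⟨fun w hwx hwy hwz => ?_, fun b hb => by simp [hb, harr, h2 b hb], fun i hi => ?_⟩
  · simp [hfr w hwy hwz, ht, hwx, hwz, h1 w hwx hwy hwz]
  · rcases Nat.lt_succ_iff_lt_or_eq.1 hi with hi | rfl
    · simp [Function.update_of_ne hi.ne, harr, h3 i hi]
    · simp [hz']

theorem card_range_filter {n : ℕ} (P : ℕ → Prop) [DecidablePred P] :
    ((Finset.range n).filter P).card = (Finset.univ.filter fun v : Fin n => P v).card := by
  rw [Finset.card_filter, Finset.card_filter]
  exact Finset.sum_range fun i => if P i then 1 else 0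

/-- Improve the edge set in array `2`, within the graph in array `3`, by the best move to a set whose
vertices in `R` (array `1`) all lie in array `9`. -/
def move : Stmt :=
  fill 20 6 (ent 1 20 - ent 9 20) ;;
  fill2 20 21 5 (2 - 2 * (1 - mat 3 20 21) - mat 2 20 21) ;;
  tally 20 21 23 4 (mat 3 20 21 * mat 2 20 21) ;;
  flow ;;
  fill2 20 21 12 (1 - (1 - (mat 2 20 21 *
    (1 - mat 3 20 21 * ((1 - (1 - ent 7 20)) + (1 - (1 - ent 7 21)))) +
    mat 3 20 21 * (((1 - (1 - ent 7 20)) - (1 - (1 - ent 7 21))) +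
      ((1 - (1 - ent 7 21)) - (1 - (1 - ent 7 20))))))) ;;
  fill2 20 21 2 (mat 12 20 21)

/-- The program `move` makes the best move to a set `W` whose terminals are among the allowed ones,
array `9`, and takes the least such `W`. -/
theorem move_spec {n : ℕ} {s : State} (h0 : s.var 0 = n) (h10 : s.var 10 = n * n + 1)
    (hR : ∀ v, row s 1 n v ≤ 1) (ha : IsSym01 (grid s 3 n)) (hS : IsSym01 (grid s 2 n)) :
    ∃ W, Disjoint W (supp s 1 n \ supp s 9 n) ∧
      grid (move.den s) 2 n = moveMat (grid s 3 n) (grid s 2 n) W ∧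
      ∀ W', Disjoint W' (supp s 1 n \ supp s 9 n) →
        active (grid s 3 n) (moveMat (grid s 3 n) (grid s 2 n) W) ≤
          active (grid s 3 n) (moveMat (grid s 3 n) (grid s 2 n) W') ∧
        (active (grid s 3 n) (moveMat (grid s 3 n) (grid s 2 n) W') ≤
          active (grid s 3 n) (moveMat (grid s 3 n) (grid s 2 n) W) → W ⊆ W') := by
  set adj := grid s 3 n with hadj
  set S := grid s 2 n with hSdef
  have hnw : ∀ {p : Stmt}, p.writesVar 0 = false → ∀ {t : State}, t.var 0 = n →
      (p.den t).var 0 = n := fun hp t ht => by rw [den_var hp, ht]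
  -- the network
  set s1 := (fill 20 6 (ent 1 20 - ent 9 20)).den s with hs1
  set s2 := (fill2 20 21 5 (2 - 2 * (1 - mat 3 20 21) - mat 2 20 21)).den s1 with hs2
  set s3 := (tally 20 21 23 4 (mat 3 20 21 * mat 2 20 21)).den s2 with hs3
  have h1 : s1.var 0 = n := hnw rfl h0
  have h2 : s2.var 0 = n := hnw rfl h1
  have h3 : s3.var 0 = n := hnw rfl h2
  have e6 : supp s3 6 n = supp s 1 n \ supp s 9 n := by
    have e : supp s3 6 n = supp s1 6 n :=
      supp_congr (by rw [hs3, den_arr rfl, hs2, den_arr rfl])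
    rw [e]
    ext v
    rw [Finset.mem_sdiff, mem_supp, mem_supp, mem_supp, hs1,
      fill_arr rfl (by rw [h0]; exact v.2)]
    have := hR v
    simp only [row] at this
    simp
    omega
  have e5 : grid s3 5 n = fun u v => 2 - 2 * (1 - adj u v) - S u v := by
    rw [grid_congr (show s3.arr 5 = s2.arr 5 by rw [hs3, den_arr rfl])]
    ext u v
    have e := fill2_arr (x := 20) (y := 21) (a := 5)
      (e := 2 - 2 * (1 - mat 3 20 21) - mat 2 20 21) (s := s1) (by omega) (by omega) (by omega) rfl
      (i := u) (j := v) (by rw [h1]; exact u.2) (by rw [h1]; exact v.2)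
    rw [h1] at e
    rw [grid, hs2, e]
    have a2 : s1.arr 2 = s.arr 2 := by rw [hs1, den_arr rfl]
    have a3 : s1.arr 3 = s.arr 3 := by rw [hs1, den_arr rfl]
    simp [h1, a2, a3, hadj, hSdef, grid]
  have e4 : row s3 4 n = fun v => ∑ x, adj v x * S v x := by
    ext v
    have a2 : s2.arr 2 = s.arr 2 := by rw [hs2, den_arr rfl, hs1, den_arr rfl]
    have a3 : s2.arr 3 = s.arr 3 := by rw [hs2, den_arr rfl, hs1, den_arr rfl]
    rw [row, hs3, tally_arr (by omega) (by omega) (by omega) (by omega) (by omega) (by omega) rfl rfl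
      (by rw [h2]; exact v.2), h2, card_range_filter, Finset.card_filter]
    refine Finset.sum_congr rfl fun x _ => ?_
    have e : (mat 3 20 21 * mat 2 20 21).eval ((s2.setVar 20 v).setVar 21 x) = adj v x * S v x := by
      simp [h2, a2, a3, hadj, hSdef, grid]
    rw [e]
    have b1 := ha.le v x
    have b2 := hS.le v x
    interval_cases adj v x <;> interval_cases S v x <;> rfl
  have h10' : s3.var 10 = n * n + 1 := by
    rw [hs3, den_var rfl, hs2, den_var rfl, hs1, den_var rfl, h10]
  have hcut : ∀ W, cutVal (row s3 4 n) (grid s3 5 n) W = active adj (moveMat adj S W) := fun W => by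
    rw [e4, e5, cutVal_eq_active ha hS]
  have hfl := flow_spec (s := s3) h3 ⟨∅, Finset.disjoint_empty_left _, by
    rw [hcut, h10', moveMat_empty, active]
    have : ∀ u, ∑ v, adj u v * S u v ≤ n := fun u => by
      calc ∑ v, adj u v * S u v ≤ ∑ v : Fin n, 1 :=
            Finset.sum_le_sum fun v _ => Nat.mul_le_mul (ha.le u v) (hS.le u v)
        _ = n := by simp
    calc ∑ u, ∑ v, adj u v * S u v ≤ ∑ u : Fin n, n := Finset.sum_le_sum fun u _ => this u
      _ < n * n + 1 := by simp⟩
  set s4 := flow.den s3 with hs4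
  have h4 : s4.var 0 = n := hnw rfl h3
  set W := supp s4 7 n with hW
  rw [e6] at hfl
  simp only [hcut] at hfl
  refine ⟨W, hfl.1, ?_, hfl.2⟩
  -- the update of the edge set
  set e12 : Expr := 1 - (1 - (mat 2 20 21 *
    (1 - mat 3 20 21 * ((1 - (1 - ent 7 20)) + (1 - (1 - ent 7 21)))) +
    mat 3 20 21 * (((1 - (1 - ent 7 20)) - (1 - (1 - ent 7 21))) +
      ((1 - (1 - ent 7 21)) - (1 - (1 - ent 7 20)))))) with he12
  set s5 := (fill2 20 21 12 e12).den s4 with hs5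
  have h5 : s5.var 0 = n := hnw rfl h4
  have hmd : move.den s = (fill2 20 21 2 (mat 12 20 21)).den s5 := rfl
  rw [hmd]
  ext u v
  have f1 := fill2_arr (x := 20) (y := 21) (a := 2) (e := mat 12 20 21) (s := s5)
    (by omega) (by omega) (by omega) rfl
    (i := u) (j := v) (by rw [h5]; exact u.2) (by rw [h5]; exact v.2)
  have f2 := fill2_arr (x := 20) (y := 21) (a := 12) (e := e12) (s := s4)
    (by omega) (by omega) (by omega) rfl
    (i := u) (j := v) (by rw [h4]; exact u.2) (by rw [h4]; exact v.2)
  rw [h5] at f1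
  rw [h4, ← hs5] at f2
  rw [grid, f1]
  have f3 : (mat 12 20 21).eval ((s5.setVar 20 u).setVar 21 v) = s5.arr 12 (u * n + v) := by
    simp [h5]
  have a2 : s4.arr 2 (u * n + v) = S u v := by
    rw [hs4, den_arr rfl, hs3, den_arr rfl, hs2, den_arr rfl, hs1, den_arr rfl]; rfl
  have a3 : s4.arr 3 (u * n + v) = adj u v := by
    rw [hs4, den_arr rfl, hs3, den_arr rfl, hs2, den_arr rfl, hs1, den_arr rfl]; rfl
  have w1 : ∀ x : Fin n, 1 - (1 - s4.arr 7 x) = if x ∈ W then 1 else 0 := fun x => by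
    have := @mem_supp s4 7 n x
    by_cases h : s4.arr 7 x = 0 <;> simp [hW, this, h]
    omega
  rw [f3, f2, he12]
  simp only [eval_sub, eval_mul, eval_add, eval_one, eval_mat, eval_ent, setVar_var, setVar_arr]
  simp only [show ((21 : ℕ) = 20) = False by simp, show ((20 : ℕ) = 21) = False by simp,
    show ((0 : ℕ) = 20) = False by simp, show ((0 : ℕ) = 21) = False by simp, if_false, if_true, h4,
    a2, a3, w1, moveMat]
  have b1 := ha.le u v
  have b2 := hS.le u v
  by_cases hu : u ∈ W <;> by_cases hv : v ∈ W <;> simp only [hu, hv, if_true, if_false, and_true,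
    and_false, or_true, or_false] <;>
  interval_cases adj u v <;> interval_cases S u v <;> rfl

end Stmt
end LoopLang

namespace LoopLang
open WordRAM
namespace Stmt

/-! ### Local search over all advice -/

/-- Local search: `n ^ 2 + 1` rounds, in each of which the program `dec` turns every advice `g < M`
(variables `28` and `11`) into a set of vertices (array `9`) for which the best move is made. -/
def localSearch (dec : Stmt) : Stmt := loop 19 10 (loop 28 11 (dec ;; move))

/-- The two states agree on the parameters of the local search: the variables below `19`, the graphs
in arrays `0` and `3` and the terminals in array `1`. -/
def SameInput (s t : State) : Prop :=
  (∀ x < 19, s.var x = t.var x) ∧ s.arr 0 = t.arr 0 ∧ s.arr 1 = t.arr 1 ∧ s.arr 3 = t.arr 3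

theorem SameInput.setVar {s t : State} {x v : ℕ} (h : SameInput s t) (hx : 19 ≤ x) :
    SameInput (s.setVar x v) t :=
  ⟨fun y hy => by rw [setVar_var_of_ne (by omega)]; exact h.1 y hy, h.2⟩

/-- The statement changes neither the parameters nor the loop variables of the local search. -/
def Keeps (p : Stmt) : Bool :=
  (List.range 20).all (fun x => !p.writesVar x) && !p.writesArr 0 && !p.writesArr 1 &&
    !p.writesArr 3

theorem SameInput.den {p : Stmt} (hp : p.Keeps) {s t : State} (h : SameInput s t) :
    SameInput (p.den s) t := by
  simp only [Keeps, Bool.and_eq_true, List.all_eq_true, List.mem_range, Bool.not_eq_true'] at hp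
  obtain ⟨⟨⟨h1, h2⟩, h3⟩, h4⟩ := hp
  exact ⟨fun x hx => by rw [den_var (h1 x (by omega)), h.1 x hx], by rw [den_arr h2, h.2.1],
    by rw [den_arr h3, h.2.2.1], by rw [den_arr h4, h.2.2.2]⟩

/-- No move to a set whose vertices in `R` lie in `A` shrinks the edge set `S`. -/
def StableAt {n : ℕ} (adj S : Fin n → Fin n → ℕ) (R A : Finset (Fin n)) : Prop :=
  ∀ W, Disjoint W (R \ A) → active adj S ≤ active adj (moveMat adj S W)

theorem active_le {n : ℕ} {adj S : Fin n → Fin n → ℕ} (ha : IsSym01 adj) (hS : IsSym01 S) :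
    active adj S ≤ n * n := by
  calc active adj S ≤ ∑ u : Fin n, ∑ v : Fin n, 1 := Finset.sum_le_sum fun u _ =>
        Finset.sum_le_sum fun v _ => Nat.mul_le_mul (ha.le u v) (hS.le u v)
    _ = n * n := by simp

/-- A round makes `S` smaller unless `S` is stable already, in which case the least of the best moves is
the empty one and `S` stays the same. As `S` has at most `n * n` entries, `n * n + 1` rounds
suffice. -/
theorem localSearch_spec {n : ℕ} {dec : Stmt} {s₀ : State} {A : ℕ → Finset (Fin n)}
    {Feas : (Fin n → Fin n → ℕ) → Prop} (hk : dec.Keeps) (hd2 : dec.writesArr 2 = false)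
    (h0 : s₀.var 0 = n) (h10 : s₀.var 10 = n * n + 1)
    (hR : ∀ v, row s₀ 1 n v ≤ 1) (ha : IsSym01 (grid s₀ 3 n)) (hS : IsSym01 (grid s₀ 2 n))
    (hdec : ∀ g < s₀.var 11, ∀ s, SameInput s s₀ → s.var 28 = g → supp (dec.den s) 9 n = A g)
    (hF0 : Feas (grid s₀ 2 n))
    (hF : ∀ g < s₀.var 11, ∀ S W, IsSym01 S → Feas S → Disjoint W (supp s₀ 1 n \ A g) →
      Feas (moveMat (grid s₀ 3 n) S W)) :
    let S := grid ((localSearch dec).den s₀) 2 n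
    IsSym01 S ∧ Feas S ∧ ∀ g < s₀.var 11, StableAt (grid s₀ 3 n) S (supp s₀ 1 n) (A g) := by
  set adj := grid s₀ 3 n with hadj
  set R := supp s₀ 1 n with hRdef
  set M := s₀.var 11 with hM
  let Good (s : State) : Prop := SameInput s s₀ ∧ IsSym01 (grid s 2 n) ∧ Feas (grid s 2 n)
  let Stab (S : Fin n → Fin n → ℕ) : Prop := ∀ g < M, StableAt adj S R (A g)
  have hset : ∀ {s x v}, 19 ≤ x → Good s → Good (s.setVar x v) :=
    fun hx h => ⟨h.1.setVar hx, h.2⟩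
  -- one move
  have hstep : ∀ g < M, ∀ s, Good s → s.var 28 = g →
      Good ((dec ;; move).den s) ∧
      ((active adj (grid ((dec ;; move).den s) 2 n) < active adj (grid s 2 n) ∧
        ¬ StableAt adj (grid s 2 n) R (A g)) ∨
      (grid ((dec ;; move).den s) 2 n = grid s 2 n ∧ StableAt adj (grid s 2 n) R (A g))) := by
    intro g hg s ⟨hs1, hs2, hs3⟩ hs28
    set t := dec.den s with ht
    have ht1 : SameInput t s₀ := hs1.den hk
    have ht2 : grid t 2 n = grid s 2 n := grid_congr (den_arr hd2 s)
    have ht3 : grid t 3 n = adj := grid_congr ht1.2.2.2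
    have htR : supp t 1 n = R := supp_congr ht1.2.2.1
    obtain ⟨W, w1, w2, w3⟩ := move_spec (s := t) (by rw [ht1.1 0 (by omega), h0])
      (by rw [ht1.1 10 (by omega), h10])
      (fun v => by rw [row_congr ht1.2.2.1]; exact hR v) (by rw [ht3]; exact ha)
      (by rw [ht2]; exact hs2)
    rw [htR, hdec g hg s hs1 hs28] at w1 w3
    rw [ht2, ht3] at w2 w3
    have hden : (dec ;; move).den s = move.den t := rfl
    rw [hden]
    refine ⟨⟨ht1.den rfl, ?_, ?_⟩, ?_⟩
    · rw [w2]; exact ha.moveMat hs2 W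
    · rw [w2]; exact hF g hg _ W hs2 hs3 w1
    · rw [w2]
      have hself := (w3 ∅ (Finset.disjoint_empty_left _))
      rw [moveMat_empty] at hself
      rcases Nat.lt_or_ge (active adj (moveMat adj (grid s 2 n) W)) (active adj (grid s 2 n))
        with hlt | hge
      · exact Or.inl ⟨hlt, fun h => absurd (h W w1) (by omega)⟩
      · right
        have hW : W = ∅ := Finset.subset_empty.1 (hself.2 hge)
        subst hW
        rw [moveMat_empty] at w3 ⊢
        exact ⟨rfl, fun W' hW' => (w3 W' hW').1⟩
  -- one round
  have hround : ∀ s, Good s → Good ((loop 28 11 (dec ;; move)).den s) ∧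
      ((active adj (grid ((loop 28 11 (dec ;; move)).den s) 2 n) < active adj (grid s 2 n) ∧
        ¬ Stab (grid s 2 n)) ∨
      (grid ((loop 28 11 (dec ;; move)).den s) 2 n = grid s 2 n ∧ Stab (grid s 2 n))) := by
    intro s hs
    have h11 : s.var 11 = M := hs.1.1 11 (by omega)
    have := loop_induct (x := 28) (y := 11) (p := dec ;; move) (s := s)
      (I := fun g s' => Good s' ∧
        ((active adj (grid s' 2 n) < active adj (grid s 2 n) ∧ ¬ Stab (grid s 2 n)) ∨
        (grid s' 2 n = grid s 2 n ∧ ∀ g' < g, StableAt adj (grid s 2 n) R (A g'))))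
      ⟨hs, Or.inr ⟨rfl, fun g hg => absurd hg (Nat.not_lt_zero g)⟩⟩ ?_
    · rw [h11] at this; exact this
    rintro g hg s' ⟨g1, g2⟩
    rw [h11] at hg
    obtain ⟨f1, f2⟩ := hstep g hg (s'.setVar 28 g) (hset (by omega) g1) (by simp)
    refine ⟨f1, ?_⟩
    have e : grid (s'.setVar 28 g) 2 n = grid s' 2 n := rfl
    rw [e] at f2
    rcases g2 with ⟨g2, g3⟩ | ⟨g2, g3⟩
    · refine Or.inl ⟨?_, g3⟩
      rcases f2 with f2 | f2
      · exact f2.1.trans g2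
      · rw [f2.1]; exact g2
    · rw [g2] at f2
      rcases f2 with f2 | f2
      · exact Or.inl ⟨f2.1, fun h => f2.2 (h g hg)⟩
      · refine Or.inr ⟨f2.1, fun g' hg' => ?_⟩
        rcases Nat.lt_succ_iff_lt_or_eq.1 hg' with hg' | rfl
        · exact g3 g' hg'
        · exact f2.2
  have := loop_induct (x := 19) (y := 10) (p := loop 28 11 (dec ;; move)) (s := s₀)
    (I := fun i s' => Good s' ∧ (active adj (grid s' 2 n) + i ≤ n * n ∨ Stab (grid s' 2 n)))
    ⟨⟨⟨fun _ _ => rfl, rfl, rfl, rfl⟩, hS, hF0⟩, Or.inl (active_le ha hS)⟩ ?_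
  · obtain ⟨⟨-, g1, g2⟩, g3⟩ := this
    refine ⟨g1, g2, g3.resolve_left fun h => ?_⟩
    rw [h10] at h
    omega
  rintro i hi s' ⟨g1, g2⟩
  obtain ⟨f1, f2⟩ := hround (s'.setVar 19 i) (hset (by omega) g1)
  refine ⟨f1, ?_⟩
  have e : grid (s'.setVar 19 i) 2 n = grid s' 2 n := rfl
  rw [e] at f2
  rcases f2 with ⟨f2, f3⟩ | ⟨f2, f3⟩
  · left
    have := g2.resolve_right f3
    omega
  · right; rw [f2]; exact f3

end Stmt
end LoopLang

/-! ### Advice as a sequence of digits -/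

/-- Starting from `a`, apply `step` with the `j` lowest digits of `h` to the base `β`, the lowest
digit first. -/
def runDigits {σ : Type*} (step : σ → ℕ → σ) (β : ℕ) : ℕ → σ → ℕ → σ
  | 0, a, _ => a
  | j + 1, a, h => runDigits step β j (step a (h % β)) (h / β)

theorem exists_runDigits {σ : Type*} {step : σ → ℕ → σ} {β : ℕ} {Inv : ℕ → σ → Prop}
    (hβ : 0 < β) (hs : ∀ j a, Inv (j + 1) a → ∃ q < β, Inv j (step a q)) (j : ℕ) (a : σ)
    (ha : Inv j a) : ∃ h < β ^ j, Inv 0 (runDigits step β j a h) := by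
  induction j generalizing a with
  | zero => exact ⟨0, by simp, ha⟩
  | succ j ih =>
    obtain ⟨q, hq, hi⟩ := hs j a ha
    obtain ⟨h, hh, hr⟩ := ih _ hi
    refine ⟨q + β * h, ?_, ?_⟩
    · calc q + β * h < β + β * h := by omega
        _ = β * (h + 1) := by ring
        _ ≤ β * β ^ j := Nat.mul_le_mul_left _ hh
        _ = β ^ (j + 1) := by ring
    · have h1 : (q + β * h) % β = q := by
        rw [Nat.add_mul_mod_self_left, Nat.mod_eq_of_lt hq]
      have h2 : (q + β * h) / β = h := by
        rw [Nat.add_mul_div_left _ _ hβ, Nat.div_eq_of_lt hq, Nat.zero_add]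
      rw [runDigits, h1, h2]
      exact hr

theorem runDigits_induct {σ : Type*} {step : σ → ℕ → σ} {β : ℕ} {P : ℕ → σ → Prop}
    (hs : ∀ j a q, P (j + 1) a → P j (step a q)) (j : ℕ) (a : σ) (h : ℕ) (ha : P j a) :
    P 0 (runDigits step β j a h) := by
  induction j generalizing a h with
  | zero => exact ha
  | succ j ih => exact ih _ _ (hs j a _ ha)

/-- The vertices outside `A` with a neighbour in `A`. -/
def outside {V : Type*} [Fintype V] [DecidableEq V] (adj : V → V → ℕ) (A : Finset V) : Finset V :=
  Finset.univ.filter fun x => x ∉ A ∧ ∃ y ∈ A, adj x y ≠ 0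

/-- Add to `A` the `q`-th outside neighbour, if there is one. -/
def expand {n : ℕ} (adj : Fin n → Fin n → ℕ) (A : Finset (Fin n)) (q : ℕ) : Finset (Fin n) :=
  A ∪ (outside adj A).filter fun x => ((outside adj A).filter fun y => y < x).card = q

/-- The set `U` is connected in the graph `adj`: every nonempty proper subset has a neighbour. -/
def Linked {V : Type*} [DecidableEq V] (adj : V → V → ℕ) (U : Finset V) : Prop :=
  ∀ A ⊆ U, A.Nonempty → A ≠ U → ∃ y ∈ A, ∃ x ∈ U \ A, adj x y ≠ 0

theorem filter_rank_eq {n : ℕ} {N : Finset (Fin n)} {x : Fin n} (hx : x ∈ N) :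
    (N.filter fun z => (N.filter fun y => y < z).card = (N.filter fun y => y < x).card) = {x} := by
  have hlt : ∀ a ∈ N, ∀ b ∈ N, a < b → (N.filter fun y => y < a).card <
      (N.filter fun y => y < b).card := fun a ha b _ hab =>
    Finset.card_lt_card <| Finset.ssubset_iff_subset_ne.2 ⟨fun y hy => by
      simp only [Finset.mem_filter] at hy ⊢; exact ⟨hy.1, hy.2.trans hab⟩, fun h => by
      have : a ∈ N.filter fun y => y < a := by rw [h]; simp [ha, hab]
      simp at this⟩
  ext z
  simp only [Finset.mem_filter, Finset.mem_singleton]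
  constructor
  · rintro ⟨hz, h⟩
    rcases lt_trichotomy z x with hzx | hzx | hzx
    · exact absurd h (hlt z hz x hx hzx).ne
    · exact hzx
    · exact absurd h (hlt x hx z hz hzx).ne'
  · rintro rfl; exact ⟨hx, rfl⟩

theorem card_expand_le {n : ℕ} (adj : Fin n → Fin n → ℕ) (A : Finset (Fin n)) (q : ℕ) :
    (expand adj A q).card ≤ A.card + 1 := by
  refine (Finset.card_union_le _ _).trans (Nat.add_le_add_left ?_ _)
  rw [Finset.card_le_one]
  intro a ha b hb
  simp only [Finset.mem_filter] at ha hb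
  have h1 := filter_rank_eq ha.1
  rw [ha.2] at h1
  have : b ∈ ({a} : Finset (Fin n)) := by rw [← h1]; simp [hb]
  exact (Finset.mem_singleton.1 this).symm

/-- A connected set of at most `K` vertices, in a graph whose degrees are at most `Δ`, is reached
from each of its vertices by `K - 1` expansions. -/
theorem exists_runDigits_expand {n K Δ β : ℕ} {adj : Fin n → Fin n → ℕ} {U : Finset (Fin n)}
    (hU : Linked adj U) (hK : U.card ≤ K) (hdeg : ∀ y, (Finset.univ.filter fun x =>
      adj x y ≠ 0).card ≤ Δ) (hβ : K * Δ ≤ β) (hβ0 : 0 < β) {r : Fin n} (hr : r ∈ U) :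
    ∃ h < β ^ (K - 1), U ⊆ runDigits (expand adj) β (K - 1) {r} h := by
  have := exists_runDigits (step := expand adj) (β := β) (Inv := fun j A => (U ⊆ A) ∨
    (A ⊆ U ∧ A.Nonempty ∧ U.card ≤ A.card + j)) hβ0 ?_ (K - 1) {r}
    (Or.inr ⟨by simpa using hr, by simp, by simp; omega⟩)
  · obtain ⟨h, hh, h1⟩ := this
    refine ⟨h, hh, h1.elim id fun h2 => ?_⟩
    exact (Finset.eq_of_subset_of_card_le h2.1 (by omega)).symm.subset
  rintro j A (hA | ⟨h1, h2, h3⟩)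
  · exact ⟨0, hβ0, Or.inl (hA.trans Finset.subset_union_left)⟩
  by_cases hAU : A = U
  · exact ⟨0, hβ0, Or.inl (hAU ▸ Finset.subset_union_left)⟩
  obtain ⟨y, hy, x, hx, hxy⟩ := hU A h1 h2 hAU
  rw [Finset.mem_sdiff] at hx
  have hxN : x ∈ outside adj A := by
    simp only [outside, Finset.mem_filter, Finset.mem_univ, true_and]
    exact ⟨hx.2, y, hy, hxy⟩
  have hcard : (outside adj A).card ≤ K * Δ := by
    have hsub : outside adj A ⊆ A.biUnion fun y => Finset.univ.filter fun x => adj x y ≠ 0 := by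
      intro z hz
      simp only [outside, Finset.mem_filter, Finset.mem_univ, true_and] at hz
      obtain ⟨-, w, hw, hzw⟩ := hz
      simp only [Finset.mem_biUnion, Finset.mem_filter, Finset.mem_univ, true_and]
      exact ⟨w, hw, hzw⟩
    calc _ ≤ _ := Finset.card_le_card hsub
      _ ≤ A.card * Δ := Finset.card_biUnion_le_card_mul _ _ _ fun y _ => hdeg y
      _ ≤ K * Δ := Nat.mul_le_mul_right _ ((Finset.card_le_card h1).trans hK)
  have hlt : ((outside adj A).filter fun y => y < x).card < (outside adj A).card :=
    Finset.card_lt_card <| Finset.ssubset_iff_subset_ne.2 ⟨Finset.filter_subset _ _, fun h => by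
      rw [← h] at hxN; simp at hxN⟩
  have hexp : expand adj A ((outside adj A).filter fun y => y < x).card = insert x A := by
    rw [expand, filter_rank_eq hxN, Finset.union_comm]; rfl
  refine ⟨_, hlt.trans_le (hcard.trans hβ), Or.inr ?_⟩
  rw [hexp, Finset.card_insert_of_notMem hx.2]
  exact ⟨Finset.insert_subset hx.1 h1, Finset.insert_nonempty _ _, by omega⟩

/-- Insert the vertex with number `q`. -/
def insertNum {n : ℕ} (A : Finset (Fin n)) (q : ℕ) : Finset (Fin n) :=
  A ∪ Finset.univ.filter fun v => (v : ℕ) = q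

theorem card_insertNum_le {n : ℕ} (A : Finset (Fin n)) (q : ℕ) :
    (insertNum A q).card ≤ A.card + 1 := by
  refine (Finset.card_union_le _ _).trans (Nat.add_le_add_left ?_ _)
  rw [Finset.card_le_one]
  intro a ha b hb
  simp only [Finset.mem_filter] at ha hb
  exact Fin.ext (ha.2.trans hb.2.symm)

/-- Every set of at most `K` vertices is contained in a set given by `K` digits. -/
theorem exists_runDigits_insertNum {n K : ℕ} (hn : 0 < n) {T : Finset (Fin n)} (hT : T.card ≤ K) :
    ∃ h < n ^ K, T ⊆ runDigits insertNum n K ∅ h := by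
  have := exists_runDigits (step := insertNum (n := n)) (β := n)
    (Inv := fun j A => (T \ A).card ≤ j) hn ?_ K ∅ (by simpa using hT)
  · obtain ⟨h, hh, h1⟩ := this
    refine ⟨h, hh, ?_⟩
    rw [← Finset.sdiff_eq_empty_iff_subset, ← Finset.card_eq_zero]
    omega
  intro j A hA
  by_cases h : T \ A = ∅
  · refine ⟨0, hn, ?_⟩
    have : T \ insertNum A 0 = ∅ := Finset.sdiff_eq_empty_iff_subset.2
      ((Finset.sdiff_eq_empty_iff_subset.1 h).trans Finset.subset_union_left)
    rw [this]; simp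
  · obtain ⟨v, hv⟩ := Finset.nonempty_iff_ne_empty.2 h
    refine ⟨v, v.2, ?_⟩
    have hsub : T \ insertNum A v ⊆ (T \ A).erase v := by
      intro w hw
      simp only [insertNum, Finset.mem_sdiff, Finset.mem_union, Finset.mem_filter, Finset.mem_univ,
        true_and, not_or] at hw
      rw [Finset.mem_erase, Finset.mem_sdiff]
      exact ⟨fun h => hw.2.2 (by rw [h]), hw.1, hw.2.1⟩
    have := Finset.card_le_card hsub
    rw [Finset.card_erase_of_mem hv] at this
    omega

namespace LoopLang
open WordRAM
namespace Stmt
open LoopLang.Expr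

/-- Run `body` once for each digit (variable `30`) of variable `27` to the base `β`; the number of
digits is in variable `y`. -/
def digitLoop (β : Expr) (y : ℕ) (body : Stmt) : Stmt :=
  loop 29 y (set 30 (.var 27 - .var 27 / β * β) ;; set 27 (.var 27 / β) ;; body)

theorem digitLoop_spec {σ : Type*} {β : Expr} {y b : ℕ} {body : Stmt} {Env : State → Prop}
    {abs : State → σ} {step : σ → ℕ → σ} {s : State} (hs : Env s)
    (hE : ∀ s x v, Env s → x = 27 ∨ x = 29 ∨ x = 30 → Env (s.setVar x v))
    (ha : ∀ s x v, x = 27 ∨ x = 29 ∨ x = 30 → abs (s.setVar x v) = abs s)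
    (hβ : ∀ s, Env s → β.eval s = b) (h27 : body.writesVar 27 = false)
    (hb : ∀ s, Env s → Env (body.den s) ∧ abs (body.den s) = step (abs s) (s.var 30)) :
    Env ((digitLoop β y body).den s) ∧
      abs ((digitLoop β y body).den s) = runDigits step b (s.var y) (abs s) (s.var 27) := by
  have := loop_induct (x := 29) (y := y)
    (p := set 30 (.var 27 - .var 27 / β * β) ;; set 27 (.var 27 / β) ;; body) (s := s)
    (I := fun i s' => Env s' ∧ runDigits step b (s.var y - i) (abs s') (s'.var 27) =
      runDigits step b (s.var y) (abs s) (s.var 27)) ⟨hs, rfl⟩ ?_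
  · refine ⟨this.1, ?_⟩
    rw [← this.2, Nat.sub_self]; rfl
  rintro i hi s' ⟨g1, g2⟩
  set t := ((s'.setVar 29 i).setVar 30 (s'.var 27 % b)).setVar 27 (s'.var 27 / b) with ht
  have e1 := hE s' 29 i g1 (by simp)
  have hden : (set 30 (.var 27 - .var 27 / β * β) ;; set 27 (.var 27 / β) ;; body).den
      (s'.setVar 29 i) = body.den t := by
    have h1 := hβ _ e1
    have h2 : (Expr.var 27 - .var 27 / β * β).eval (s'.setVar 29 i) = s'.var 27 % b := by
      simp only [eval_sub, eval_mul, eval_div, eval_var, h1]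
      rw [setVar_var_of_ne (by omega), Nat.mod_eq_sub_div_mul]
    have h3 := hβ _ (hE _ 30 (s'.var 27 % b) e1 (by simp))
    simp only [den_seq, den_set, h2, eval_div, eval_var, h3, ht]
    simp
  rw [hden]
  have et : Env t := hE _ 27 _ (hE _ 30 _ e1 (by simp)) (by simp)
  have at' : abs t = abs s' := by
    rw [ht, ha _ 27 _ (by simp), ha _ 30 _ (by simp), ha _ 29 _ (by simp)]
  obtain ⟨b1, b2⟩ := hb t et
  refine ⟨b1, ?_⟩
  rw [b2, at', den_var h27, ← g2]
  have : s.var y - i = (s.var y - (i + 1)) + 1 := by omega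
  rw [this, runDigits]
  simp [ht]

/-- Array `9` becomes the set of the vertices that are the digits of the advice. -/
def decodeTuple : Stmt :=
  fill 20 9 0 ;; set 27 (.var 28) ;; digitLoop (.var 0) 12 (put 9 (.var 30) 1)

theorem supp_fill_zero {n : ℕ} {s : State} {x a : ℕ} (h0 : s.var 0 = n) :
    supp ((fill x a 0).den s) a n = ∅ := by
  ext v
  rw [mem_supp, fill_arr rfl (by rw [h0]; exact v.2)]
  simp

theorem supp_put {n : ℕ} {s : State} {a q w : ℕ} (hw : w ≠ 0) :
    supp (s.setArr a q w) a n = insertNum (supp s a n) q := by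
  ext v
  simp only [insertNum, Finset.mem_union, Finset.mem_filter, Finset.mem_univ, true_and, mem_supp]
  by_cases h : (v : ℕ) = q
  · simp [h, hw]
  · simp [h]

theorem decodeTuple_spec {n : ℕ} {s : State} (h0 : s.var 0 = n) :
    supp (decodeTuple.den s) 9 n = runDigits insertNum n (s.var 12) ∅ (s.var 28) := by
  set s1 := (fill 20 9 0 ;; set 27 (.var 28)).den s with hs1
  have h1 : s1.var 0 = n := by rw [hs1, den_var rfl, h0]
  have := (digitLoop_spec (β := .var 0) (y := 12) (b := n) (body := put 9 (.var 30) 1) (s := s1)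
    (Env := fun s => s.var 0 = n) (abs := fun s => supp s 9 n) (step := insertNum) h1
    (fun s x v h hx => by rw [setVar_var_of_ne (by omega)]; exact h) (fun s x v _ => rfl)
    (fun s h => h) rfl (fun s h => ⟨h, by
      rw [den_put, eval_var, eval_one, supp_put one_ne_zero]⟩)).2
  have hd : decodeTuple.den s = (digitLoop (.var 0) 12 (put 9 (.var 30) 1)).den s1 := rfl
  rw [hd, this]
  have e1 : supp s1 9 n = ∅ := supp_fill_zero h0
  have e2 : s1.var 27 = s.var 28 := by
    rw [hs1, den_seq, den_set, setVar_var_self, eval_var, den_var rfl]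
  have e3 : s1.var 12 = s.var 12 := by rw [hs1, den_var rfl]
  rw [e1, e2, e3]

/-- Enlarge the set in array `9` by the outside neighbour whose rank is in variable `30`. Array `13`
holds the numbers of neighbours in the set, array `14` the ranks of the outside neighbours. -/
def expandStep : Stmt :=
  tally 20 21 23 13 (ent 9 21 * mat 3 20 21) ;;
  tally 20 21 23 14 (ent 13 21 * (1 - ent 9 21) * (.var 20 - .var 21)) ;;
  fill 20 15 (1 - (1 - (ent 9 20 + ent 13 20 * (1 - ent 9 20) *
    (1 - ((ent 14 20 - .var 30) + (.var 30 - ent 14 20)))))) ;;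
  fill 20 9 (ent 15 20)

theorem expandStep_spec {n : ℕ} {s : State} (h0 : s.var 0 = n) :
    supp (expandStep.den s) 9 n = expand (grid s 3 n) (supp s 9 n) (s.var 30) := by
  set s1 := (tally 20 21 23 13 (ent 9 21 * mat 3 20 21)).den s with hs1
  set s2 := (tally 20 21 23 14 (ent 13 21 * (1 - ent 9 21) * (.var 20 - .var 21))).den s1 with hs2
  set e15 : Expr := 1 - (1 - (ent 9 20 + ent 13 20 * (1 - ent 9 20) *
    (1 - ((ent 14 20 - .var 30) + (.var 30 - ent 14 20))))) with he15
  set s3 := (fill 20 15 e15).den s2 with hs3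
  have hd : expandStep.den s = (fill 20 9 (ent 15 20)).den s3 := rfl
  have h1 : s1.var 0 = n := by rw [hs1, den_var rfl, h0]
  have h2 : s2.var 0 = n := by rw [hs2, den_var rfl, h1]
  have h3 : s3.var 0 = n := by rw [hs3, den_var rfl, h2]
  have h30 : s2.var 30 = s.var 30 := by rw [hs2, den_var rfl, hs1, den_var rfl]
  have a9 : s1.arr 9 = s.arr 9 := by rw [hs1, den_arr rfl]
  have a9' : s2.arr 9 = s.arr 9 := by rw [hs2, den_arr rfl, a9]
  have a13' : s2.arr 13 = s1.arr 13 := by rw [hs2, den_arr rfl]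
  have a13 : ∀ u : Fin n, s1.arr 13 u ≠ 0 ↔ ∃ y ∈ supp s 9 n, grid s 3 n u y ≠ 0 := by
    intro u
    rw [hs1, tally_arr (by omega) (by omega) (by omega) (by omega) (by omega) (by omega) rfl rfl
      (by rw [h0]; exact u.2), h0, card_range_filter, Finset.card_ne_zero]
    simp only [Finset.Nonempty, Finset.mem_filter, Finset.mem_univ, true_and]
    refine exists_congr fun y => ?_
    rw [mem_supp]
    simp [h0, grid]
  have hN : ∀ u : Fin n, s1.arr 13 u * (1 - s.arr 9 u) ≠ 0 ↔ u ∈ outside (grid s 3 n) (supp s 9 n) :=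
    fun u => by
      have := a13 u
      have h9 := @mem_supp s 9 n u
      simp only [outside, Finset.mem_filter, Finset.mem_univ, true_and, ← this, h9, ne_eq,
        Nat.mul_eq_zero, not_or, not_not]
      constructor
      · rintro ⟨h, h'⟩; exact ⟨by omega, h⟩
      · rintro ⟨h, h'⟩; exact ⟨h', by omega⟩
  have a14 : ∀ u : Fin n, s2.arr 14 u =
      ((outside (grid s 3 n) (supp s 9 n)).filter fun y => y < u).card := by
    intro u
    rw [hs2, tally_arr (by omega) (by omega) (by omega) (by omega) (by omega) (by omega) rfl rfl
      (by rw [h1]; exact u.2), h1, card_range_filter]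
    congr 1
    ext y
    have := hN y
    simp only [Finset.mem_filter, Finset.mem_univ, true_and, ← this]
    simp [a9, Nat.sub_eq_zero_iff_le]
  rw [hd]
  ext u
  rw [mem_supp, fill_arr rfl (by rw [h3]; exact u.2)]
  have e1 : (ent 15 20).eval (s3.setVar 20 u) = s3.arr 15 u := by simp
  rw [e1, hs3, fill_arr rfl (by rw [h2]; exact u.2), he15]
  simp only [expand, Finset.mem_union, Finset.mem_filter, ← hN, ← a14, mem_supp]
  simp only [eval_sub, eval_mul, eval_add, eval_one, eval_ent, eval_var, setVar_var, setVar_arr,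
    if_true, show ((30 : ℕ) = 20) = False by simp, if_false, h30, a9', a13']
  generalize s.arr 9 u = a
  generalize s1.arr 13 u = b
  generalize s2.arr 14 u = c
  generalize s.var 30 = q
  by_cases hc : c = q
  · subst hc
    simp only [Nat.sub_self, Nat.add_zero, Nat.sub_zero, Nat.mul_one, and_true]
    omega
  · have : 1 - (c - q + (q - c)) = 0 := by omega
    rw [this]
    simp only [Nat.mul_zero, Nat.add_zero, hc, and_false, or_false]
    omega

/-- Array `9` becomes the singleton of the vertex `g % n`, variable `27` becomes `g / n`, for the
advice `g`. -/
def decodeStart (a : ℕ) : Stmt :=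
  fill 20 a 0 ;; put a (.var 28 - .var 28 / .var 0 * .var 0) 1 ;; set 27 (.var 28 / .var 0)

theorem decodeStart_spec {n a : ℕ} {s : State} (h0 : s.var 0 = n) (hn : 0 < n) :
    supp ((decodeStart a).den s) a n = {⟨s.var 28 % n, Nat.mod_lt _ hn⟩} ∧
      ((decodeStart a).den s).var 27 = s.var 28 / n := by
  set s1 := (fill 20 a 0).den s with hs1
  have h1 : s1.var 0 = n := by rw [hs1, den_var (by simp [fill, writesVar]), h0]
  have h28 : s1.var 28 = s.var 28 := by rw [hs1, den_var (by simp [fill, writesVar])]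
  have hd : (decodeStart a).den s = (s1.setArr a (s.var 28 % n) 1).setVar 27 (s.var 28 / n) := by
    simp only [decodeStart, den_seq, den_put, den_set, ← hs1, eval_sub, eval_mul, eval_div, eval_var,
      h1, h28, ← Nat.mod_eq_sub_div_mul, eval_one, setArr_var]
  rw [hd]
  refine ⟨?_, by simp⟩
  have : supp ((s1.setArr a (s.var 28 % n) 1).setVar 27 (s.var 28 / n)) a n =
    supp (s1.setArr a (s.var 28 % n) 1) a n := rfl
  rw [this, supp_put one_ne_zero, supp_fill_zero h0]
  ext v
  simp [insertNum, Fin.ext_iff]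

/-- Array `9` becomes the set that the advice describes by a vertex and ranks of outside neighbours,
which are digits to the base in variable `14`. -/
def decodeExpand : Stmt := decodeStart 9 ;; digitLoop (.var 14) 13 expandStep

theorem decodeExpand_spec {n : ℕ} {s : State} (h0 : s.var 0 = n) (hn : 0 < n) :
    supp (decodeExpand.den s) 9 n = runDigits (expand (grid s 3 n)) (s.var 14) (s.var 13)
      {⟨s.var 28 % n, Nat.mod_lt _ hn⟩} (s.var 28 / n) := by
  set s1 := (decodeStart 9).den s with hs1
  obtain ⟨e1, e2⟩ := decodeStart_spec (a := 9) h0 hn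
  have := (digitLoop_spec (β := .var 14) (y := 13) (b := s.var 14) (body := expandStep) (s := s1)
    (Env := fun t => t.var 0 = n ∧ t.var 14 = s.var 14 ∧ t.arr 3 = s.arr 3)
    (abs := fun s => supp s 9 n) (step := expand (grid s 3 n))
    ⟨by rw [hs1, den_var rfl, h0], by rw [hs1, den_var rfl], by rw [hs1, den_arr rfl]⟩
    (fun s x v h hx => ⟨by rw [setVar_var_of_ne (by omega)]; exact h.1,
      by rw [setVar_var_of_ne (by omega)]; exact h.2.1, h.2.2⟩) (fun s x v _ => rfl)
    (fun s h => h.2.1) rfl (fun t h => ⟨⟨by rw [den_var rfl, h.1], by rw [den_var rfl, h.2.1],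
      by rw [den_arr rfl, h.2.2]⟩, by rw [expandStep_spec h.1, grid_congr h.2.2]⟩)).2
  have hd : decodeExpand.den s = (digitLoop (.var 14) 13 expandStep).den s1 := rfl
  rw [hd, this, e1, e2]
  have e3 : s1.var 13 = s.var 13 := by rw [hs1, den_var rfl]
  rw [e3]

end Stmt
end LoopLang

/-! ### Searching for a set with small boundary and few terminals -/

/-- The number of edges between `Z` and `B`. -/
def between {V : Type*} (adj : V → V → ℕ) (Z B : Finset V) : ℕ := ∑ u ∈ Z, ∑ v ∈ B, adj u v

theorem between_mono {V : Type*} {adj : V → V → ℕ} {Z Z' B B' : Finset V} (hZ : Z ⊆ Z') (hB : B ⊆ B') :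
    between adj Z B ≤ between adj Z' B' :=
  (Finset.sum_le_sum fun _ _ => Finset.sum_le_sum_of_subset hB).trans
    (Finset.sum_le_sum_of_subset hZ)

section Boundary
variable {V : Type*} [Fintype V] [DecidableEq V]

/-- The number of edges that leave `W`. -/
def bdry (adj : V → V → ℕ) (W : Finset V) : ℕ := ∑ u ∈ W, ∑ v ∈ Wᶜ, adj u v

theorem bdry_eq_sum (adj : V → V → ℕ) (W : Finset V) :
    bdry adj W = ∑ u, ∑ v, if u ∈ W ∧ v ∉ W then adj u v else 0 := by
  rw [bdry, sum_sum_split _ W]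
  have e1 : ∑ u ∈ W, ∑ v ∈ W, (if u ∈ W ∧ v ∉ W then adj u v else 0) = 0 :=
    Finset.sum_eq_zero fun u _ => Finset.sum_eq_zero fun v hv => by simp [hv]
  have e2 : ∑ u ∈ W, ∑ v ∈ Wᶜ, (if u ∈ W ∧ v ∉ W then adj u v else 0) =
      ∑ u ∈ W, ∑ v ∈ Wᶜ, adj u v :=
    Finset.sum_congr rfl fun u hu => Finset.sum_congr rfl fun v hv => by
      rw [if_pos ⟨hu, Finset.mem_compl.1 hv⟩]
  have e3 : ∀ X : Finset V, ∑ u ∈ Wᶜ, ∑ v ∈ X, (if u ∈ W ∧ v ∉ W then adj u v else 0) = 0 :=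
    fun X => Finset.sum_eq_zero fun u hu => Finset.sum_eq_zero fun v _ => by
      rw [if_neg fun h => Finset.mem_compl.1 hu h.1]
  rw [e1, e2, e3, e3]
  omega

theorem bdry_submodular (adj : V → V → ℕ) (A B : Finset V) :
    bdry adj (A ∩ B) + bdry adj (A ∪ B) ≤ bdry adj A + bdry adj B := by
  simp only [bdry_eq_sum, ← Finset.sum_add_distrib]
  refine Finset.sum_le_sum fun u _ => Finset.sum_le_sum fun v _ => ?_
  by_cases h1 : u ∈ A <;> by_cases h2 : u ∈ B <;> by_cases h3 : v ∈ A <;> by_cases h4 : v ∈ B <;>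
    simp [h1, h2, h3, h4]

theorem bdry_compl {adj : V → V → ℕ} (ha : ∀ u v, adj u v = adj v u) (W : Finset V) :
    bdry adj Wᶜ = bdry adj W := by
  rw [bdry, bdry, compl_compl, Finset.sum_comm]
  exact Finset.sum_congr rfl fun u _ => Finset.sum_congr rfl fun v _ => ha v u

/-- `W` is the smallest minimum cut that contains `Z` and avoids `B`. -/
structure IsMinCut (adj : V → V → ℕ) (Z B W : Finset V) : Prop where
  subset : Z ⊆ W
  disj : Disjoint W B
  le : ∀ X, Z ⊆ X → Disjoint X B → bdry adj W ≤ bdry adj X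
  least : ∀ X, Z ⊆ X → Disjoint X B → bdry adj X ≤ bdry adj W → W ⊆ X

theorem IsMinCut.unique {adj : V → V → ℕ} {Z B W W' : Finset V} (h : IsMinCut adj Z B W)
    (h' : IsMinCut adj Z B W') : W = W' :=
  Finset.Subset.antisymm (h.least W' h'.subset h'.disj (h'.le W h.subset h.disj))
    (h'.least W h.subset h.disj (h.le W' h'.subset h'.disj))

theorem exists_isMinCut (adj : V → V → ℕ) {Z B : Finset V} (h : Disjoint Z B) : ∃ W, IsMinCut adj Z B W := by
  obtain ⟨W, hW, hmin⟩ := Finset.exists_min_image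
    (Finset.univ.filter fun X : Finset V => Z ⊆ X ∧ Disjoint X B)
    (fun X => toLex (bdry adj X, X.card)) ⟨Z, by simp [h]⟩
  simp only [Finset.mem_filter, Finset.mem_univ, true_and] at hW hmin
  have hle : ∀ X, Z ⊆ X → Disjoint X B → bdry adj W ≤ bdry adj X := fun X h1 h2 => by
    rcases Prod.Lex.toLex_le_toLex.1 (hmin X ⟨h1, h2⟩) with h | h
    · exact h.le
    · exact h.1.le
  refine ⟨W, hW.1, hW.2, hle, fun X h1 h2 h3 => ?_⟩
  have i1 : Z ⊆ W ∩ X := Finset.subset_inter hW.1 h1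
  have i2 : Disjoint (W ∩ X) B := Finset.disjoint_of_subset_left Finset.inter_subset_left hW.2
  have i3 := hle (W ∪ X) (hW.1.trans Finset.subset_union_left)
    (Finset.disjoint_union_left.2 ⟨hW.2, h2⟩)
  have i4 := bdry_submodular adj W X
  have i5 := hle X h1 h2
  have i6 : W.card ≤ (W ∩ X).card := by
    rcases Prod.Lex.toLex_le_toLex.1 (hmin _ ⟨i1, i2⟩) with h | h
    · simp only at h; omega
    · exact h.2
  exact Finset.inter_eq_left.1 (Finset.eq_of_subset_of_card_le Finset.inter_subset_left i6)

open Classical in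
/-- The smallest minimum cut that contains `Z` and avoids `B`, empty if `Z` meets `B`. -/
noncomputable def minCut (adj : V → V → ℕ) (Z B : Finset V) : Finset V :=
  if h : ∃ W, IsMinCut adj Z B W then h.choose else ∅

theorem minCut_spec (adj : V → V → ℕ) {Z B : Finset V} (h : Disjoint Z B) : IsMinCut adj Z B (minCut adj Z B) := by
  rw [minCut, dif_pos (exists_isMinCut adj h)]
  exact (exists_isMinCut adj h).choose_spec

/-- A network with large source capacities at `Z` has the minimum cuts of the graph. -/
theorem isMinCut_of_cutVal {adj : V → V → ℕ} {N : ℕ} {Z B W : Finset V} (hZB : Disjoint Z B)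
    (hN : bdry adj Z < N) (hWB : Disjoint W B)
    (h : ∀ X, Disjoint X B →
      cutVal (fun v => if v ∈ Z then N else 0) adj W ≤
        cutVal (fun v => if v ∈ Z then N else 0) adj X ∧
      (cutVal (fun v => if v ∈ Z then N else 0) adj X ≤
        cutVal (fun v => if v ∈ Z then N else 0) adj W → W ⊆ X)) : IsMinCut adj Z B W := by
  have hcut : ∀ X, Z ⊆ X → cutVal (fun v => if v ∈ Z then N else 0) adj X = bdry adj X := by
    intro X hX
    rw [cutVal, bdry, Finset.sum_eq_zero, Nat.zero_add]
    intro v hv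
    rw [if_neg fun h => Finset.mem_compl.1 hv (hX h)]
  have hZW : Z ⊆ W := by
    intro z hz
    by_contra hzW
    have h1 := (h Z hZB).1
    rw [hcut Z (Finset.Subset.refl _), cutVal] at h1
    have h2 := Finset.single_le_sum (f := fun v => if v ∈ Z then N else 0)
      (fun _ _ => Nat.zero_le _) (Finset.mem_compl.2 hzW)
    simp only [hz, if_true] at h2
    omega
  refine ⟨hZW, hWB, fun X h1 h2 => ?_, fun X h1 h2 h3 => ?_⟩
  · have := (h X h2).1
    rwa [hcut W hZW, hcut X h1] at this
  · exact (h X h2).2 (by rwa [hcut W hZW, hcut X h1])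

theorem between_le_bdry {adj : V → V → ℕ} {Z B U : Finset V} (hZ : Z ⊆ U) (hB : Disjoint U B) :
    between adj Z B ≤ bdry adj U :=
  between_mono hZ fun _ hv => Finset.mem_compl.2 fun h => Finset.disjoint_left.1 hB h hv

end Boundary

section Branching
variable {n : ℕ}

/-- Decide that `x` belongs to the set that is searched for (`q = 0`) or does not (`q ≠ 0`). A state
of the search is a pair of disjoint sets: the vertices decided to be in, and those decided to be
out. -/
def decide01 (q : ℕ) (x : Fin n) (s : Finset (Fin n) × Finset (Fin n)) :
    Finset (Fin n) × Finset (Fin n) :=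
  if q = 0 then (insert x s.1, s.2) else (s.1, insert x s.2)

/-- One step of the search. As long as the smallest minimum cut contains an undecided terminal,
decide about this terminal. Otherwise add the largest minimum cut that contains no further terminal,
which is no restriction, and decide about a vertex next to it. -/
noncomputable def searchStep (adj : Fin n → Fin n → ℕ) (R : Finset (Fin n))
    (s : Finset (Fin n) × Finset (Fin n)) (q : ℕ) : Finset (Fin n) × Finset (Fin n) :=
  if h : ((minCut adj s.1 s.2 ∩ R) \ s.1).Nonempty then decide01 q (Finset.max' _ h) s
  else
    let W := (minCut adj (s.2 ∪ R \ s.1) s.1)ᶜ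
    if h : (outside adj W \ s.2).Nonempty then decide01 q (Finset.max' _ h) (W, s.2)
    else (W, s.2)

variable {adj : Fin n → Fin n → ℕ} {R : Finset (Fin n)}

/-- The largest minimum cut that contains `Z`, avoids `B` and contains no terminal outside `Z`. -/
theorem largest_minCut (ha : ∀ u v, adj u v = adj v u) {Z B : Finset (Fin n)}
    (hZB : Disjoint Z B) :
    Z ⊆ (minCut adj (B ∪ R \ Z) Z)ᶜ ∧ Disjoint (minCut adj (B ∪ R \ Z) Z)ᶜ (B ∪ R \ Z) ∧
    ∀ X, Z ⊆ X → Disjoint X (B ∪ R \ Z) → bdry adj (minCut adj (B ∪ R \ Z) Z)ᶜ ≤ bdry adj X ∧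
      (bdry adj X ≤ bdry adj (minCut adj (B ∪ R \ Z) Z)ᶜ → X ⊆ (minCut adj (B ∪ R \ Z) Z)ᶜ) := by
  have hd : Disjoint (B ∪ R \ Z) Z :=
    Finset.disjoint_union_left.2 ⟨hZB.symm, Finset.sdiff_disjoint⟩
  have h := minCut_spec adj hd
  set Y := minCut adj (B ∪ R \ Z) Z with hY
  refine ⟨Finset.subset_compl_comm.1 ?_, ?_, fun X h1 h2 => ?_⟩
  · intro y hy; exact Finset.mem_compl.2 fun h' => Finset.disjoint_left.1 h.disj hy h'
  · rw [Finset.disjoint_left]; intro y hy hy'; exact Finset.mem_compl.1 hy (h.subset hy')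
  · have c1 : B ∪ R \ Z ⊆ Xᶜ := fun y hy => Finset.mem_compl.2 fun h' =>
      Finset.disjoint_left.1 h2 h' hy
    have c2 : Disjoint Xᶜ Z := by
      rw [Finset.disjoint_left]; intro y hy hy'; exact Finset.mem_compl.1 hy (h1 hy')
    rw [bdry_compl ha]
    have g1 := h.le Xᶜ c1 c2
    have g2 := h.least Xᶜ c1 c2
    rw [bdry_compl ha] at g1 g2
    exact ⟨g1, fun hle => Finset.subset_compl_comm.1 (g2 hle)⟩

theorem searchStep_disjoint (ha : ∀ u v, adj u v = adj v u)
    {s : Finset (Fin n) × Finset (Fin n)} (hs : Disjoint s.1 s.2) (q : ℕ) :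
    Disjoint (searchStep adj R s q).1 (searchStep adj R s q).2 := by
  have hdec : ∀ (x : Fin n) (s : Finset (Fin n) × Finset (Fin n)), Disjoint s.1 s.2 → x ∉ s.1 →
      x ∉ s.2 → Disjoint (decide01 q x s).1 (decide01 q x s).2 := by
    intro x s hs h1 h2
    unfold decide01
    split
    · exact Finset.disjoint_insert_left.2 ⟨h2, hs⟩
    · exact Finset.disjoint_insert_right.2 ⟨h1, hs⟩
  have hW := largest_minCut (R := R) ha hs
  have hWB := (Finset.disjoint_union_right.1 hW.2.1).1
  unfold searchStep
  split
  · rename_i h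
    have hx := Finset.max'_mem _ h
    rw [Finset.mem_sdiff, Finset.mem_inter] at hx
    exact hdec _ _ hs hx.2 fun h' => Finset.disjoint_left.1 (minCut_spec adj hs).disj hx.1.1 h'
  · dsimp only
    split
    · rename_i h
      have hx := Finset.max'_mem _ h
      simp only [Finset.mem_sdiff, outside, Finset.mem_filter, Finset.mem_univ, true_and] at hx
      exact hdec _ _ hWB hx.1.1 hx.2
    · exact hWB

open Classical in
/-- The progress measure of the search. A right decision about a terminal of the minimum cut raises
one of the first two terms by at least two, which pays for the last term. When the last term is zero,
a vertex next to the largest minimum cut raises the first term if it is taken in, and the number of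
edges between the two sides if it is left out. -/
noncomputable def progress (adj : Fin n → Fin n → ℕ) (R : Finset (Fin n))
    (s : Finset (Fin n) × Finset (Fin n)) : ℕ :=
  2 * bdry adj (minCut adj s.1 s.2) + 2 * (s.1 ∩ R).card + between adj s.1 s.2 +
    if ((minCut adj s.1 s.2 ∩ R) \ s.1).Nonempty then 1 else 0

/-- The decisions made so far agree with `U`, which has the terminals of the set `U₀` that is
searched for. -/
structure Target (adj : Fin n → Fin n → ℕ) (R U₀ : Finset (Fin n)) (r : Fin n) (b : ℕ)
    (s : Finset (Fin n) × Finset (Fin n)) (U : Finset (Fin n)) : Prop where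
  start : r ∈ s.1
  sub : U₀ ⊆ U
  terminals : U ∩ R = U₀ ∩ R
  inside : s.1 ⊆ U
  outside : Disjoint U s.2
  bdry_le : bdry adj U ≤ b

theorem Target.progress_le {U₀ U : Finset (Fin n)} {r : Fin n}
    {b : ℕ} {s : Finset (Fin n) × Finset (Fin n)} (h : Target adj R U₀ r b s U) :
    progress adj R s ≤ 3 * b + 2 * (U₀ ∩ R).card + 1 := by
  have hd : Disjoint s.1 s.2 := Finset.disjoint_of_subset_left h.inside h.outside
  have h1 := (minCut_spec adj hd).le U h.inside h.outside
  have h2 := between_le_bdry (adj := adj) h.inside h.outside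
  have h3 : (s.1 ∩ R).card ≤ (U₀ ∩ R).card := by
    rw [← h.terminals]; exact Finset.card_le_card (Finset.inter_subset_inter_right h.inside)
  have h4 := h.bdry_le
  unfold progress
  split_ifs <;> omega

/-- A search step has a right answer, which leads to a state with a target again and makes progress
unless the set that is searched for is covered then. Without boundary the answer is always `0`.
The target grows to `U ∪ W` when `Z` is replaced by the largest minimum cut `W`, by
submodularity. -/
theorem Target.searchStep (ha : ∀ u v, adj u v = adj v u) {U₀ U : Finset (Fin n)} {r : Fin n}
    {b : ℕ} {s : Finset (Fin n) × Finset (Fin n)} (hU₀ : Linked adj U₀) (hr : r ∈ U₀)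
    (h : Target adj R U₀ r b s U) : ∃ q < 2, (b = 0 → q = 0) ∧
      ∃ U', Target adj R U₀ r b (searchStep adj R s q) U' ∧ s.1 ⊆ (searchStep adj R s q).1 ∧
        (U₀ ⊆ (searchStep adj R s q).1 ∨
          progress adj R s + 1 ≤ progress adj R (searchStep adj R s q)) := by
  classical
  obtain ⟨Z, B⟩ := s
  have hd : Disjoint Z B := Finset.disjoint_of_subset_left h.inside h.outside
  have hmc := minCut_spec adj hd
  -- minimum cuts grow with the decisions
  have hlam : ∀ {Z' B' : Finset (Fin n)}, Z ⊆ Z' → B ⊆ B' → Disjoint Z' B' →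
      bdry adj (minCut adj Z B) ≤ bdry adj (minCut adj Z' B') := fun hZ hB hd' =>
    hmc.le _ (hZ.trans (minCut_spec adj hd').subset)
      (Finset.disjoint_of_subset_right hB (minCut_spec adj hd').disj)
  have ha1 : ∀ {Z' : Finset (Fin n)}, Z ⊆ Z' → (Z ∩ R).card ≤ (Z' ∩ R).card := fun hZ =>
    Finset.card_le_card (Finset.inter_subset_inter_right hZ)
  have ha2 : ∀ {Z' : Finset (Fin n)} {x : Fin n}, insert x Z ⊆ Z' → x ∉ Z → x ∈ R →
      (Z ∩ R).card + 1 ≤ (Z' ∩ R).card := fun {Z'} {x} hZ hx hxR => by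
    rw [← Finset.card_insert_of_notMem (a := x) (s := Z ∩ R) (by simp [hx])]
    refine Finset.card_le_card fun y hy => ?_
    rcases Finset.mem_insert.1 hy with rfl | hy
    · exact Finset.mem_inter.2 ⟨hZ (Finset.mem_insert_self _ _), hxR⟩
    · exact Finset.mem_inter.2 ⟨hZ (Finset.mem_insert_of_mem (Finset.mem_inter.1 hy).1),
        (Finset.mem_inter.1 hy).2⟩
  by_cases hP : ((minCut adj Z B ∩ R) \ Z).Nonempty
  · have hst : ∀ q, _root_.searchStep adj R (Z, B) q = decide01 q (Finset.max' _ hP) (Z, B) :=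
      fun q => by rw [_root_.searchStep, dif_pos hP]
    have hx := Finset.max'_mem _ hP
    set x := Finset.max' _ hP with hxdef
    simp only [Finset.mem_sdiff, Finset.mem_inter] at hx
    obtain ⟨⟨hxW, hxR⟩, hxZ⟩ := hx
    by_cases hxU : x ∈ U
    · refine ⟨0, by omega, fun _ => rfl, U, ?_⟩
      rw [hst]
      simp only [decide01, if_true]
      have hd' : Disjoint (insert x Z) B := Finset.disjoint_insert_left.2
        ⟨fun h' => Finset.disjoint_left.1 h.outside hxU h', hd⟩
      refine ⟨⟨Finset.mem_insert_of_mem h.start, h.sub, h.terminals,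
        Finset.insert_subset hxU h.inside, h.outside, h.bdry_le⟩, Finset.subset_insert _ _,
        Or.inr ?_⟩
      have e1 := hlam (Finset.subset_insert x Z) (Finset.Subset.refl B) hd'
      have e2 := ha2 (Finset.Subset.refl _) hxZ hxR
      have e3 := between_mono (adj := adj) (Finset.subset_insert x Z) (Finset.Subset.refl B)
      simp only [progress, if_pos hP]
      omega
    · have hd' : Disjoint Z (insert x B) := Finset.disjoint_insert_right.2 ⟨hxZ, hd⟩
      have hmc' := minCut_spec adj hd'
      have e1 : bdry adj (minCut adj Z B) + 1 ≤ bdry adj (minCut adj Z (insert x B)) := by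
        by_contra hlt
        have := hmc.least _ hmc'.subset
          (Finset.disjoint_of_subset_right (Finset.subset_insert _ _) hmc'.disj) (by omega) hxW
        exact Finset.disjoint_left.1 hmc'.disj this (Finset.mem_insert_self _ _)
      have hUd : Disjoint U (insert x B) := Finset.disjoint_insert_right.2 ⟨hxU, h.outside⟩
      have hb := hmc'.le U h.inside hUd
      refine ⟨1, by omega, fun hb0 => ?_, U, ?_⟩
      · have := h.bdry_le; omega
      rw [hst]
      simp only [decide01, one_ne_zero, if_false]
      refine ⟨⟨h.start, h.sub, h.terminals, h.inside, hUd, h.bdry_le⟩, Finset.Subset.refl _,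
        Or.inr ?_⟩
      have e3 := between_mono (adj := adj) (Finset.Subset.refl Z) (Finset.subset_insert x B)
      simp only [progress, if_pos hP]
      omega
  · obtain ⟨w1, w2, w3⟩ := largest_minCut (R := R) ha hd
    set W := (minCut adj (B ∪ R \ Z) Z)ᶜ with hW
    obtain ⟨w2B, w2R⟩ := Finset.disjoint_union_right.1 w2
    have hWR : ∀ y ∈ W, y ∈ R → y ∈ Z := fun y hy hyR => by
      by_contra hyZ
      exact Finset.disjoint_left.1 w2R hy (Finset.mem_sdiff.2 ⟨hyR, hyZ⟩)
    have hmcR : Disjoint (minCut adj Z B) (B ∪ R \ Z) := by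
      refine Finset.disjoint_union_right.2 ⟨hmc.disj, ?_⟩
      rw [Finset.disjoint_left]
      intro y hy hy'
      rw [Finset.mem_sdiff] at hy'
      exact hP ⟨y, Finset.mem_sdiff.2 ⟨Finset.mem_inter.2 ⟨hy, hy'.1⟩, hy'.2⟩⟩
    have hWlam : bdry adj W = bdry adj (minCut adj Z B) :=
      le_antisymm (w3 _ hmc.subset hmcR).1 (hmc.le W w1 w2B)
    -- `U` may be enlarged by `W`
    have hT : Target adj R U₀ r b (W, B) (U ∪ W) := by
      refine ⟨w1 h.start, h.sub.trans Finset.subset_union_left, ?_, Finset.subset_union_right,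
        Finset.disjoint_union_left.2 ⟨h.outside, w2B⟩, ?_⟩
      · rw [← h.terminals]
        ext y
        simp only [Finset.mem_inter, Finset.mem_union]
        constructor
        · rintro ⟨hy | hy, hyR⟩
          · exact ⟨hy, hyR⟩
          · exact ⟨h.inside (hWR y hy hyR), hyR⟩
        · rintro ⟨hy, hyR⟩; exact ⟨Or.inl hy, hyR⟩
      · have s1 := bdry_submodular adj U W
        have s2 := (w3 (U ∩ W) (Finset.subset_inter h.inside w1)
          (Finset.disjoint_of_subset_left Finset.inter_subset_right w2)).1
        have s3 := h.bdry_le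
        omega
    by_cases hQ : (_root_.outside adj W \ B).Nonempty
    · have hst : ∀ q, _root_.searchStep adj R (Z, B) q = decide01 q (Finset.max' _ hQ) (W, B) :=
        fun q => by rw [_root_.searchStep, dif_neg hP]; exact dif_pos hQ
      have hx := Finset.max'_mem _ hQ
      set x := Finset.max' _ hQ with hxdef
      simp only [Finset.mem_sdiff, _root_.outside, Finset.mem_filter, Finset.mem_univ,
        true_and] at hx
      obtain ⟨⟨hxW, y, hyW, hxy⟩, hxB⟩ := hx
      by_cases hxU : x ∈ U ∪ W
      · refine ⟨0, by omega, fun _ => rfl, U ∪ W, ?_⟩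
        rw [hst]
        simp only [decide01, if_true]
        have hd' : Disjoint (insert x W) B := Finset.disjoint_insert_left.2 ⟨hxB, w2B⟩
        have hZx : Z ⊆ insert x W := w1.trans (Finset.subset_insert _ _)
        refine ⟨⟨Finset.mem_insert_of_mem hT.start, hT.sub, hT.terminals,
          Finset.insert_subset hxU hT.inside, hT.outside, hT.bdry_le⟩, hZx, Or.inr ?_⟩
        have e1 := hlam hZx (Finset.Subset.refl B) hd'
        have e2 := ha1 hZx
        have e3 := between_mono (adj := adj) hZx (Finset.Subset.refl B)
        simp only [progress, if_neg hP]
        by_cases hxR : x ∈ R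
        · have := ha2 (Finset.insert_subset_insert x w1) (fun h' => hxW (w1 h')) hxR
          omega
        by_cases hP' : ((minCut adj (insert x W) B ∩ R) \ insert x W).Nonempty
        · rw [if_pos hP']; omega
        · have hmc' := minCut_spec adj hd'
          have hlt : ¬ bdry adj (minCut adj (insert x W) B) ≤ bdry adj (minCut adj Z B) := by
            intro hle
            have hdis : Disjoint (minCut adj (insert x W) B) (B ∪ R \ Z) := by
              refine Finset.disjoint_union_right.2 ⟨hmc'.disj, ?_⟩
              rw [Finset.disjoint_left]
              intro z hz hz'
              rw [Finset.mem_sdiff] at hz'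
              refine hP' ⟨z, Finset.mem_sdiff.2 ⟨Finset.mem_inter.2 ⟨hz, hz'.1⟩, fun h' => ?_⟩⟩
              rcases Finset.mem_insert.1 h' with rfl | h'
              · exact hxR hz'.1
              · exact hz'.2 (hWR z h' hz'.1)
            exact hxW ((w3 _ (hZx.trans hmc'.subset) hdis).2 (by omega)
              (hmc'.subset (Finset.mem_insert_self _ _)))
          omega
      · have hUd : Disjoint (U ∪ W) (insert x B) :=
          Finset.disjoint_insert_right.2 ⟨hxU, hT.outside⟩
        have hd' : Disjoint W (insert x B) := Finset.disjoint_insert_right.2 ⟨hxW, w2B⟩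
        have e3 : between adj Z B + 1 ≤ between adj W (insert x B) := by
          have e : between adj W (insert x B) = ∑ u ∈ W, adj u x + between adj W B := by
            rw [between, between, ← Finset.sum_add_distrib]
            exact Finset.sum_congr rfl fun u _ => Finset.sum_insert hxB
          have h1 : adj y x ≤ ∑ u ∈ W, adj u x := Finset.single_le_sum (f := fun u => adj u x) (fun _ _ => Nat.zero_le _) hyW
          have h2 := between_mono (adj := adj) w1 (Finset.Subset.refl B)
          have h3 := ha x y
          omega
        have hb : between adj W (insert x B) ≤ _ := between_le_bdry hT.inside hUd
        refine ⟨1, by omega, fun hb0 => ?_, U ∪ W, ?_⟩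
        · have := hT.bdry_le; omega
        rw [hst]
        simp only [decide01, one_ne_zero, if_false]
        refine ⟨⟨hT.start, hT.sub, hT.terminals, hT.inside, hUd, hT.bdry_le⟩, w1, Or.inr ?_⟩
        have e1 := hlam w1 (Finset.subset_insert x B) hd'
        have e2 := ha1 w1
        simp only [progress, if_neg hP]
        omega
    · have hst : ∀ q, _root_.searchStep adj R (Z, B) q = (W, B) :=
        fun q => by rw [_root_.searchStep, dif_neg hP]; exact dif_neg hQ
      refine ⟨0, by omega, fun _ => rfl, U ∪ W, ?_⟩
      rw [hst]
      refine ⟨hT, w1, Or.inl ?_⟩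
      rw [← Finset.inter_eq_left]
      by_contra hne
      obtain ⟨y, hy, x, hx, hxy⟩ := hU₀ (U₀ ∩ W) Finset.inter_subset_left
        ⟨r, Finset.mem_inter.2 ⟨hr, hT.start⟩⟩ hne
      simp only [Finset.mem_sdiff, Finset.mem_inter, not_and] at hx hy
      refine hQ ⟨x, Finset.mem_sdiff.2 ⟨?_, fun hxB =>
        Finset.disjoint_left.1 h.outside (h.sub hx.1) hxB⟩⟩
      simp only [_root_.outside, Finset.mem_filter, Finset.mem_univ, true_and]
      exact ⟨hx.2 hx.1, y, hy.2, hxy⟩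

/-- Some advice leads the search to the terminals of a connected set `U₀` with at most `K` terminals
and a boundary of at most `b` edges. For `b = 0` nothing has to be decided. -/
theorem exists_runDigits_searchStep (ha : ∀ u v, adj u v = adj v u) {U₀ : Finset (Fin n)}
    {r : Fin n} {b K : ℕ} (hU₀ : Linked adj U₀) (hr : r ∈ U₀) (hb : bdry adj U₀ ≤ b)
    (hK : (U₀ ∩ R).card ≤ K) :
    ∃ h < (if b = 0 then 1 else 2 ^ (3 * b + 2 * K + 2)),
      U₀ ⊆ (runDigits (searchStep adj R) 2 (3 * b + 2 * K + 2) ({r}, ∅) h).1 ∧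
      (runDigits (searchStep adj R) 2 (3 * b + 2 * K + 2) ({r}, ∅) h).1 ∩ R = U₀ ∩ R := by
  set D := 3 * b + 2 * K + 2 with hD
  let Inv (j : ℕ) (s : Finset (Fin n) × Finset (Fin n)) : Prop :=
    ∃ U, Target adj R U₀ r b s U ∧ (U₀ ⊆ s.1 ∨ D ≤ j + progress adj R s)
  have hstep : ∀ j s, Inv (j + 1) s → ∃ q < 2, (b = 0 → q = 0) ∧ Inv j (searchStep adj R s q) := by
    rintro j s ⟨U, hU, hp⟩
    obtain ⟨q, hq, hq0, U', hU', hsub, hp'⟩ := hU.searchStep ha hU₀ hr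
    refine ⟨q, hq, hq0, U', hU', ?_⟩
    rcases hp with hp | hp
    · exact Or.inl (hp.trans hsub)
    · exact hp'.imp id fun hp' => by omega
  have h0 : Inv D ({r}, ∅) := ⟨U₀, ⟨by simp, Finset.Subset.refl _, rfl, by simpa using hr, by simp,
    hb⟩, Or.inr (by omega)⟩
  have hend : ∀ s, Inv 0 s → U₀ ⊆ s.1 ∧ s.1 ∩ R = U₀ ∩ R := by
    rintro s ⟨U, hU, hp⟩
    have hsub : U₀ ⊆ s.1 := hp.resolve_right fun h => by
      have := hU.progress_le
      omega
    refine ⟨hsub, Finset.Subset.antisymm ?_ (Finset.inter_subset_inter_right hsub)⟩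
    rw [← hU.terminals]
    exact Finset.inter_subset_inter_right hU.inside
  by_cases hb0 : b = 0
  · refine ⟨0, by simp [hb0], hend _ ?_⟩
    have : ∀ j s, Inv j s → Inv 0 (runDigits (searchStep adj R) 2 j s 0) := by
      intro j
      induction j with
      | zero => exact fun s hs => hs
      | succ j ih =>
        intro s hs
        obtain ⟨q, -, hq0, hi⟩ := hstep j s hs
        rw [hq0 hb0] at hi
        exact ih _ hi
    exact this D _ h0
  · obtain ⟨h, hh, hi⟩ := exists_runDigits (by omega)
      (fun j s hs => (hstep j s hs).imp fun q hq => ⟨hq.1, hq.2.2⟩) D _ h0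
    exact ⟨h, by rwa [if_neg hb0], hend _ hi⟩

end Branching

namespace LoopLang
open WordRAM
namespace Stmt
open LoopLang.Expr

/-- The last vertex that satisfies a condition, found by `find`. -/
theorem find_var_max {n : ℕ} {x z : ℕ} {c : Expr} {s : State} (h0 : s.var 0 = n) (hxz : x ≠ z)
    (hc : c.usesVar z = false) {P : Finset (Fin n)}
    (hP : ∀ v : Fin n, c.eval (s.setVar x v) ≠ 0 ↔ v ∈ P) :
    ((find x z c).den s).var z = if h : P.Nonempty then (P.max' h : ℕ) + 1 else s.var z := by
  rcases find_var (s := s) hxz hc with ⟨h1, h2⟩ | ⟨i, hi, h1, h2, h3⟩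
  · rw [dif_neg, h1]
    rintro ⟨v, hv⟩
    exact (hP v).2 hv (h2 v (by rw [h0]; exact v.2))
  · rw [h0] at hi h3
    have hmem : (⟨i, hi⟩ : Fin n) ∈ P := (hP ⟨i, hi⟩).1 h2
    rw [dif_pos ⟨_, hmem⟩, h1]
    have : P.max' ⟨_, hmem⟩ = ⟨i, hi⟩ := le_antisymm
      (Finset.max'_le _ _ _ fun v hv => h3 v v.2 ((hP v).2 hv)) (Finset.le_max' _ _ hmem)
    rw [this]

/-- The smallest minimum cut between the vertices with `c ≠ 0` and those with `d ≠ 0` (conditions on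
variable `20`) in the graph of array `3` is computed in array `7`. -/
def cutBetween (c d : Expr) : Stmt :=
  fill 20 4 (.var 10 - .var 10 * (1 - c)) ;; fill2 20 21 5 (mat 3 20 21) ;; fill 20 6 d ;; flow

theorem bdry_le_sq {n : ℕ} {adj : Fin n → Fin n → ℕ} (ha : IsSym01 adj) (W : Finset (Fin n)) :
    bdry adj W ≤ n * n := by
  rw [bdry_eq_sum]
  calc _ ≤ ∑ u : Fin n, ∑ v : Fin n, 1 := Finset.sum_le_sum fun u _ => Finset.sum_le_sum fun v _ => by
        have := ha.le u v
        split_ifs <;> omega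
    _ = n * n := by simp

theorem cutBetween_spec {n : ℕ} {c d : Expr} {s : State} {Z B : Finset (Fin n)} (h0 : s.var 0 = n)
    (h10 : s.var 10 = n * n + 1) (ha : IsSym01 (grid s 3 n)) (hZB : Disjoint Z B)
    (hc4 : c.usesArr 4 = false) (hd4 : d.usesArr 4 = false) (hd5 : d.usesArr 5 = false)
    (hd6 : d.usesArr 6 = false) (hd21 : d.usesVar 21 = false)
    (hc : ∀ v : Fin n, c.eval (s.setVar 20 v) ≠ 0 ↔ v ∈ Z)
    (hd : ∀ v : Fin n, d.eval (s.setVar 20 v) ≠ 0 ↔ v ∈ B) :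
    supp ((cutBetween c d).den s) 7 n = minCut (grid s 3 n) Z B := by
  set e4 : Expr := .var 10 - .var 10 * (1 - c) with he4
  set s1 := (fill 20 4 e4).den s with hs1
  set s2 := (fill2 20 21 5 (mat 3 20 21)).den s1 with hs2
  set s3 := (fill 20 6 d).den s2 with hs3
  have h1 : s1.var 0 = n := by rw [hs1, den_var rfl, h0]
  have h2 : s2.var 0 = n := by rw [hs2, den_var rfl, h1]
  have h3 : s3.var 0 = n := by rw [hs3, den_var rfl, h2]
  have h10' : s3.var 10 = n * n + 1 := by
    rw [hs3, den_var rfl, hs2, den_var rfl, hs1, den_var rfl, h10]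
  have f4 : row s3 4 n = fun v => if v ∈ Z then n * n + 1 else 0 := by
    rw [row_congr (show s3.arr 4 = s1.arr 4 by rw [hs3, den_arr rfl, hs2, den_arr rfl])]
    ext v
    rw [row, hs1, fill_arr (by simp [he4, usesArr, hc4, HSub.hSub, HMul.hMul, Sub.sub, Mul.mul,
      OfNat.ofNat]) (by rw [h0]; exact v.2)]
    have := hc v
    simp only [he4, eval_sub, eval_var, eval_mul, eval_one, setVar_var_of_ne (show 10 ≠ 20 by omega),
      h10]
    split_ifs with hv
    · have : 1 - c.eval (s.setVar 20 v) = 0 := by have := this.2 hv; omega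
      rw [this]; simp
    · have : c.eval (s.setVar 20 v) = 0 := by by_contra h; exact hv (this.1 h)
      rw [this]; simp
  have f5 : grid s3 5 n = grid s 3 n := by
    rw [grid_congr (show s3.arr 5 = s2.arr 5 by rw [hs3, den_arr rfl])]
    ext u v
    have e := fill2_arr (x := 20) (y := 21) (a := 5) (e := mat 3 20 21) (s := s1) (by omega)
      (by omega) (by omega) rfl (i := u) (j := v) (by rw [h1]; exact u.2) (by rw [h1]; exact v.2)
    rw [h1] at e
    rw [grid, hs2, e]
    have a3 : s1.arr 3 = s.arr 3 := by rw [hs1, den_arr rfl]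
    simp [h1, a3, grid]
  have f6 : supp s3 6 n = B := by
    ext v
    rw [mem_supp, hs3, fill_arr hd6 (by rw [h2]; exact v.2), ← hd v]
    have : d.eval (s2.setVar 20 v) = d.eval (s.setVar 20 v) := by
      refine Expr.eval_congr (fun x hx => ?_) (fun a hx => ?_)
      · have h21 : x ≠ 21 := by rintro rfl; simp [hd21] at hx
        by_cases hx20 : x = 20
        · simp [hx20]
        · rw [setVar_var_of_ne hx20, setVar_var_of_ne hx20, hs2,
            den_var (by simp [fill2, writesVar, hx20, h21]), hs1,
            den_var (by simp [fill, writesVar, hx20])]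
      · have h4 : a ≠ 4 := by rintro rfl; simp [hd4] at hx
        have h5 : a ≠ 5 := by rintro rfl; simp [hd5] at hx
        rw [setVar_arr, setVar_arr, hs2, den_arr (by simp [fill2, writesArr, h5]), hs1,
          den_arr (by simp [fill, writesArr, h4])]
    rw [this]
  have hlt : bdry (grid s 3 n) Z < n * n + 1 := Nat.lt_succ_of_le (bdry_le_sq ha Z)
  have hfl := flow_spec (s := s3) h3 ⟨Z, by rw [f6]; exact hZB, by
    rw [h10', f4, f5, cutVal, Finset.sum_eq_zero, Nat.zero_add]
    · exact hlt
    · intro v hv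
      rw [if_neg (Finset.mem_compl.1 hv)]⟩
  rw [f4, f5, f6] at hfl
  exact (isMinCut_of_cutVal hZB hlt hfl.1 hfl.2).unique (minCut_spec _ hZB)

/-- The part of a step of the search in which there is no forced terminal: the set of the vertices
that are in is enlarged, and a vertex outside of it is chosen. -/
def searchExtend : Stmt :=
  cutBetween (ent 11 20 + (ent 1 20 - ent 10 20)) (ent 10 20) ;;
  fill 20 10 (1 - ent 7 20) ;; tally 20 21 23 13 (ent 10 21 * mat 3 20 21) ;;
  find 20 32 (ent 13 20 * (1 - ent 10 20) * (1 - ent 11 20))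

/-- The end of a step of the search: the chosen vertex is put in or out. -/
def searchDecide : Stmt :=
  ite (.var 32) (ite (.var 30) (put 11 (.var 32 - 1) 1) (put 10 (.var 32 - 1) 1)) skip

/-- One step of the search; the sets of the vertices that are in and out are in the arrays `10` and
`11`, the decision in variable `30`. -/
def searchProg : Stmt :=
  set 32 0 ;; cutBetween (ent 10 20) (ent 11 20) ;;
  find 20 32 (ent 7 20 * ent 1 20 * (1 - ent 10 20)) ;;
  ite (.var 32) skip searchExtend ;; searchDecide

theorem searchDecide_den {n : ℕ} {s : State} {x : Fin n} (hx : s.var 32 = x + 1) :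
    let t := searchDecide.den s
    (supp t 10 n, supp t 11 n) = decide01 (s.var 30) x (supp s 10 n, supp s 11 n) := by
  have hins : ∀ A : Finset (Fin n), insertNum A x = insert x A := fun A => by
    ext v; simp [insertNum, Fin.ext_iff, or_comm]
  have hne : ∀ {a b i w : ℕ}, a ≠ b → supp (s.setArr a i w) b n = supp s b n := fun h =>
    supp_congr (by simp [h.symm])
  intro t
  have ht : t = if s.var 30 ≠ 0 then s.setArr 11 x 1 else s.setArr 10 x 1 := by
    simp only [t, searchDecide, den_ite, eval_var, den_put, eval_sub, eval_one, hx, Nat.add_sub_cancel]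
    simp
  rw [ht, decide01]
  by_cases h : s.var 30 = 0
  · simp only [h, ne_eq, not_true, if_false, if_true]
    rw [supp_put one_ne_zero, hins, hne (by omega)]
  · simp only [h, ne_eq, not_false_iff, if_false, if_true]
    rw [supp_put one_ne_zero, hins, hne (by omega)]

theorem searchProg_spec {n : ℕ} {s : State} (h0 : s.var 0 = n) (h10 : s.var 10 = n * n + 1)
    (hR : ∀ v, row s 1 n v ≤ 1) (ha : IsSym01 (grid s 3 n))
    (hd : Disjoint (supp s 10 n) (supp s 11 n)) :
    (supp (searchProg.den s) 10 n, supp (searchProg.den s) 11 n) =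
      searchStep (grid s 3 n) (supp s 1 n) (supp s 10 n, supp s 11 n) (s.var 30) := by
  set adj := grid s 3 n with hadj
  set R := supp s 1 n with hRdef
  set Z := supp s 10 n with hZ
  set B := supp s 11 n with hB
  set s1 := (cutBetween (ent 10 20) (ent 11 20)).den (s.setVar 32 0) with hs1
  set s2 := (find 20 32 (ent 7 20 * ent 1 20 * (1 - ent 10 20))).den s1 with hs2
  have h1 : s1.var 0 = n := by rw [hs1, den_var rfl]; simpa using h0
  have h7 : supp s1 7 n = minCut adj Z B := by
    have := cutBetween_spec (c := ent 10 20) (d := ent 11 20) (s := s.setVar 32 0) (Z := Z) (B := B)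
      (by simpa using h0) (by simpa using h10) ha hd rfl rfl rfl rfl rfl
      (fun v => by rw [hZ, mem_supp]; simp) (fun v => by rw [hB, mem_supp]; simp)
    exact this
  have a1 : ∀ a, a = 1 ∨ a = 3 ∨ a = 10 ∨ a = 11 → s1.arr a = s.arr a := by
    rintro a (rfl | rfl | rfl | rfl) <;> rw [hs1, den_arr rfl] <;> rfl
  have hP : ∀ v : Fin n, (ent 7 20 * ent 1 20 * (1 - ent 10 20)).eval (s1.setVar 20 v) ≠ 0 ↔
      v ∈ (minCut adj Z B ∩ R) \ Z := fun v => by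
    rw [Finset.mem_sdiff, Finset.mem_inter, ← h7, hRdef, hZ, mem_supp, mem_supp, mem_supp]
    simp [a1]
    omega
  have h32 := find_var_max (x := 20) (z := 32) h1 (by omega) rfl hP
  have h32' : s1.var 32 = 0 := by rw [hs1, den_var rfl]; simp
  rw [h32', ← hs2] at h32
  have a2 : ∀ a, s2.arr a = s1.arr a := fun a => by rw [hs2, den_arr rfl]
  have h2 : s2.var 0 = n := by rw [hs2, den_var rfl, h1]
  have h30 : s2.var 30 = s.var 30 := by rw [hs2, den_var rfl, hs1, den_var rfl]; simp
  have hden : searchProg.den s = searchDecide.den ((ite (.var 32) skip searchExtend).den s2) := rfl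
  have hsup2 : ∀ a, a = 1 ∨ a = 3 ∨ a = 10 ∨ a = 11 → s2.arr a = s.arr a := fun a h => by
    rw [a2, a1 a h]
  by_cases hne : ((minCut adj Z B ∩ R) \ Z).Nonempty
  · rw [dif_pos hne] at h32
    have : (ite (.var 32) skip searchExtend).den s2 = s2 := by
      rw [den_ite, eval_var, h32]; simp
    rw [hden, this, searchStep, dif_pos hne]
    have := searchDecide_den (n := n) h32
    simp only at this
    rw [this, h30, supp_congr (hsup2 10 (by simp)), supp_congr (hsup2 11 (by simp))]
  · rw [dif_neg hne] at h32
    have hi : (ite (.var 32) skip searchExtend).den s2 = searchExtend.den s2 := by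
      rw [den_ite, eval_var, h32]; simp
    set s3 := (cutBetween (ent 11 20 + (ent 1 20 - ent 10 20)) (ent 10 20)).den s2 with hs3
    set s4 := (fill 20 10 (1 - ent 7 20)).den s3 with hs4
    set s5 := (tally 20 21 23 13 (ent 10 21 * mat 3 20 21)).den s4 with hs5
    set s6 := (find 20 32 (ent 13 20 * (1 - ent 10 20) * (1 - ent 11 20))).den s5 with hs6
    have hi' : searchExtend.den s2 = s6 := by rw [searchExtend, den_seq, den_seq, den_seq]
    have h3 : s3.var 0 = n := by rw [hs3, den_var rfl, h2]
    have h4 : s4.var 0 = n := by rw [hs4, den_var rfl, h3]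
    have h5 : s5.var 0 = n := by rw [hs5, den_var rfl, h4]
    set W := (minCut adj (B ∪ R \ Z) Z)ᶜ with hW
    have hdis : Disjoint (B ∪ R \ Z) Z :=
      Finset.disjoint_union_left.2 ⟨hd.symm, Finset.sdiff_disjoint⟩
    have g3 : grid s2 3 n = adj := grid_congr (hsup2 3 (by simp))
    have f7 : supp s3 7 n = minCut adj (B ∪ R \ Z) Z := by
      have := cutBetween_spec (c := ent 11 20 + (ent 1 20 - ent 10 20)) (d := ent 10 20) (s := s2)
        (Z := B ∪ R \ Z) (B := Z) h2 (by rw [hs2, den_var rfl, hs1, den_var rfl]; simpa using h10)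
        (by rw [g3]; exact ha) hdis rfl rfl rfl rfl rfl
        (fun v => by
          have := hR v
          simp only [row] at this
          rw [Finset.mem_union, Finset.mem_sdiff, hB, hRdef, hZ, mem_supp, mem_supp, mem_supp]
          simp [hsup2]
          omega)
        (fun v => by rw [hZ, mem_supp]; simp [hsup2])
      rw [g3] at this
      exact this
    have g10 : supp s4 10 n = W := by
      ext v
      rw [mem_supp, hs4, fill_arr rfl (by rw [h3]; exact v.2), hW, Finset.mem_compl, ← f7, mem_supp]
      simp
      omega
    have b10 : s5.arr 10 = s4.arr 10 := by rw [hs5, den_arr rfl]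
    have b11 : s5.arr 11 = s.arr 11 := by
      rw [hs5, den_arr rfl, hs4, den_arr rfl, hs3, den_arr rfl, hsup2 11 (by simp)]
    have b3 : s4.arr 3 = s.arr 3 := by
      rw [hs4, den_arr rfl, hs3, den_arr rfl, hsup2 3 (by simp)]
    have a13 : ∀ u : Fin n, s5.arr 13 u ≠ 0 ↔ ∃ y ∈ W, adj u y ≠ 0 := by
      intro u
      rw [hs5, tally_arr (by omega) (by omega) (by omega) (by omega) (by omega) (by omega) rfl rfl
        (by rw [h4]; exact u.2), h4, card_range_filter, Finset.card_ne_zero]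
      simp only [Finset.Nonempty, Finset.mem_filter, Finset.mem_univ, true_and]
      refine exists_congr fun y => ?_
      rw [← g10, mem_supp]
      simp [h4, b3, hadj, grid]
    have hQ : ∀ v : Fin n, (ent 13 20 * (1 - ent 10 20) * (1 - ent 11 20)).eval (s5.setVar 20 v) ≠ 0 ↔
        v ∈ outside adj W \ B := fun v => by
      have h13 := a13 v
      have hWv : v ∈ W ↔ s5.arr 10 v ≠ 0 := by rw [← g10, mem_supp, b10]
      simp only [Finset.mem_sdiff, outside, Finset.mem_filter, Finset.mem_univ, true_and, ← h13, hWv,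
        hB, mem_supp, ← b11]
      simp
      omega
    have k32 := find_var_max (x := 20) (z := 32) h5 (by omega) rfl hQ
    have k32' : s5.var 32 = 0 := by
      rw [hs5, den_var rfl, hs4, den_var rfl, hs3, den_var rfl, h32]
    rw [k32', ← hs6] at k32
    have c10 : supp s6 10 n = W := by
      rw [← g10]; exact supp_congr (by rw [hs6, den_arr rfl, b10])
    have c11 : supp s6 11 n = B := supp_congr (by rw [hs6, den_arr rfl, b11])
    have c30 : s6.var 30 = s.var 30 := by
      rw [hs6, den_var rfl, hs5, den_var rfl, hs4, den_var rfl, hs3, den_var rfl, h30]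
    rw [hden, hi, hi', searchStep, dif_neg hne]
    dsimp only
    by_cases hne' : (outside adj W \ B).Nonempty
    · rw [dif_pos hne'] at k32
      rw [dif_pos hne']
      have := searchDecide_den (n := n) k32
      simp only at this
      rw [this, c10, c11, c30]
    · rw [dif_neg hne'] at k32
      rw [dif_neg hne', searchDecide, den_ite, eval_var, k32]
      simp [c10, c11, hW]

/-- Array `9` becomes the set found by the search with the advice, if it has at most `K` terminals
(variable `12`), and empty otherwise. -/
def decodeSearch : Stmt :=
  fill 20 11 0 ;; decodeStart 10 ;; digitLoop 2 13 searchProg ;;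
  set 33 0 ;; count 20 33 (ent 10 20 * ent 1 20) ;;
  fill 20 9 (ent 10 20 - ent 10 20 * (.var 33 - .var 12))

open Classical in
/-- The outcome of the search for the advice `g`. -/
noncomputable def searchResult {n : ℕ} (adj : Fin n → Fin n → ℕ) (R : Finset (Fin n)) (K D : ℕ)
    (r : Fin n) (h : ℕ) : Finset (Fin n) :=
  let Z := (runDigits (searchStep adj R) 2 D ({r}, ∅) h).1
  if (Z ∩ R).card ≤ K then Z else ∅

theorem decodeSearch_spec {n : ℕ} {s : State} (h0 : s.var 0 = n) (hn : 0 < n)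
    (h10 : s.var 10 = n * n + 1) (hR : ∀ v, row s 1 n v ≤ 1) (ha : IsSym01 (grid s 3 n)) :
    supp (decodeSearch.den s) 9 n = searchResult (grid s 3 n) (supp s 1 n) (s.var 12) (s.var 13)
      ⟨s.var 28 % n, Nat.mod_lt _ hn⟩ (s.var 28 / n) := by
  set adj := grid s 3 n with hadj
  set R := supp s 1 n with hRdef
  set s0 := (fill 20 11 0).den s with hs0
  have k0 : s0.var 0 = n := by rw [hs0, den_var rfl, h0]
  have k28 : s0.var 28 = s.var 28 := by rw [hs0, den_var rfl]
  set s1 := (decodeStart 10).den s0 with hs1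
  obtain ⟨e1, e2⟩ := decodeStart_spec (a := 10) k0 hn
  have e11 : supp s1 11 n = ∅ := by
    rw [← supp_fill_zero (s := s) (x := 20) (a := 11) h0]
    exact supp_congr (by rw [hs1, den_arr rfl])
  have hE1 : ∀ {p : Stmt}, p.writesVar 0 = false → p.writesVar 10 = false → p.writesArr 1 = false →
      p.writesArr 3 = false → ∀ t : State, (t.var 0 = n ∧ t.var 10 = n * n + 1 ∧
      t.arr 1 = s.arr 1 ∧ t.arr 3 = s.arr 3) → ((p.den t).var 0 = n ∧ (p.den t).var 10 = n * n + 1 ∧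
      (p.den t).arr 1 = s.arr 1 ∧ (p.den t).arr 3 = s.arr 3) := by
    rintro p p0 p10 p1 p3 t ⟨t0, t10, t1, t3⟩
    exact ⟨by rw [den_var p0, t0], by rw [den_var p10, t10], by rw [den_arr p1, t1],
      by rw [den_arr p3, t3]⟩
  have hdl := digitLoop_spec (β := 2) (y := 13) (b := 2) (body := searchProg) (s := s1)
    (Env := fun t => (t.var 0 = n ∧ t.var 10 = n * n + 1 ∧ t.arr 1 = s.arr 1 ∧ t.arr 3 = s.arr 3) ∧
      Disjoint (supp t 10 n) (supp t 11 n))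
    (abs := fun t => (supp t 10 n, supp t 11 n)) (step := searchStep adj R)
    ⟨hE1 rfl rfl rfl rfl _ (hE1 rfl rfl rfl rfl _ ⟨h0, h10, rfl, rfl⟩), by rw [e11]; simp⟩
    (fun t x v h hx => ⟨⟨by rw [setVar_var_of_ne (by omega)]; exact h.1.1,
      by rw [setVar_var_of_ne (by omega)]; exact h.1.2.1, h.1.2.2⟩, h.2⟩) (fun t x v _ => rfl)
    (fun t h => rfl) rfl (fun t h => by
      have hg : grid t 3 n = adj := grid_congr h.1.2.2.2
      have hr : supp t 1 n = R := supp_congr h.1.2.2.1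
      have := searchProg_spec h.1.1 h.1.2.1 (fun v => by rw [row_congr h.1.2.2.1]; exact hR v)
        (by rw [hg]; exact ha) h.2
      rw [hg, hr] at this
      refine ⟨⟨hE1 rfl rfl rfl rfl _ h.1, ?_⟩, this⟩
      have hd := searchStep_disjoint (R := R) ha.symm (s := (supp t 10 n, supp t 11 n)) h.2 (t.var 30)
      rw [← this] at hd
      exact hd)
  set s2 := (digitLoop 2 13 searchProg).den s1 with hs2
  obtain ⟨⟨⟨f0, -, f1, -⟩, -⟩, fr⟩ := hdl
  have e13 : s1.var 13 = s.var 13 := by rw [hs1, den_var rfl, hs0, den_var rfl]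
  rw [e1, e2, e11, e13, k28] at fr
  set Z := (runDigits (searchStep adj R) 2 (s.var 13)
    ({⟨s.var 28 % n, Nat.mod_lt _ hn⟩}, ∅) (s.var 28 / n)).1 with hZ
  have fZ : supp s2 10 n = Z := by rw [hZ, ← fr]
  set s3 := (count 20 33 (ent 10 20 * ent 1 20)).den (s2.setVar 33 0) with hs3
  have g0 : s3.var 0 = n := by rw [hs3, den_var rfl]; simpa using f0
  have g12 : s3.var 12 = s.var 12 := by
    rw [hs3, den_var rfl, setVar_var_of_ne (by omega), hs2, den_var rfl, hs1, den_var rfl, hs0,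
      den_var rfl]
  have g10 : s3.arr 10 = s2.arr 10 := by rw [hs3, den_arr rfl]; rfl
  have g33 : s3.var 33 = (Z ∩ R).card := by
    have e0 : (s2.setVar 33 0).var 0 = n := by simpa using f0
    rw [hs3, count_var (by omega) rfl, e0, card_range_filter, setVar_var_self, Nat.zero_add]
    congr 1
    ext v
    rw [Finset.mem_inter, ← fZ, hRdef, mem_supp, mem_supp]
    simp [f1]
  have hden : decodeSearch.den s =
    (fill 20 9 (ent 10 20 - ent 10 20 * (.var 33 - .var 12))).den s3 := rfl
  rw [hden]
  ext v
  rw [mem_supp, fill_arr rfl (by rw [g0]; exact v.2)]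
  have hv : v ∈ Z ↔ s3.arr 10 v ≠ 0 := by rw [g10, ← fZ, mem_supp]
  have hev : (ent 10 20 - ent 10 20 * (.var 33 - .var 12)).eval (s3.setVar 20 v) =
      s3.arr 10 v - s3.arr 10 v * ((Z ∩ R).card - s.var 12) := by
    simp [g33, g12]
  rw [hev, searchResult]
  rw [← hZ]
  split_ifs with hc
  · rw [hv, Nat.sub_eq_zero_of_le hc]; simp
  · have : s3.arr 10 v ≤ s3.arr 10 v * ((Z ∩ R).card - s.var 12) :=
      Nat.le_mul_of_pos_right _ (by omega)
    simp [Nat.sub_eq_zero_of_le this]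

end Stmt
end LoopLang

/-! ### Feasibility of the moves -/

section Feasible
variable {V : Type*} [DecidableEq V]

/-- Deleting the edges `S` of the graph `adj₀` leaves components with at most `K` vertices of `R`,
and `S` contains all edges of `adj₀` that are not in `adj`. -/
structure Separates (adj₀ adj : V → V → ℕ) (R : Finset V) (K : ℕ) (S : V → V → ℕ) : Prop where
  le : ∀ u v, S u v ≤ adj₀ u v
  eq : ∀ u v, adj u v = 0 → S u v = adj₀ u v
  card_le : ∀ U, Linked (fun u v => adj₀ u v - S u v) U → (U ∩ R).card ≤ K

theorem separates_self (adj₀ adj : V → V → ℕ) (R : Finset V) {K : ℕ} (hK : 1 ≤ K) :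
    Separates adj₀ adj R K adj₀ := by
  refine ⟨fun _ _ => le_rfl, fun _ _ _ => rfl, fun U hU => ?_⟩
  refine (Finset.card_le_card Finset.inter_subset_left).trans (le_trans ?_ hK)
  rw [Finset.card_le_one]
  intro a ha b hb
  by_contra hab
  obtain ⟨y, _, x, _, h⟩ := hU {a} (by simpa using ha) (by simp) (fun h => by
    rw [← h] at hb; exact hab (Finset.mem_singleton.1 hb).symm)
  simp at h

theorem Separates.moveMat {adj₀ adj S : V → V → ℕ} {R W : Finset V} {K : ℕ}
    (h₀ : IsSym01 adj₀) (ha : ∀ u v, adj u v ≤ adj₀ u v) (h : Separates adj₀ adj R K S)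
    (hW : (W ∩ R).card ≤ K) : Separates adj₀ adj R K (moveMat adj S W) := by
  refine ⟨fun u v => ?_, fun u v huv => ?_, fun U hU => ?_⟩
  · have h1 := h.le u v
    have h2 := ha u v
    unfold _root_.moveMat
    split_ifs <;> omega
  · rw [_root_.moveMat, if_pos huv, h.eq u v huv]
  -- no remaining edge leaves `W`
  have hcross : ∀ u v, u ∈ W → v ∉ W →
      adj₀ u v - _root_.moveMat adj S W u v = 0 ∧ adj₀ v u - _root_.moveMat adj S W v u = 0 := by
    intro u v hu hv
    have h1 := h.eq u v
    have h2 := h.eq v u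
    have h3 := h₀.le u v
    have h4 := h₀.le v u
    simp only [_root_.moveMat, hu, hv, and_false, false_and, or_true, true_or, if_true, if_false]
    constructor <;> split_ifs <;> omega
  by_cases hUW : (U ∩ W).Nonempty
  · have : U ∩ W = U := by
      by_contra hne
      obtain ⟨y, hy, x, hx, hxy⟩ := hU _ Finset.inter_subset_left hUW hne
      have hxW : x ∉ W := fun hxW => by simp_all
      exact hxy (hcross y x (Finset.mem_inter.1 hy).2 hxW).2
    refine (Finset.card_le_card (Finset.inter_subset_inter_right ?_)).trans hW
    exact Finset.inter_eq_left.1 this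
  · refine h.card_le U fun A hA hA0 hAU => ?_
    obtain ⟨y, hy, x, hx, hxy⟩ := hU A hA hA0 hAU
    have hout : ∀ z ∈ U, z ∉ W := fun z hz hzW => hUW ⟨z, Finset.mem_inter.2 ⟨hz, hzW⟩⟩
    refine ⟨y, hy, x, hx, ?_⟩
    have e : _root_.moveMat adj S W x y = S x y := by
      simp [_root_.moveMat, hout x (Finset.mem_sdiff.1 hx).1, hout y (hA hy)]
    simpa only [e] using hxy

end Feasible

/-! ### The quality of local optima -/

section Quality
variable {V : Type*} [Fintype V] [DecidableEq V]

/-- The number of ordered pairs of `f` with at least one vertex in `W`. -/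
def touching (f : V → V → ℕ) (W : Finset V) : ℕ := ∑ u, ∑ v, if u ∈ W ∨ v ∈ W then f u v else 0

/-- The number of ordered pairs of `f` with exactly one vertex in `W`. -/
def crossing (f : V → V → ℕ) (W : Finset V) : ℕ := ∑ u, ∑ v, if (u ∈ W ↔ v ∈ W) then 0 else f u v

theorem crossing_eq {f : V → V → ℕ} (hf : ∀ u v, f u v = f v u) (W : Finset V) :
    crossing f W = 2 * bdry f W := by
  have h : crossing f W = bdry f W + bdry f Wᶜ := by
    rw [bdry_eq_sum, bdry_eq_sum, crossing, ← Finset.sum_add_distrib]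
    refine Finset.sum_congr rfl fun u _ => ?_
    rw [← Finset.sum_add_distrib]
    refine Finset.sum_congr rfl fun v _ => ?_
    by_cases h1 : u ∈ W <;> by_cases h2 : v ∈ W <;> simp [h1, h2]
  rw [h, bdry_compl hf]; ring

/-- What a move does to the size of `S`. -/
theorem active_moveMat_add {adj S : V → V → ℕ} (ha : ∀ u v, adj u v ≤ 1) (W : Finset V) :
    active adj (moveMat adj S W) + touching (fun u v => adj u v * S u v) W =
      active adj S + crossing adj W := by
  simp only [active, touching, crossing, ← Finset.sum_add_distrib]
  refine Finset.sum_congr rfl fun u _ => Finset.sum_congr rfl fun v _ => ?_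
  have := ha u v
  unfold moveMat
  by_cases h1 : u ∈ W <;> by_cases h2 : v ∈ W <;>
  interval_cases adj u v <;> simp [h1, h2, Nat.add_comm]

/-- If moving to `O` without the vertices in `Q` does not shrink `S`, then `S` has not many more
edges at `O` than the edges that leave `O`. -/
theorem touching_le_of_move {adj S : V → V → ℕ} (ha : IsSym01 adj) (hS : ∀ u v, S u v ≤ 1)
    (O Q : Finset V) (h : active adj S ≤ active adj (moveMat adj S (O \ Q))) :
    touching (fun u v => adj u v * S u v) O ≤ crossing adj O + 2 * ∑ u ∈ O ∩ Q, ∑ v, adj u v := by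
  have h1 := active_moveMat_add (S := S) ha.le (O \ Q)
  have h2 : touching (fun u v => adj u v * S u v) (O \ Q) ≤ crossing adj (O \ Q) := by omega
  have hQ : ∑ u ∈ O ∩ Q, ∑ v, adj u v = ∑ u, ∑ v, if u ∈ O ∩ Q then adj u v else 0 := by
    rw [← Finset.sum_filter_add_sum_filter_not Finset.univ (· ∈ O ∩ Q)]
    have e : ∑ u ∈ Finset.univ.filter (· ∉ O ∩ Q), ∑ v, (if u ∈ O ∩ Q then adj u v else 0) = 0 :=
      Finset.sum_eq_zero fun u hu => by simp [(Finset.mem_filter.1 hu).2]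
    rw [e, Nat.add_zero, Finset.filter_univ_mem]
    exact Finset.sum_congr rfl fun u hu => by simp only [hu, if_true]
  have hQ' : ∑ u ∈ O ∩ Q, ∑ v, adj u v = ∑ u, ∑ v, if v ∈ O ∩ Q then adj u v else 0 := by
    rw [hQ, Finset.sum_comm]
    exact Finset.sum_congr rfl fun u _ => Finset.sum_congr rfl fun v _ => by rw [ha.symm]
  have key : touching (fun u v => adj u v * S u v) O + crossing adj (O \ Q) ≤
      touching (fun u v => adj u v * S u v) (O \ Q) + crossing adj O +
        (∑ u, ∑ v, (if u ∈ O ∩ Q then adj u v else 0) +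
          ∑ u, ∑ v, if v ∈ O ∩ Q then adj u v else 0) := by
    simp only [touching, crossing, ← Finset.sum_add_distrib]
    refine Finset.sum_le_sum fun u _ => Finset.sum_le_sum fun v _ => ?_
    have hf : adj u v * S u v ≤ adj u v := by
      simpa using Nat.mul_le_mul_left (adj u v) (hS u v)
    generalize adj u v * S u v = f at hf
    by_cases h1 : u ∈ O <;> by_cases h2 : v ∈ O <;> by_cases h3 : u ∈ Q <;> by_cases h4 : v ∈ Q <;>
      simp [h1, h2, h3, h4] <;> omega
  rw [← hQ, ← hQ'] at key
  omega

/-- If the edges of `S` at every class of a partition are bounded in terms of the edges that leave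
the class, then `S` is bounded in terms of the edges between different classes. -/
theorem active_le_of_parts {adj S : V → V → ℕ} {p q : ℕ} (c : V → V)
    (h : ∀ i, p * touching (fun u v => adj u v * S u v) (Finset.univ.filter fun v => c v = i) ≤
      q * crossing adj (Finset.univ.filter fun v => c v = i)) :
    p * active adj S ≤ q * (2 * ∑ u, ∑ v, if c u = c v then 0 else adj u v) := by
  have h1 : active adj S ≤
      ∑ i, touching (fun u v => adj u v * S u v) (Finset.univ.filter fun v => c v = i) := by
    simp only [touching]
    rw [Finset.sum_comm, active]
    refine Finset.sum_le_sum fun u _ => ?_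
    rw [Finset.sum_comm]
    refine Finset.sum_le_sum fun v _ => ?_
    calc adj u v * S u v = if u ∈ (Finset.univ.filter fun v => c v = c u) ∨
          v ∈ (Finset.univ.filter fun v => c v = c u) then adj u v * S u v else 0 := by simp
      _ ≤ _ := Finset.single_le_sum (f := fun i => if u ∈ (Finset.univ.filter fun v => c v = i) ∨
          v ∈ (Finset.univ.filter fun v => c v = i) then adj u v * S u v else 0)
          (fun _ _ => Nat.zero_le _) (Finset.mem_univ _)
  have h2 : ∑ i, crossing adj (Finset.univ.filter fun v => c v = i) =
      2 * ∑ u, ∑ v, if c u = c v then 0 else adj u v := by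
    simp only [crossing]
    rw [Finset.sum_comm, Finset.mul_sum]
    refine Finset.sum_congr rfl fun u _ => ?_
    rw [Finset.sum_comm, Finset.mul_sum]
    refine Finset.sum_congr rfl fun v _ => ?_
    simp only [Finset.mem_filter, Finset.mem_univ, true_and]
    by_cases huv : c u = c v
    · simp [huv]
    · have : ∀ i, (if c u = i ↔ c v = i then 0 else adj u v) =
          (if c u = i then adj u v else 0) + (if c v = i then adj u v else 0) := fun i => by
        by_cases h1 : c u = i
        · have : c v ≠ i := fun h => huv (h1.trans h.symm)
          simp [h1, this]
        · by_cases h2 : c v = i <;> simp [h1, h2]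
      simp only [this, Finset.sum_add_distrib, huv, if_false]
      simp
      ring
  calc p * active adj S ≤ p * _ := Nat.mul_le_mul_left _ h1
    _ ≤ q * ∑ i, crossing adj (Finset.univ.filter fun v => c v = i) := by
      rw [Finset.mul_sum, Finset.mul_sum]
      exact Finset.sum_le_sum fun i _ => h i
    _ = _ := by rw [h2]

end Quality

/-! ### Feasible solutions of the graph problem as matrices -/

namespace SubsetEdgeSeparator
variable {V : Type*}

open Classical in
/-- The adjacency matrix. -/
noncomputable def adjMat (G : SimpleGraph V) : V → V → ℕ := fun u v => if G.Adj u v then 1 else 0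

open Classical in
/-- The matrix of a set of edges. -/
noncomputable def edgeMat (T : Finset (Sym2 V)) : V → V → ℕ := fun u v => if s(u, v) ∈ T then 1 else 0

theorem isSym01_adjMat (G : SimpleGraph V) : IsSym01 (adjMat G) := by
  refine ⟨fun u v => ?_, fun u v => ?_⟩
  · by_cases h : G.Adj u v <;> simp [adjMat, h, G.adj_comm v u]
  · unfold adjMat; split_ifs <;> simp

theorem isSym01_edgeMat (T : Finset (Sym2 V)) : IsSym01 (edgeMat T) := by
  refine ⟨fun u v => ?_, fun u v => ?_⟩
  · rw [edgeMat, edgeMat, Sym2.eq_swap]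
  · unfold edgeMat; split_ifs <;> simp

theorem sum_edgeMat [Fintype V] {G : SimpleGraph V} {T : Finset (Sym2 V)}
    (hT : (T : Set (Sym2 V)) ⊆ G.edgeSet) : ∑ u, ∑ v, edgeMat T u v = 2 * T.card := by
  classical
  obtain ⟨H, hH⟩ : ∃ H, H = SimpleGraph.fromEdgeSet (T : Set (Sym2 V)) := ⟨_, rfl⟩
  have hnd : ∀ e ∈ T, ¬ e.IsDiag := fun e he => G.not_isDiag_of_mem_edgeSet (hT he)
  have hcard : H.edgeFinset.card = T.card := by
    congr 1
    ext e
    rw [SimpleGraph.mem_edgeFinset, hH, SimpleGraph.edgeSet_fromEdgeSet]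
    simp only [Set.mem_sdiff, Finset.mem_coe]
    exact ⟨fun h => h.1, fun h => ⟨h, hnd e h⟩⟩
  rw [← hcard, ← SimpleGraph.sum_degrees_eq_twice_card_edges]
  refine Finset.sum_congr rfl fun u _ => ?_
  rw [← SimpleGraph.card_neighborFinset_eq_degree, SimpleGraph.neighborFinset_eq_filter,
    Finset.card_filter]
  refine Finset.sum_congr rfl fun v _ => ?_
  rw [edgeMat]
  refine if_congr ?_ rfl rfl
  rw [hH, SimpleGraph.fromEdgeSet_adj]
  refine ⟨fun h => ⟨h, fun huv => hnd _ h (by simp [huv])⟩, fun h => h.1⟩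

/-- The connected components are connected in the sense of `Linked`. -/
theorem linked_component [DecidableEq V] {H : SimpleGraph V} {adj : V → V → ℕ} {U : Finset V}
    (hadj : ∀ u v, H.Adj u v → adj v u ≠ 0) {C : H.ConnectedComponent}
    (hU : ∀ v, v ∈ U ↔ H.connectedComponentMk v = C) : Linked adj U := by
  intro A hA hA0 hAU
  obtain ⟨a, ha⟩ := hA0
  obtain ⟨b, hb, hbA⟩ : ∃ b ∈ U, b ∉ A := by
    by_contra! h
    exact hAU (Finset.Subset.antisymm hA h)
  obtain ⟨p⟩ : H.Reachable a b := SimpleGraph.ConnectedComponent.exact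
    (((hU a).1 (hA ha)).trans ((hU b).1 hb).symm)
  obtain ⟨d, hd, h1, h2⟩ := p.exists_boundary_dart (A : Set V) (by simpa using ha)
    (by simpa using hbA)
  refine ⟨d.fst, h1, d.snd, Finset.mem_sdiff.2 ⟨?_, h2⟩, hadj _ _ d.adj⟩
  rw [hU, ← (hU d.fst).1 (hA h1)]
  exact (SimpleGraph.ConnectedComponent.sound d.adj.reachable).symm

theorem isSolution_of_separates [Fintype V] [DecidableEq V] {G : SimpleGraph V} {R : Finset V} {K : ℕ} {adj : V → V → ℕ}
    {S : Finset (Sym2 V)} (h : Separates (adjMat G) adj R K (edgeMat S)) : IsSolution G R K S := by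
  classical
  refine ⟨fun e he => ?_, fun C => ?_⟩
  · induction e with
    | _ u v =>
    have := h.le u v
    simp only [edgeMat, adjMat, if_pos (Finset.mem_coe.1 he)] at this
    by_contra hG
    rw [SimpleGraph.mem_edgeSet] at hG
    simp [hG] at this
  · set U := Finset.univ.filter fun v => (G.deleteEdges (S : Set (Sym2 V))).connectedComponentMk v = C
      with hU
    have hl : Linked (fun u v => adjMat G u v - edgeMat S u v) U := by
      refine linked_component (H := G.deleteEdges (S : Set (Sym2 V))) (C := C) (fun u v huv => ?_)
        (fun v => by simp [hU])
      rw [SimpleGraph.deleteEdges_adj] at huv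
      rw [(isSym01_adjMat G).symm, (isSym01_edgeMat S).symm]
      simp only [adjMat, edgeMat, huv.1, if_true]
      rw [if_neg (by simpa using huv.2)]
      simp
    refine le_trans (le_of_eq ?_) (h.card_le U hl)
    rw [← Set.ncard_coe_finset]
    congr 1
    ext v
    simp [hU, and_comm]

/-- The components that a feasible solution `T` leaves of a subgraph, as the classes of a
representative function. -/
theorem exists_parts [Fintype V] [DecidableEq V] {G : SimpleGraph V} {R : Finset V} {K : ℕ} {adj : V → V → ℕ}
    {T : Finset (Sym2 V)} (hT : IsSolution G R K T) (ha : IsSym01 adj)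
    (hG : ∀ u v, adj u v ≤ adjMat G u v) :
    ∃ c : V → V, (∀ i, Linked adj (Finset.univ.filter fun v => c v = i)) ∧
      (∀ i, ((Finset.univ.filter fun v => c v = i) ∩ R).card ≤ K) ∧
      ∀ u v, adj u v ≠ 0 → c u ≠ c v → s(u, v) ∈ T := by
  classical
  have hGA : ∀ u v, adj u v ≠ 0 → G.Adj u v := fun u v h => by
    by_contra hn
    have := hG u v
    simp [adjMat, hn] at this
    exact h this
  let H : SimpleGraph V :=
    { Adj := fun u v => adj u v ≠ 0 ∧ s(u, v) ∉ T
      symm := ⟨fun u v h => ⟨by rw [ha.symm]; exact h.1, by rw [Sym2.eq_swap]; exact h.2⟩⟩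
      loopless := ⟨fun u h => (hGA u u h.1).ne rfl⟩ }
  have hle : H ≤ G.deleteEdges (T : Set (Sym2 V)) := fun u v h =>
    SimpleGraph.deleteEdges_adj.2 ⟨hGA u v h.1, by simpa using h.2⟩
  have hc : ∀ v i, (H.connectedComponentMk v).out = i → H.connectedComponentMk v =
      H.connectedComponentMk i := fun v i h => by
    rw [← h]; exact (Quot.out_eq (H.connectedComponentMk v)).symm
  refine ⟨fun v => (H.connectedComponentMk v).out, fun i => ?_, fun i => ?_, fun u v h huv => ?_⟩
  · rcases Finset.eq_empty_or_nonempty (Finset.univ.filter fun v =>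
      (H.connectedComponentMk v).out = i) with h | ⟨w, hw⟩
    · rw [h]
      intro A hA hA0 _
      exact absurd (Finset.subset_empty.1 hA) hA0.ne_empty
    · refine linked_component (H := H) (C := H.connectedComponentMk i)
        (fun u v h => by rw [ha.symm]; exact h.1) fun v => ?_
      simp only [Finset.mem_filter, Finset.mem_univ, true_and] at hw ⊢
      refine ⟨fun h => hc v i h, fun h => ?_⟩
      rw [h, ← hc w i hw, hw]
  · refine le_trans ?_ (hT.2 ((G.deleteEdges (T : Set (Sym2 V))).connectedComponentMk i))
    rw [← Set.ncard_coe_finset]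
    refine Set.ncard_le_ncard (fun v hv => ?_) (Set.toFinite _)
    simp only [Finset.coe_inter, Finset.coe_filter, Finset.mem_univ, true_and, Set.mem_inter_iff,
      Set.mem_ofPred_eq, Finset.mem_coe] at hv
    refine ⟨hv.2, ?_⟩
    rw [SimpleGraph.ConnectedComponent.mem_supp_iff]
    exact SimpleGraph.ConnectedComponent.sound
      ((SimpleGraph.ConnectedComponent.exact (hc v i hv.1)).mono hle)
  · by_contra hn
    exact huv (congrArg _ (SimpleGraph.ConnectedComponent.sound
      (SimpleGraph.Adj.reachable (G := H) ⟨h, hn⟩)))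

/-- Only `min k n` matters, for a graph with `n` vertices. -/
theorem isSolution_min_iff [Fintype V] {G : SimpleGraph V} {R : Finset V} {k : ℕ} {T : Finset (Sym2 V)} :
    IsSolution G R (min k (Fintype.card V)) T ↔ IsSolution G R k T := by
  refine and_congr_right fun _ => forall_congr' fun C => ?_
  rw [le_min_iff, and_iff_left]
  rw [← Nat.card_eq_fintype_card]
  exact Set.ncard_le_card _

end SubsetEdgeSeparator

/-! ### Approximation ratios -/

namespace SubsetEdgeSeparator
variable {V : Type*}

theorem edgeMat_le {G : SimpleGraph V} {T : Finset (Sym2 V)}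
    (hT : (T : Set (Sym2 V)) ⊆ G.edgeSet) (u v : V) : edgeMat T u v ≤ adjMat G u v := by
  unfold edgeMat adjMat
  split_ifs with h1 h2
  · exact le_rfl
  · exact absurd (hT h1) h2
  · simp
  · exact le_rfl

/-- The edges between the parts of a feasible solution belong to it. -/
theorem sum_between_parts_le [Fintype V] [DecidableEq V] {adj : V → V → ℕ} {T : Finset (Sym2 V)} (ha : ∀ u v, adj u v ≤ 1)
    {c : V → V} (hc : ∀ u v, adj u v ≠ 0 → c u ≠ c v → s(u, v) ∈ T) :
    ∑ u, ∑ v, (if c u = c v then 0 else adj u v) ≤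
      ∑ u, ∑ v, if adj u v = 0 then 0 else edgeMat T u v := by
  refine Finset.sum_le_sum fun u _ => Finset.sum_le_sum fun v _ => ?_
  by_cases h : adj u v = 0
  · simp [h]
  · by_cases h' : c u = c v
    · simp [h']
    · rw [if_neg h', if_neg h, edgeMat, if_pos (hc u v h h')]
      exact ha u v

theorem sum_eq_active [Fintype V] {adj S : V → V → ℕ} (ha : ∀ u v, adj u v ≤ 1) :
    ∑ u, ∑ v, S u v = active adj S + ∑ u, ∑ v, if adj u v = 0 then S u v else 0 := by
  simp only [active, ← Finset.sum_add_distrib]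
  refine Finset.sum_congr rfl fun u _ => Finset.sum_congr rfl fun v _ => ?_
  have := ha u v
  interval_cases adj u v <;> simp

theorem sum_eq_active_self [Fintype V] {adj S : V → V → ℕ} (ha : ∀ u v, adj u v ≤ 1)
    (hS : ∀ u v, S u v ≤ adj u v) : ∑ u, ∑ v, S u v = active adj S := by
  rw [sum_eq_active ha, Nat.add_eq_left]
  refine Finset.sum_eq_zero fun u _ => Finset.sum_eq_zero fun v _ => ?_
  have := hS u v
  split_ifs <;> omega

theorem sum_cut_le [Fintype V] [DecidableEq V] {G : SimpleGraph V} {T : Finset (Sym2 V)} {c : V → V}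
    (hc : ∀ u v, adjMat G u v ≠ 0 → c u ≠ c v → s(u, v) ∈ T) :
    ∑ u, ∑ v, (if c u = c v then 0 else adjMat G u v) ≤ ∑ u, ∑ v, edgeMat T u v :=
  (sum_between_parts_le (isSym01_adjMat G).le hc).trans <|
    Finset.sum_le_sum fun u _ => Finset.sum_le_sum fun v _ => by split_ifs <;> simp

variable [Fintype V]

/-- The graph without the edges at vertices of degree more than `t`. -/
def lowDegree (adj : V → V → ℕ) (t : ℕ) : V → V → ℕ := fun u v =>
  if t < ∑ w, adj u w ∨ t < ∑ w, adj v w then 0 else adj u v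

theorem lowDegree_le (adj : V → V → ℕ) (t : ℕ) (u v : V) : lowDegree adj t u v ≤ adj u v := by
  unfold lowDegree; split_ifs <;> simp

theorem isSym01_lowDegree {adj : V → V → ℕ} (ha : IsSym01 adj) (t : ℕ) :
    IsSym01 (lowDegree adj t) :=
  ⟨fun u v => by simp only [lowDegree, ha.symm u v, or_comm], fun u v =>
    (lowDegree_le adj t u v).trans (ha.le u v)⟩

theorem card_lowDegree_le {adj : V → V → ℕ} (ha : IsSym01 adj) (t : ℕ) (y : V) :
    (Finset.univ.filter fun x => lowDegree adj t x y ≠ 0).card ≤ t := by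
  by_cases hy : t < ∑ w, adj y w
  · simp [lowDegree, hy]
  · refine le_trans ?_ (not_lt.1 hy)
    rw [Finset.card_filter]
    refine Finset.sum_le_sum fun x _ => ?_
    have := lowDegree_le adj t x y
    rw [ha.symm y x]
    split_ifs <;> omega

variable [DecidableEq V]

/-- Local optima with respect to all sets with few terminals. -/
theorem ratio_of_stable {G : SimpleGraph V} {R : Finset V} {K : ℕ} {S : V → V → ℕ}
    {T : Finset (Sym2 V)} (hT : IsSolution G R K T) (hS : ∀ u v, S u v ≤ adjMat G u v)
    (h : ∀ O, (O ∩ R).card ≤ K →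
      active (adjMat G) S ≤ active (adjMat G) (moveMat (adjMat G) S O)) :
    ∑ u, ∑ v, S u v ≤ 2 * ∑ u, ∑ v, edgeMat T u v := by
  have ha := isSym01_adjMat G
  obtain ⟨c, -, c2, c3⟩ := exists_parts hT ha fun _ _ => le_rfl
  have := active_le_of_parts (adj := adjMat G) (S := S) (p := 1) (q := 1) c fun i => by
    have := touching_le_of_move ha (fun u v => (hS u v).trans (ha.le u v))
      (Finset.univ.filter fun v => c v = i) ∅ (by simpa using h _ (c2 i))
    simpa using this
  rw [sum_eq_active_self ha.le hS]
  have := sum_cut_le c3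
  omega

/-- Local optima with respect to connected sets with few terminals and a boundary of at most `b`
edges, and with respect to sets without terminals. A part with a larger boundary is charged with the
edges at its terminals. -/
theorem ratio_of_stable_small {G : SimpleGraph V} {R : Finset V} {K b d p q : ℕ} {S : V → V → ℕ}
    {T : Finset (Sym2 V)} (hT : IsSolution G R K T) (hS : ∀ u v, S u v ≤ adjMat G u v)
    (hd : ∀ u, ∑ v, adjMat G u v ≤ d) (hb : 2 * K * d * q ≤ p * (b + 1))
    (h : ∀ O, Linked (adjMat G) O → bdry (adjMat G) O ≤ b → (O ∩ R).card ≤ K →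
      active (adjMat G) S ≤ active (adjMat G) (moveMat (adjMat G) S O))
    (h' : ∀ O, Disjoint O R → active (adjMat G) S ≤ active (adjMat G) (moveMat (adjMat G) S O)) :
    q * ∑ u, ∑ v, S u v ≤ (2 * q + p) * ∑ u, ∑ v, edgeMat T u v := by
  have ha := isSym01_adjMat G
  have hS1 : ∀ u v, S u v ≤ 1 := fun u v => (hS u v).trans (ha.le u v)
  obtain ⟨c, c1, c2, c3⟩ := exists_parts hT ha fun _ _ => le_rfl
  have := active_le_of_parts (adj := adjMat G) (S := S) (p := 2 * q) (q := 2 * q + p) c fun i => by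
    set O := Finset.univ.filter fun v => c v = i with hO
    by_cases hbd : bdry (adjMat G) O ≤ b
    · have := touching_le_of_move ha hS1 O ∅ (by simpa using h _ (c1 i) hbd (c2 i))
      simp only [Finset.inter_empty, Finset.sum_empty, Nat.mul_zero, Nat.add_zero] at this
      exact Nat.mul_le_mul (by omega) this
    · have h1 := touching_le_of_move ha hS1 O R (h' _ Finset.sdiff_disjoint)
      have h2 : ∑ u ∈ O ∩ R, ∑ v, adjMat G u v ≤ K * d :=
        (Finset.sum_le_card_nsmul _ _ d fun u _ => hd u).trans (Nat.mul_le_mul_right d (c2 i))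
      have h3 := crossing_eq ha.symm O
      have h4 : p * (b + 1) ≤ p * bdry (adjMat G) O := Nat.mul_le_mul_left _ (by omega)
      calc 2 * q * touching (fun u v => adjMat G u v * S u v) O
          ≤ 2 * q * (crossing (adjMat G) O + 2 * (K * d)) := Nat.mul_le_mul_left _ (by omega)
        _ = 2 * q * crossing (adjMat G) O + 2 * (2 * K * d * q) := by ring
        _ ≤ 2 * q * crossing (adjMat G) O + 2 * (p * bdry (adjMat G) O) := by omega
        _ = _ := by rw [h3]; ring
  rw [sum_eq_active_self ha.le hS]
  have h5 := Nat.mul_le_mul_left (2 * q + p) (sum_cut_le c3)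
  nlinarith

/-- Among the edges at a vertex, at most `K - 1` are not in a feasible solution, when all vertices
are terminals. -/
theorem sum_sub_edgeMat_le {G : SimpleGraph V} {K : ℕ} {T : Finset (Sym2 V)}
    (hT : IsSolution G Finset.univ K T) (u : V) :
    ∑ v, (adjMat G u v - edgeMat T u v) ≤ K - 1 := by
  have ha := isSym01_adjMat G
  obtain ⟨c, -, c2, c3⟩ := exists_parts hT ha fun _ _ => le_rfl
  have hle : (Finset.univ.filter fun v => c v = c u).card ≤ K := by
    simpa using c2 (c u)
  have hu : u ∈ Finset.univ.filter fun v => c v = c u := by simp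
  calc ∑ v, (adjMat G u v - edgeMat T u v)
      ≤ ∑ v, if v ∈ (Finset.univ.filter fun v => c v = c u).erase u then 1 else 0 := by
        refine Finset.sum_le_sum fun v _ => ?_
        split_ifs with h
        · have := ha.le u v; omega
        · simp only [Finset.mem_erase, Finset.mem_filter, Finset.mem_univ, true_and, not_and] at h
          by_cases hv : v = u
          · simp [adjMat, hv]
          · by_cases h0 : adjMat G u v = 0
            · omega
            · have h1 := c3 u v h0 fun h' => h hv h'.symm
              have := ha.le u v
              simp only [edgeMat, if_pos h1]
              omega
    _ = ((Finset.univ.filter fun v => c v = c u).erase u).card := by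
        rw [Finset.sum_ite_mem, Finset.univ_inter, Finset.card_eq_sum_ones]
    _ ≤ K - 1 := by rw [Finset.card_erase_of_mem hu]; omega

/-- If all vertices are terminals, a feasible solution contains at least half of the edges at the
vertices of degree more than `3 * (K - 1)`. -/
theorem sum_highDegree_le {G : SimpleGraph V} {K : ℕ} {T : Finset (Sym2 V)}
    (hT : IsSolution G Finset.univ K T) :
    ∑ u, ∑ v, (if lowDegree (adjMat G) (3 * (K - 1)) u v = 0 then adjMat G u v else 0) ≤
      2 * ∑ u, ∑ v, if lowDegree (adjMat G) (3 * (K - 1)) u v = 0 then edgeMat T u v else 0 := by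
  have ha := isSym01_adjMat G
  set H := Finset.univ.filter fun u => 3 * (K - 1) < ∑ v, adjMat G u v with hH
  have hmem : ∀ u, u ∈ H ↔ 3 * (K - 1) < ∑ v, adjMat G u v := fun u => by simp [hH]
  have hlow : ∀ u v, lowDegree (adjMat G) (3 * (K - 1)) u v =
      if u ∈ H ∨ v ∈ H then 0 else adjMat G u v := fun u v => by
    simp only [lowDegree, hmem]
  have hTle := edgeMat_le hT.1
  set N : V → V → ℕ := fun u v => adjMat G u v - edgeMat T u v with hN
  have hNT : ∀ u v, adjMat G u v = N u v + edgeMat T u v := fun u v => by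
    have := hTle u v
    simp only [hN]; omega
  have hrow : ∀ f : V → V → ℕ, ∑ u ∈ H, ∑ v, f u v = ∑ u, ∑ v, if u ∈ H then f u v else 0 :=
    fun f => by
      rw [← Finset.sum_filter_add_sum_filter_not Finset.univ (· ∈ H)]
      have e : ∑ u ∈ Finset.univ.filter (· ∉ H), ∑ v, (if u ∈ H then f u v else 0) = 0 :=
        Finset.sum_eq_zero fun u hu => by simp [(Finset.mem_filter.1 hu).2]
      rw [e, Nat.add_zero, Finset.filter_univ_mem]
      exact Finset.sum_congr rfl fun u hu => by simp only [hu, if_true]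
  -- the edges not in `T`
  have h1 : ∑ u, ∑ v, (if u ∈ H ∨ v ∈ H then N u v else 0) ≤ 2 * ∑ u ∈ H, ∑ v, N u v := by
    have hsw : ∑ u ∈ H, ∑ v, N u v = ∑ u, ∑ v, if v ∈ H then N u v else 0 := by
      rw [hrow, Finset.sum_comm]
      refine Finset.sum_congr rfl fun u _ => Finset.sum_congr rfl fun v _ => ?_
      simp only [hN, ha.symm u v, (isSym01_edgeMat T).symm u v]
    rw [two_mul]
    nth_rewrite 2 [hsw]
    rw [hrow, ← Finset.sum_add_distrib]
    refine Finset.sum_le_sum fun u _ => ?_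
    rw [← Finset.sum_add_distrib]
    refine Finset.sum_le_sum fun v _ => ?_
    by_cases h1 : u ∈ H <;> by_cases h2 : v ∈ H <;> simp [h1, h2]
  -- the edges in `T`
  have h2 : ∑ u ∈ H, ∑ v, edgeMat T u v ≤ ∑ u, ∑ v, if u ∈ H ∨ v ∈ H then edgeMat T u v else 0 := by
    rw [hrow]
    refine Finset.sum_le_sum fun u _ => Finset.sum_le_sum fun v _ => ?_
    by_cases h1 : u ∈ H <;> simp [h1]
  have h3 : 2 * ∑ u ∈ H, ∑ v, N u v ≤ ∑ u ∈ H, ∑ v, edgeMat T u v := by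
    rw [Finset.mul_sum]
    refine Finset.sum_le_sum fun u hu => ?_
    have g1 := sum_sub_edgeMat_le hT u
    have g2 := (hmem u).1 hu
    have g3 : ∑ v, adjMat G u v = ∑ v, N u v + ∑ v, edgeMat T u v := by
      rw [← Finset.sum_add_distrib]; exact Finset.sum_congr rfl fun v _ => hNT u v
    have g1' : ∑ v, N u v ≤ K - 1 := g1
    omega
  have h4 : ∑ u, ∑ v, (if lowDegree (adjMat G) (3 * (K - 1)) u v = 0 then adjMat G u v else 0) =
      ∑ u, ∑ v, (if u ∈ H ∨ v ∈ H then N u v else 0) +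
        ∑ u, ∑ v, if u ∈ H ∨ v ∈ H then edgeMat T u v else 0 := by
    simp only [← Finset.sum_add_distrib]
    refine Finset.sum_congr rfl fun u _ => Finset.sum_congr rfl fun v _ => ?_
    rw [hlow]
    by_cases h : u ∈ H ∨ v ∈ H
    · simp only [if_pos h, if_true]; exact hNT u v
    · simp only [if_neg h, add_zero, ite_eq_right_iff, imp_self]
  have h5 : ∑ u, ∑ v, (if u ∈ H ∨ v ∈ H then edgeMat T u v else 0) ≤
      ∑ u, ∑ v, if lowDegree (adjMat G) (3 * (K - 1)) u v = 0 then edgeMat T u v else 0 := by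
    refine Finset.sum_le_sum fun u _ => Finset.sum_le_sum fun v _ => ?_
    rw [hlow]
    by_cases h : u ∈ H ∨ v ∈ H
    · simp only [if_pos h, if_true]; exact le_rfl
    · simp only [if_neg h]; exact Nat.zero_le _
  omega

/-- Local optima with respect to connected sets of at most `K` vertices, in the graph without the
edges at vertices of high degree. -/
theorem ratio_of_stable_lowDegree {G : SimpleGraph V} {K : ℕ} {S : V → V → ℕ}
    {T : Finset (Sym2 V)} (hT : IsSolution G Finset.univ K T)
    (hS : Separates (adjMat G) (lowDegree (adjMat G) (3 * (K - 1))) Finset.univ K S)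
    (h : ∀ O, Linked (lowDegree (adjMat G) (3 * (K - 1))) O → O.card ≤ K →
      active (lowDegree (adjMat G) (3 * (K - 1))) S ≤ active (lowDegree (adjMat G) (3 * (K - 1)))
        (moveMat (lowDegree (adjMat G) (3 * (K - 1))) S O)) :
    ∑ u, ∑ v, S u v ≤ 2 * ∑ u, ∑ v, edgeMat T u v := by
  have h1 := sum_highDegree_le hT
  set adj := lowDegree (adjMat G) (3 * (K - 1)) with hadj
  have ha : IsSym01 adj := isSym01_lowDegree (isSym01_adjMat G) _
  obtain ⟨c, c1, c2, c3⟩ := exists_parts hT ha (lowDegree_le _ _)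
  have h2 := active_le_of_parts (adj := adj) (S := S) (p := 1) (q := 1) c fun i => by
    have := touching_le_of_move ha (fun u v => (hS.le u v).trans ((isSym01_adjMat G).le u v))
      (Finset.univ.filter fun v => c v = i) ∅
      (by simpa using h _ (c1 i) (by simpa using c2 i))
    simpa using this
  have h3 := sum_between_parts_le ha.le c3
  have h4 : ∑ u, ∑ v, edgeMat T u v = ∑ u, ∑ v, (if adj u v = 0 then 0 else edgeMat T u v) +
      ∑ u, ∑ v, if adj u v = 0 then edgeMat T u v else 0 := by
    simp only [← Finset.sum_add_distrib]
    refine Finset.sum_congr rfl fun u _ => Finset.sum_congr rfl fun v _ => ?_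
    split_ifs <;> simp
  have h5 : ∑ u, ∑ v, (if adj u v = 0 then S u v else 0) =
      ∑ u, ∑ v, if adj u v = 0 then adjMat G u v else 0 := by
    refine Finset.sum_congr rfl fun u _ => Finset.sum_congr rfl fun v _ => ?_
    split_ifs with h0
    · exact hS.eq u v h0
    · rfl
  rw [sum_eq_active ha.le, h5]
  omega

end SubsetEdgeSeparator

/-! ### Time and word length of a local search program -/

namespace LoopLang
open WordRAM
namespace Stmt
open LoopLang.Expr

theorem Fits.mono {W W' : ℕ} (h : W ≤ W') {p : Stmt} : ∀ {s : State}, p.Fits W s → p.Fits W' s := by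
  induction p with
  | skip => exact fun _ => trivial
  | set x e => exact fun hs => Expr.Fits.mono h hs
  | put a e f => exact fun hs => ⟨hs.1.mono h, hs.2.mono h⟩
  | seq p q ihp ihq => exact fun hs => ⟨ihp hs.1, ihq hs.2⟩
  | ite e p q ihp ihq =>
    intro s hs
    refine ⟨hs.1.mono h, ?_⟩
    have h2 := hs.2
    split_ifs at h2 ⊢
    · exact ihp h2
    · exact ihq h2
  | loop x y p ih => exact fun hs => ⟨hs.1.trans h, fun i hi => ih (hs.2 i hi)⟩

theorem boundsLe_of_le {X : ℕ} {s : State} (h : s.Le X) (p : Stmt) : p.BoundsLe X s := by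
  induction p with
  | skip => trivial
  | set y e => trivial
  | put b e f => trivial
  | seq p q ihp ihq => exact ⟨ihp, ihq⟩
  | ite e p q ihp ihq => exact ⟨ihp, ihq⟩
  | loop y z p ih => exact ⟨h.1 z, ih⟩

/-- All loop bounds are variables from the list. -/
def boundsIn (L : List ℕ) : Stmt → Bool
  | skip => true
  | set _ _ => true
  | put _ _ _ => true
  | seq p q => p.boundsIn L && q.boundsIn L
  | ite _ p q => p.boundsIn L && q.boundsIn L
  | loop _ y p => L.contains y && p.boundsIn L

theorem boundsLe_of_boundsIn {L : List ℕ} {X : ℕ} {s : State} (h : ∀ x ∈ L, s.var x ≤ X) {p : Stmt}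
    (hp : p.boundsIn L) : p.BoundsLe X s := by
  induction p with
  | skip => trivial
  | set y e => trivial
  | put b e f => trivial
  | seq p q ihp ihq =>
    simp only [boundsIn, Bool.and_eq_true] at hp
    exact ⟨ihp hp.1, ihq hp.2⟩
  | ite e p q ihp ihq =>
    simp only [boundsIn, Bool.and_eq_true] at hp
    exact ⟨ihp hp.1, ihq hp.2⟩
  | loop y z p ih =>
    simp only [boundsIn, Bool.and_eq_true] at hp
    exact ⟨h z (by simpa using hp.1), ih hp.2⟩

/-- All values that the statement computes are bounded by a fixed power of the values at its
start. -/
def IsPoly (p : Stmt) : Prop :=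
  ∃ E, ∀ (X : ℕ) (s : State), 2 ≤ X → s.Le X → p.Fits (X ^ E) s ∧ (p.den s).Le (X ^ E)

theorem le_pow_add_one {X c : ℕ} (hX : 2 ≤ X) : c ≤ X ^ (c + 1) :=
  (Nat.lt_two_pow_self.le.trans (Nat.pow_le_pow_left hX c)).trans
    (Nat.pow_le_pow_right (by omega) (by omega))

theorem isPoly_set (x : ℕ) (e : Expr) : IsPoly (set x e) := by
  refine ⟨(e.lits + 1) * e.size, fun X s hX hs => ?_⟩
  have h1 : X ≤ X ^ (e.lits + 1) := Nat.le_self_pow (by omega) X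
  have h2 := Expr.eval_le_and_fits (X := X ^ (e.lits + 1)) (hX.trans h1)
    (fun x => (hs.1 x).trans h1) (fun a i => (hs.2 a i).trans h1) (le_pow_add_one hX)
  rw [pow_mul]
  refine ⟨h2.2, (hs.mono ?_).setVar h2.1⟩
  exact h1.trans (Nat.le_self_pow (Nat.one_le_iff_ne_zero.1 e.size_pos) _)

theorem isPoly_of_small {p : Stmt} (h : p.small) (hp : boundsFixedBy p p) : IsPoly p := by
  set e := p.lits + 1 + (p.weight + 1 + p.depth * (p.lits + 1)) with he
  refine ⟨e * p.width, fun X s hX hs => ?_⟩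
  have hX0 : 0 < X := by omega
  set X' := X ^ (p.lits + 1) with hX'
  have h1 : X ≤ X' := Nat.le_self_pow (by omega) X
  have hs' := hs.mono h1
  have hX2 := hX.trans h1
  have hc := cost_le (X := X') (by omega) p s hp (fun _ h => h) (boundsLe_of_le hs' p)
  have hle : X' + p.cost s ≤ X ^ e := by
    have h2 : p.cost s ≤ X ^ (p.weight + 1 + p.depth * (p.lits + 1)) := by
      refine hc.trans ?_
      rw [pow_add, Nat.mul_comm p.depth, pow_mul]
      exact Nat.mul_le_mul_right _ (le_pow_add_one hX)
    calc X' + p.cost s ≤ X' + X ^ (p.weight + 1 + p.depth * (p.lits + 1)) := by omega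
      _ ≤ X' * X ^ (p.weight + 1 + p.depth * (p.lits + 1)) := by
        refine Nat.add_le_mul hX2 (hX.trans (Nat.le_self_pow (by omega) X))
      _ = X ^ e := by rw [hX', ← pow_add]
  have := le_and_fits (Y := X ^ e) (W := X ^ (e * p.width)) (E := p.width)
    (hX.trans (Nat.le_self_pow (by omega) X)) (by rw [pow_mul]) p X' s h (le_pow_add_one hX) le_rfl
    hs' hle
  refine ⟨this.1, this.2.mono (hle.trans ?_)⟩
  have hw : 1 ≤ p.width := by
    clear * -
    induction p with
    | skip => exact le_rfl
    | set _ e => exact e.size_pos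
    | put _ e f => exact e.size_pos.trans (le_max_left _ _)
    | seq _ _ h _ => exact h.trans (le_max_left _ _)
    | ite e _ _ _ _ => exact e.size_pos.trans (le_max_left _ _)
    | loop _ _ _ h => exact h
  exact Nat.pow_le_pow_right hX0 (Nat.le_mul_of_pos_right _ hw)

theorem IsPoly.seq {p q : Stmt} (hp : IsPoly p) (hq : IsPoly q) : IsPoly (p ;; q) := by
  obtain ⟨E, hE⟩ := hp
  obtain ⟨F, hF⟩ := hq
  refine ⟨(E + 1) * (F + 1), fun X s hX hs => ?_⟩
  have hX0 : 0 < X := by omega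
  obtain ⟨h1, h2⟩ := hE X s hX hs
  have h3 : X ^ E ≤ X ^ (E + 1) := Nat.pow_le_pow_right hX0 (by omega)
  have h4 : 2 ≤ X ^ (E + 1) := hX.trans (Nat.le_self_pow (by omega) X)
  obtain ⟨h5, h6⟩ := hF (X ^ (E + 1)) (p.den s) h4 (h2.mono h3)
  have h7 : (X ^ (E + 1)) ^ F ≤ X ^ ((E + 1) * (F + 1)) := by
    rw [pow_mul]; exact Nat.pow_le_pow_right (by omega) (by omega)
  refine ⟨⟨h1.mono (h3.trans ?_), h5.mono h7⟩, h6.mono h7⟩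
  exact Nat.pow_le_pow_right hX0 (Nat.le_mul_of_pos_right _ (by omega))

/-- Variable `11` is multiplied by the power of variable `14` whose exponent is in variable `13`. -/
def power : Stmt := loop 29 13 (set 11 (.var 11 * .var 14))

theorem power_iter (s : State) (i : ℕ) :
    (∀ x, x ≠ 11 → x ≠ 29 → (iter (fun i s' => (set 11 (.var 11 * .var 14)).den (s'.setVar 29 i)) i
      s).var x = s.var x) ∧
    (iter (fun i s' => (set 11 (.var 11 * .var 14)).den (s'.setVar 29 i)) i s).var 11 =
      s.var 11 * s.var 14 ^ i ∧
    (iter (fun i s' => (set 11 (.var 11 * .var 14)).den (s'.setVar 29 i)) i s).var 29 ≤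
      max (s.var 29) i ∧
    (iter (fun i s' => (set 11 (.var 11 * .var 14)).den (s'.setVar 29 i)) i s).arr = s.arr := by
  induction i with
  | zero => simp [iter]
  | succ i ih =>
    obtain ⟨h1, h2, h3, h4⟩ := ih
    rw [iter_succ, den_set]
    refine ⟨fun x hx hx' => ?_, ?_, ?_, ?_⟩
    · rw [setVar_var_of_ne hx, setVar_var_of_ne hx', h1 x hx hx']
    · rw [setVar_var_self, eval_mul, eval_var, eval_var, setVar_var_of_ne (by omega),
        setVar_var_of_ne (by omega), h2, h1 14 (by omega) (by omega), pow_succ, mul_assoc]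
    · rw [setVar_var_of_ne (by omega), setVar_var_self]; omega
    · exact h4

theorem power_var (s : State) : (power.den s).var 11 = s.var 11 * s.var 14 ^ s.var 13 :=
  (power_iter s _).2.1

theorem power_fits {X : ℕ} {s : State} (hs : s.Le X) (h14 : 1 ≤ s.var 14)
    (hX : s.var 11 * s.var 14 ^ s.var 13 ≤ X) : power.Fits X s ∧ (power.den s).Le X := by
  have hle : ∀ i ≤ s.var 13, s.var 11 * s.var 14 ^ i ≤ X := fun i hi =>
    (Nat.mul_le_mul_left _ (Nat.pow_le_pow_right h14 hi)).trans hX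
  refine ⟨⟨hs.1 13, fun i hi => ?_⟩, ?_⟩
  · obtain ⟨h1, h2, -, -⟩ := power_iter s i
    have e1 : ((iter (fun i s' => (set 11 (.var 11 * .var 14)).den (s'.setVar 29 i)) i s).setVar 29
        i).var 11 = s.var 11 * s.var 14 ^ i := by rw [setVar_var_of_ne (by omega), h2]
    have e2 : ((iter (fun i s' => (set 11 (.var 11 * .var 14)).den (s'.setVar 29 i)) i s).setVar 29
        i).var 14 = s.var 14 := by
      rw [setVar_var_of_ne (by omega), h1 14 (by omega) (by omega)]
    refine ⟨?_, ?_, ?_⟩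
    · exact e1.le.trans (hle i hi.le)
    · exact e2.le.trans (hs.1 14)
    · have := hle (i + 1) hi
      rw [pow_succ, ← mul_assoc] at this
      simpa only [eval, e1, e2, Op.eval] using this
  · obtain ⟨h1, h2, h3, h4⟩ := power_iter s (s.var 13)
    refine ⟨fun x => ?_, fun a i => ?_⟩
    · by_cases hx : x = 11
      · subst hx; exact h2.le.trans hX
      · by_cases hx' : x = 29
        · subst hx'; exact h3.trans (max_le (hs.1 29) (hs.1 13))
        · exact (h1 x hx hx').le.trans (hs.1 x)
    · have : (power.den s).arr = s.arr := h4
      rw [this]; exact hs.2 a i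

theorem cost_loop_le {I : State → Prop} {x y c : ℕ} {p : Stmt} {s : State} (hs : I s)
    (hI : ∀ i s', I s' → I (p.den (s'.setVar x i))) (hc : ∀ i s', I s' → p.cost (s'.setVar x i) ≤ c) :
    (loop x y p).cost s ≤ 4 + s.var y * (c + 7) := by
  rw [cost]
  refine Nat.add_le_add_left ((Finset.sum_le_card_nsmul _ _ (c + 7) fun i _ => ?_).trans ?_) 4
  · refine Nat.add_le_add_right (hc _ _ ?_) 7
    exact iter_induct (I := fun _ s' => I s') hs fun j _ s' h => hI j s' h
  · simp

/-- The cost of the local search is linear in the number `M` of advice strings. -/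
theorem localSearch_cost {dec : Stmt} {B M : ℕ} {s : State} (hB : 1 ≤ B) (hM : 1 ≤ M)
    (hfix : boundsFixedBy (localSearch dec) (dec ;; move))
    (h11 : (localSearch dec).writesVar 11 = false) (hb : (dec ;; move).BoundsLe B s)
    (hB10 : s.var 10 ≤ B) (hM11 : s.var 11 ≤ M) :
    (localSearch dec).cost s ≤
      ((dec ;; move).weight + 22) * B ^ ((dec ;; move).depth + 1) * M := by
  set p := dec ;; move with hp
  set q := localSearch dec with hq
  have hsub : ∀ x, q.writesVar x = false → x ≠ 19 ∧ x ≠ 28 ∧ p.writesVar x = false := fun x hx => by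
    rw [hp]
    simpa [hq, localSearch, writesVar] using hx
  let I (s' : State) : Prop := ∀ x, q.writesVar x = false → s'.var x = s.var x
  have hset : ∀ s' x v, x = 19 ∨ x = 28 → I s' → I (s'.setVar x v) := fun s' x v hx h z hz => by
    have := hsub z hz
    rw [setVar_var_of_ne (by rcases hx with rfl | rfl <;> omega), h z hz]
  have hden : ∀ p' : Stmt, (∀ x, q.writesVar x = false → p'.writesVar x = false) → ∀ s', I s' →
      I (p'.den s') := fun p' h s' hs' z hz => by rw [den_var (h z hz), hs' z hz]
  have hw : ∀ x, q.writesVar x = false → p.writesVar x = false := fun x hx => (hsub x hx).2.2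
  have hbody : ∀ s', I s' → p.cost s' ≤ p.weight * B ^ p.depth := fun s' hs' =>
    cost_le hB p s' hfix hw (hb.congr hfix hs')
  have hin : ∀ s', I s' → (loop 28 11 p).cost s' ≤ 4 + M * (p.weight * B ^ p.depth + 7) := by
    intro s' hs'
    refine (cost_loop_le (I := I) hs' (fun i t ht => hden p hw _ (hset _ _ _ (Or.inr rfl) ht))
      fun i t ht => hbody _ (hset _ _ _ (Or.inr rfl) ht)).trans ?_
    rw [hs' 11 h11]
    exact Nat.add_le_add_left (Nat.mul_le_mul_right _ hM11) 4
  have hout := cost_loop_le (I := I) (x := 19) (y := 10) (s := s) (fun _ _ => rfl)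
    (fun i t ht => hden (loop 28 11 p) (fun x hx => by simpa [writesVar] using (hsub x hx).2) _
      (hset _ _ _ (Or.inl rfl) ht)) fun i t ht => hin _ (hset _ _ _ (Or.inl rfl) ht)
  refine hout.trans ?_
  have e0 : 1 ≤ B ^ p.depth := Nat.one_le_pow _ _ hB
  have e1 : 1 ≤ B ^ p.depth * M := Nat.mul_pos e0 hM
  calc 4 + s.var 10 * (4 + M * (p.weight * B ^ p.depth + 7) + 7)
      ≤ 4 * B + B * (4 + M * (p.weight * B ^ p.depth + 7) + 7) :=
        Nat.add_le_add (by omega) (Nat.mul_le_mul_right _ hB10)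
    _ = B * (15 + p.weight * (B ^ p.depth * M) + 7 * M) := by ring
    _ ≤ B * (15 * (B ^ p.depth * M) + p.weight * (B ^ p.depth * M) + 7 * (B ^ p.depth * M)) := by
        refine Nat.mul_le_mul_left _ ?_
        have : M ≤ B ^ p.depth * M := Nat.le_mul_of_pos_left _ e0
        omega
    _ = _ := by rw [pow_succ]; ring

/-- A program: the setup computes the parameters of the local search. -/
def searchWith (setup dec : Stmt) : Stmt := setup ;; power ;; localSearch dec

/-- The static conditions on the parts of a program. -/
structure Admissible (setup dec : Stmt) : Prop where
  poly : IsPoly setup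
  fixed : boundsFixedBy setup setup
  loops : setup.boundsIn [0]
  loops' : (dec ;; move).boundsIn [0, 10, 12, 13]
  bound : (searchWith setup dec).bound ≤ 100
  small : (localSearch dec).small
  fixed' : boundsFixedBy (localSearch dec) (dec ;; move)
  writes : (localSearch dec).writesVar 11 = false

/-- If the loop bounds are at most `B` and there are `M` advice strings, then the program takes
time `M * B ^ O(1)`, with numbers that are polynomial in this and in the input. -/
theorem Admissible.exec {setup dec : Stmt} (h : Admissible setup dec) :
    ∃ C, ∀ (s : State) (X B M : ℕ), 2 ≤ X → s.Le X → 1 ≤ B → 1 ≤ M → s.var 0 ≤ B →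
      1 ≤ (setup.den s).var 14 → (setup.den s).var 13 ≤ B →
      (setup.den s).var 11 * (setup.den s).var 14 ^ (setup.den s).var 13 ≤ M →
      (setup.den s).var 0 ≤ B → (setup.den s).var 10 ≤ B → (setup.den s).var 12 ≤ B →
      ∃ W t s', Exec W ((searchWith setup dec).comp 100) s t s' ∧
        (∀ a, s'.arr a = ((searchWith setup dec).den s).arr a) ∧
        t ≤ C * B ^ C * M ∧ W ≤ (X + C * B ^ C * M) ^ C := by
  obtain ⟨E, hE⟩ := h.poly
  set p := dec ;; move with hp
  set C := setup.weight + power.weight + (p.weight + 22) + setup.depth + (p.depth + 1) + 1 +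
    (E + 1 + (localSearch dec).lits + 2) * ((localSearch dec).width + 2) with hC
  refine ⟨C, fun s X B M hX hs hB hM h0 h14 h13 h11 h0' h10 h12 => ?_⟩
  set s1 := setup.den s with hs1
  set s2 := power.den s1 with hs2
  set T := C * B ^ C * M with hT
  -- the number of steps
  have hb : setup.BoundsLe B s := boundsLe_of_boundsIn (by simpa using h0) h.loops
  have hbp : (dec ;; move).BoundsLe B s2 := boundsLe_of_boundsIn (by
    intro x hx
    rw [hs2]
    simp only [List.mem_cons, List.not_mem_nil, or_false] at hx
    rcases hx with rfl | rfl | rfl | rfl <;> rw [den_var rfl] <;> assumption) h.loops'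
  have c1 := cost_le hB setup s h.fixed (fun _ h => h) hb
  have c2 : power.cost s1 ≤ power.weight * B ^ 1 :=
    cost_le (q := power) hB power s1 rfl (fun _ h => h) ⟨h13, trivial⟩
  have hM11 : s2.var 11 ≤ M := by rw [hs2, power_var]; exact h11
  have c3 := localSearch_cost (s := s2) hB hM h.fixed' h.writes hbp
    (by rw [hs2, den_var rfl]; exact h10) hM11
  have hcost : (searchWith setup dec).cost s = setup.cost s + (power.cost s1 +
    (localSearch dec).cost s2) := rfl
  have hBM : ∀ e ≤ C, B ^ e ≤ B ^ C * M := fun e he =>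
    (Nat.pow_le_pow_right hB he).trans (Nat.le_mul_of_pos_right _ hM)
  have hpos : 1 ≤ B ^ C * M := Nat.mul_pos (Nat.pow_pos hB) hM
  have hMT' : M ≤ B ^ C * M := Nat.le_mul_of_pos_left _ (Nat.pow_pos hB)
  have hTe : T = C * (B ^ C * M) := by rw [hT, mul_assoc]
  have d1 : setup.cost s ≤ setup.weight * (B ^ C * M) :=
    c1.trans (Nat.mul_le_mul_left _ (hBM _ (by omega)))
  have d2 : power.cost s1 ≤ power.weight * (B ^ C * M) :=
    c2.trans (Nat.mul_le_mul_left _ (hBM _ (by omega)))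
  have d3 : (localSearch dec).cost s2 ≤ (p.weight + 22) * (B ^ C * M) := by
    refine c3.trans ?_
    rw [mul_assoc]
    exact Nat.mul_le_mul_left _ (Nat.mul_le_mul_right _ (Nat.pow_le_pow_right hB
      (show p.depth + 1 ≤ C by omega)))
  have htotal : (searchWith setup dec).cost s ≤ T := by
    have : (setup.weight + power.weight + (p.weight + 22)) * (B ^ C * M) ≤ T := by
      rw [hTe]; exact Nat.mul_le_mul_right _ (by omega)
    rw [hcost]
    linarith
  -- the size of the numbers
  set E' := E + 1 + (localSearch dec).lits with hE'
  have hX0 : 0 < X := by omega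
  set X1 := X ^ E' + T with hX1
  have hMT : M ≤ T := by
    rw [hTe]; exact hMT'.trans (Nat.le_mul_of_pos_left _ (by omega))
  have hXE : X ^ E ≤ X1 := (Nat.pow_le_pow_right hX0 (by omega)).trans (Nat.le_add_right _ _)
  obtain ⟨f1, l1⟩ := hE X s hX hs
  obtain ⟨f2, l2⟩ := power_fits (l1.mono hXE) h14 (h11.trans (hMT.trans (Nat.le_add_left _ _)))
  have hlits : (localSearch dec).lits ≤ X1 := by
    refine le_trans ?_ (Nat.le_add_right _ _)
    exact (le_pow_add_one hX).trans (Nat.pow_le_pow_right hX0 (by omega))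
  have hX1' : 2 ≤ X1 :=
    (hX.trans (Nat.le_self_pow (by omega) X)).trans (Nat.le_add_right _ T)
  set W := (X + T) ^ C with hW
  have hbase : X1 + T ≤ (X + T) ^ (E' + 2) := by
    have g1 : X ^ E' + T ≤ (X + T) ^ (E' + 1) := by
      calc X ^ E' + T ≤ (X + T) ^ E' + (X + T) ^ E' * T := Nat.add_le_add
            (Nat.pow_le_pow_left (by omega) _) (Nat.le_mul_of_pos_left _ (Nat.pow_pos (by omega)))
        _ ≤ (X + T) ^ E' * (X + T) := by
            rw [Nat.add_comm, ← Nat.mul_succ]; exact Nat.mul_le_mul_left _ (by omega)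
        _ = _ := (pow_succ _ _).symm
    have g2 : T ≤ (X + T) ^ (E' + 1) := (Nat.le_add_left _ _).trans g1
    calc X1 + T ≤ (X + T) ^ (E' + 1) + (X + T) ^ (E' + 1) := Nat.add_le_add g1 g2
      _ = (X + T) ^ (E' + 1) * 2 := by ring
      _ ≤ (X + T) ^ (E' + 1) * (X + T) := Nat.mul_le_mul_left _ (by omega)
      _ = _ := (pow_succ _ _).symm
  have hexp : (E' + 2) * (localSearch dec).width ≤ C :=
    (Nat.mul_le_mul_left _ (Nat.le_add_right _ 2)).trans (by rw [hC]; exact Nat.le_add_left _ _)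
  have hY : (X1 + T) ^ (localSearch dec).width ≤ W := by
    calc (X1 + T) ^ (localSearch dec).width ≤ ((X + T) ^ (E' + 2)) ^ (localSearch dec).width :=
          Nat.pow_le_pow_left hbase _
      _ = (X + T) ^ ((E' + 2) * (localSearch dec).width) := (pow_mul _ _ _).symm
      _ ≤ W := Nat.pow_le_pow_right (by omega) hexp
  obtain ⟨f3, -⟩ := le_and_fits (Y := X1 + T) (W := W) (by omega) hY (localSearch dec) X1 s2 h.small
    hlits le_rfl l2 (by omega)
  have hX1W : X1 ≤ W := by
    refine ((Nat.le_add_right X1 T).trans hbase).trans (Nat.pow_le_pow_right (by omega) ?_)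
    exact (Nat.le_mul_of_pos_right _ (show 0 < (localSearch dec).width + 2 by omega)).trans
      (by rw [hC]; exact Nat.le_add_left _ _)
  have hfits : (searchWith setup dec).Fits W s :=
    ⟨f1.mono (hXE.trans hX1W), f2.mono hX1W, f3⟩
  obtain ⟨m', t, g1, g2, g3, -⟩ := comp_exec (k₀ := 100) (searchWith setup dec) 100 s s h.bound le_rfl
    (by omega) ⟨fun _ _ => rfl, rfl⟩ hfits
  exact ⟨W, t, m', g1, fun a => by rw [← g3.2], g2.trans htotal, le_rfl⟩

end Stmt
end LoopLang

/-! ### The parameters of the three local searches -/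

namespace LoopLang
open WordRAM
namespace Stmt
open LoopLang.Expr SubsetEdgeSeparator

theorem fill2_grid {n x y a : ℕ} {e : Expr} {s : State} (h0 : s.var 0 = n) (hx : x ≠ 0) (hy : y ≠ 0)
    (hxy : x ≠ y) (ha : e.usesArr a = false) (u v : Fin n) :
    grid ((fill2 x y a e).den s) a n u v = e.eval ((s.setVar x u).setVar y v) := by
  have := fill2_arr (s := s) hx hy hxy ha (i := u) (j := v) (by rw [h0]; exact u.2)
    (by rw [h0]; exact v.2)
  rw [h0] at this
  exact this

theorem copy_grid {n a b : ℕ} {s : State} (h0 : s.var 0 = n) (hab : a ≠ b) :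
    grid ((fill2 20 21 a (mat b 20 21)).den s) a n = grid s b n := by
  ext u v
  rw [fill2_grid h0 (by omega) (by omega) (by omega) (by simp [mat, usesArr, hab])]
  simp [grid, h0]

/-- The number of vertices `n` and `min k n` are prepared, and the search starts with all edges. -/
def setupCommon : Stmt :=
  set 10 (.var 0 * .var 0 + 1) ;; set 12 (.var 0 - (.var 0 - .var 1)) ;;
  fill2 20 21 2 (mat 0 20 21)

theorem setupCommon_spec {n : ℕ} {s : State} (h0 : s.var 0 = n) :
    (setupCommon.den s).var 10 = n * n + 1 ∧ (setupCommon.den s).var 12 = min (s.var 1) n ∧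
      grid (setupCommon.den s) 2 n = grid s 0 n := by
  simp only [setupCommon, den_seq, den_set]
  refine ⟨?_, ?_, ?_⟩
  · rw [den_var rfl]; simp [h0]
  · rw [den_var rfl]; simp [h0]; omega
  · rw [copy_grid (by simp [h0]) (by omega)]; rfl

/-- Parameters of the search over all sets of at most `min k n` vertices. -/
def setupTuple : Stmt :=
  setupCommon ;; fill2 20 21 3 (mat 0 20 21) ;; set 11 1 ;; set 13 (.var 12) ;; set 14 (.var 0)

/-- Degrees are computed in array `13`. -/
def degrees : Stmt := tally 20 21 23 13 (mat 0 20 21)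

theorem degrees_arr {n : ℕ} {s : State} (h0 : s.var 0 = n) (ha : ∀ u v, grid s 0 n u v ≤ 1)
    (u : Fin n) : (degrees.den s).arr 13 u = ∑ v, grid s 0 n u v := by
  rw [degrees, tally_arr (by omega) (by omega) (by omega) (by omega) (by omega) (by omega) rfl rfl
    (by rw [h0]; exact u.2), h0, card_range_filter, Finset.card_filter]
  refine Finset.sum_congr rfl fun v _ => ?_
  have h : (mat 0 20 21).eval ((s.setVar 20 u).setVar 21 v) = grid s 0 n u v := by
    simp [h0, grid]
  rw [h]
  have := ha u v
  interval_cases grid s 0 n u v <;> rfl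

/-- Parameters of the search over connected sets of at most `min k n` vertices. -/
def setupExpand : Stmt :=
  setupCommon ;; set 13 (.var 12 - 1) ;; set 14 (3 * .var 12 * .var 12) ;; set 15 (3 * .var 13) ;;
  degrees ;;
  fill2 20 21 3 (mat 0 20 21 - ((ent 13 20 - .var 15) + (ent 13 21 - .var 15))) ;; set 11 (.var 0)

/-- Parameters of the search over connected sets of small boundary. -/
def setupSearch : Stmt :=
  setupCommon ;; fill2 20 21 3 (mat 0 20 21) ;; degrees ;; set 16 0 ;;
  loop 20 0 (ite (ent 13 20 - .var 16) (set 16 (ent 13 20)) skip) ;;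
  set 15 (2 * .var 12 * .var 16 * .var 3 / .var 2) ;;
  set 13 (3 * .var 15 + 2 * .var 12 + 2) ;; set 14 (2 - (1 - .var 15)) ;; set 11 (.var 0)

/-- The outcome of a setup: the local search works in the graph `adj`. -/
structure SetupSpec (n k : ℕ) (adj₀ adj : Fin n → Fin n → ℕ) (s t : State) : Prop where
  var0 : t.var 0 = n
  var10 : t.var 10 = n * n + 1
  var12 : t.var 12 = min k n
  arr1 : t.arr 1 = s.arr 1
  grid2 : grid t 2 n = adj₀
  grid3 : grid t 3 n = adj

theorem setupTuple_spec {n k : ℕ} {s : State} (h0 : s.var 0 = n) (h1 : s.var 1 = k) :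
    SetupSpec n k (grid s 0 n) (grid s 0 n) s (setupTuple.den s) ∧
      (setupTuple.den s).var 11 = 1 ∧ (setupTuple.den s).var 13 = min k n ∧
      (setupTuple.den s).var 14 = n := by
  obtain ⟨e1, e2, e3⟩ := setupCommon_spec h0
  set t := setupCommon.den s with ht
  have t0 : t.var 0 = n := by rw [ht, den_var rfl, h0]
  set t' := (fill2 20 21 3 (mat 0 20 21)).den t with ht'
  have t0' : t'.var 0 = n := by rw [ht', den_var rfl, t0]
  have t12 : t'.var 12 = min k n := by rw [ht', den_var rfl, e2, h1]
  have hd : setupTuple.den s = ((t'.setVar 11 1).setVar 13 (t'.var 12)).setVar 14 (t'.var 0) := rfl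
  rw [hd]
  refine ⟨⟨by simp [t0'], ?_, by simp [t12], ?_, ?_, ?_⟩, by simp, by simp [t12], by simp [t0']⟩
  · simp [ht', den_var (show (fill2 20 21 3 (mat 0 20 21)).writesVar 10 = false from rfl), e1]
  · have : t'.arr 1 = s.arr 1 := by rw [ht', den_arr rfl, ht, den_arr rfl]
    exact this
  · rw [← e3]
    exact grid_congr (show t'.arr 2 = t.arr 2 by rw [ht', den_arr rfl])
  · have : grid t' 3 n = grid t 0 n := copy_grid t0 (by omega)
    refine Eq.trans this (grid_congr ?_)
    rw [ht, den_arr rfl]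

theorem setupExpand_spec {n k : ℕ} {s : State} (h0 : s.var 0 = n) (h1 : s.var 1 = k)
    (ha : IsSym01 (grid s 0 n)) :
    SetupSpec n k (grid s 0 n) (lowDegree (grid s 0 n) (3 * (min k n - 1))) s (setupExpand.den s) ∧
      (setupExpand.den s).var 11 = n ∧ (setupExpand.den s).var 13 = min k n - 1 ∧
      (setupExpand.den s).var 14 = 3 * min k n * min k n := by
  obtain ⟨e1, e2, e3⟩ := setupCommon_spec h0
  set t := setupCommon.den s with ht
  set t1 := ((t.setVar 13 (t.var 12 - 1)).setVar 14 (3 * t.var 12 * t.var 12)).setVar 15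
    (3 * (t.var 12 - 1)) with ht1
  set e : Expr := mat 0 20 21 - ((ent 13 20 - .var 15) + (ent 13 21 - .var 15)) with he
  set t2 := degrees.den t1 with ht2
  set t3 := (fill2 20 21 3 e).den t2 with ht3
  have hd : setupExpand.den s = t3.setVar 11 (t3.var 0) := by
    simp only [setupExpand, den_seq, den_set, ← ht]
    rw [ht3, ht2, ht1, he]
    simp
  have t0 : t.var 0 = n := by rw [ht, den_var rfl, h0]
  rw [h1] at e2
  have v1 : t1.var 0 = n := by simp [ht1, t0]
  have v2 : t2.var 0 = n := by rw [ht2, den_var rfl, v1]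
  have v3 : ∀ x, x = 0 ∨ x = 10 ∨ x = 12 ∨ x = 13 ∨ x = 14 → t3.var x = t1.var x := by
    rintro x (rfl | rfl | rfl | rfl | rfl) <;> rw [ht3, den_var rfl, ht2, den_var rfl]
  have a1 : t1.arr = t.arr := rfl
  have a0 : t.arr 0 = s.arr 0 := by rw [ht, den_arr rfl]
  have g0 : grid t1 0 n = grid s 0 n := grid_congr (by rw [a1, a0])
  have hdeg := degrees_arr (s := t1) v1 (by rw [g0]; exact ha.le)
  rw [hd]
  refine ⟨⟨by simp [v3, v1], by simp [v3, ht1, e1], by simp [v3, ht1, e2], ?_, ?_, ?_⟩,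
    by simp [v3, v1], by simp [v3, ht1, e2], by simp [v3, ht1, e2]⟩
  · have : t3.arr 1 = s.arr 1 := by
      rw [ht3, den_arr rfl, ht2, den_arr rfl, a1, ht, den_arr rfl]
    exact this
  · rw [← e3]
    exact grid_congr (show t3.arr 2 = t.arr 2 by rw [ht3, den_arr rfl, ht2, den_arr rfl, a1])
  · have : grid t3 3 n = lowDegree (grid s 0 n) (3 * (min k n - 1)) := by
      ext u v
      rw [ht3, fill2_grid v2 (by omega) (by omega) (by omega) rfl]
      have h15 : t2.var 15 = 3 * (min k n - 1) := by rw [ht2, den_var rfl]; simp [ht1, e2]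
      have e0 : t2.arr 0 (u * n + v) = grid s 0 n u v := by
        rw [ht2, den_arr rfl, a1, a0]; rfl
      rw [g0] at hdeg
      simp only [he, eval_sub, eval_add, eval_mat, eval_ent, eval_var, setVar_var, setVar_arr]
      simp only [show ((20 : ℕ) = 21) = False by simp, show ((0 : ℕ) = 21) = False by simp,
        show ((0 : ℕ) = 20) = False by simp, show ((15 : ℕ) = 20) = False by simp,
        show ((15 : ℕ) = 21) = False by simp, if_true, if_false, v2, h15, e0, lowDegree]
      rw [ht2, hdeg u, hdeg v]
      have := ha.le u v
      split_ifs <;> omega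
    exact this

theorem max_loop {n : ℕ} {s : State} (h0 : s.var 0 = n) (hs : s.var 16 = 0) :
    ((loop 20 0 (ite (ent 13 20 - .var 16) (set 16 (ent 13 20)) skip)).den s).var 16 =
      Finset.univ.sup fun v : Fin n => s.arr 13 v := by
  have := loop_induct (x := 20) (y := 0) (p := ite (ent 13 20 - .var 16) (set 16 (ent 13 20)) skip)
    (s := s) (I := fun i s' => s'.arr = s.arr ∧
      s'.var 16 = (Finset.range i).sup fun v => s.arr 13 v) ⟨rfl, by simp [hs]⟩ ?_
  · rw [this.2, h0]
    refine le_antisymm (Finset.sup_le fun i hi => ?_) (Finset.sup_le fun v _ => ?_)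
    · exact Finset.le_sup (f := fun v : Fin n => s.arr 13 v)
        (Finset.mem_univ (⟨i, Finset.mem_range.1 hi⟩ : Fin n))
    · exact Finset.le_sup (f := fun v => s.arr 13 v) (Finset.mem_range.2 v.2)
  rintro i hi s' ⟨h1, h2⟩
  rw [den_ite, Finset.range_add_one, Finset.sup_insert, ← h2]
  have he : (ent 13 20 - .var 16).eval (s'.setVar 20 i) = s.arr 13 i - s'.var 16 := by
    simp [h1]
  rw [he]
  split
  · refine ⟨h1, ?_⟩
    simp only [den_set, setVar_var_self, eval_ent, setVar_arr, h1]
    rw [sup_eq_left.2 (by omega)]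
  · refine ⟨h1, ?_⟩
    rw [sup_eq_right.2 (by omega)]
    simp

theorem setupSearch_spec {n k p q : ℕ} {s : State} (h0 : s.var 0 = n) (h1 : s.var 1 = k)
    (h2 : s.var 2 = p) (h3 : s.var 3 = q) (ha : IsSym01 (grid s 0 n)) {b : ℕ}
    (hb : b = 2 * min k n * (Finset.univ.sup fun u => ∑ v, grid s 0 n u v) * q / p) :
    SetupSpec n k (grid s 0 n) (grid s 0 n) s (setupSearch.den s) ∧
      (setupSearch.den s).var 11 = n ∧ (setupSearch.den s).var 13 = 3 * b + 2 * min k n + 2 ∧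
      (setupSearch.den s).var 14 = if b = 0 then 1 else 2 := by
  obtain ⟨e1, e2, e3⟩ := setupCommon_spec h0
  set t := setupCommon.den s with ht
  set t1 := (fill2 20 21 3 (mat 0 20 21)).den t with ht1
  set t2 := degrees.den t1 with ht2
  set t3 := (loop 20 0 (ite (ent 13 20 - .var 16) (set 16 (ent 13 20)) skip)).den (t2.setVar 16 0)
    with ht3
  have hd : setupSearch.den s = (set 15 (2 * .var 12 * .var 16 * .var 3 / .var 2) ;;
    set 13 (3 * .var 15 + 2 * .var 12 + 2) ;; set 14 (2 - (1 - .var 15)) ;; set 11 (.var 0)).den t3 :=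
    rfl
  rw [h1] at e2
  have t0 : t.var 0 = n := by rw [ht, den_var rfl, h0]
  have u0 : t1.var 0 = n := by rw [ht1, den_var rfl, t0]
  have v3 : ∀ x, x = 0 ∨ x = 2 ∨ x = 3 ∨ x = 10 ∨ x = 12 → t3.var x = t.var x := by
    rintro x (rfl | rfl | rfl | rfl | rfl) <;>
      rw [ht3, den_var rfl, setVar_var_of_ne (by omega), ht2, den_var rfl, ht1, den_var rfl]
  have w2 : t.var 2 = p := by rw [ht, den_var rfl, h2]
  have w3 : t.var 3 = q := by rw [ht, den_var rfl, h3]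
  have a3 : ∀ a, a ≠ 3 → a ≠ 13 → t3.arr a = t.arr a := by
    intro a h3 h13
    rw [ht3, den_arr rfl, setVar_arr, ht2, den_arr (by simp [degrees, tally, count, writesArr, h13]),
      ht1, den_arr (by simp [fill2, writesArr, h3])]
  have a0 : t.arr 0 = s.arr 0 := by rw [ht, den_arr rfl]
  have g0 : grid t1 0 n = grid s 0 n := grid_congr (by rw [ht1, den_arr rfl, a0])
  have hdeg := degrees_arr (s := t1) u0 (by rw [g0]; exact ha.le)
  rw [g0, ← ht2] at hdeg
  have h16 : t3.var 16 = Finset.univ.sup fun u => ∑ v, grid s 0 n u v := by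
    rw [ht3, max_loop (n := n) (by rw [setVar_var_of_ne (by omega), ht2, den_var rfl, u0])
      setVar_var_self]
    exact Finset.sup_congr rfl fun u _ => hdeg u
  have g3 : grid t3 3 n = grid s 0 n := by
    rw [← grid_congr (n := n) a0, ← copy_grid (a := 3) t0 (by omega)]
    exact grid_congr (by rw [ht3, den_arr rfl, setVar_arr, ht2, den_arr rfl])
  have e15 : 2 * t3.var 12 * t3.var 16 * t3.var 3 / t3.var 2 = b := by
    rw [v3 12 (by simp), v3 3 (by simp), v3 2 (by simp), h16, e2, w2, w3, hb]
  have hd' : setupSearch.den s = (((t3.setVar 15 b).setVar 13 (3 * b + 2 * min k n + 2)).setVar 14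
      (2 - (1 - b))).setVar 11 n := by
    rw [hd]
    simp only [den_seq, den_set, eval_div, eval_mul, eval_var, eval_two, eval_three, eval_add,
      eval_sub, eval_one, e15]
    simp [v3, e2, t0]
  rw [hd']
  refine ⟨⟨by simp [v3, t0], by simp [v3, e1], by simp [v3, e2], ?_, ?_, ?_⟩, by simp, by simp, ?_⟩
  · have : t3.arr 1 = s.arr 1 := by rw [a3 1 (by omega) (by omega), ht, den_arr rfl]
    exact this
  · rw [← e3]
    exact grid_congr (a3 2 (by omega) (by omega))
  · exact g3
  · have : (((((t3.setVar 15 b).setVar 13 (3 * b + 2 * min k n + 2)).setVar 14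
      (2 - (1 - b))).setVar 11 n).var 14) = 2 - (1 - b) := by simp
    rw [this]
    split_ifs <;> omega

theorem isPoly_setupCommon : IsPoly setupCommon :=
  (isPoly_set _ _).seq ((isPoly_set _ _).seq (isPoly_of_small rfl rfl))

theorem admissible_tuple : Admissible setupTuple decodeTuple where
  poly := isPoly_setupCommon.seq ((isPoly_of_small rfl rfl).seq ((isPoly_set _ _).seq
    ((isPoly_set _ _).seq (isPoly_set _ _))))
  fixed := rfl
  loops := rfl
  loops' := rfl
  bound := by decide
  small := rfl
  fixed' := rfl
  writes := rfl

theorem admissible_expand : Admissible setupExpand decodeExpand where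
  poly := isPoly_setupCommon.seq ((isPoly_set _ _).seq ((isPoly_set _ _).seq ((isPoly_set _ _).seq
    ((isPoly_of_small rfl rfl).seq ((isPoly_of_small rfl rfl).seq (isPoly_set _ _))))))
  fixed := rfl
  loops := rfl
  loops' := rfl
  bound := by decide
  small := rfl
  fixed' := rfl
  writes := rfl

theorem admissible_search : Admissible setupSearch decodeSearch where
  poly := isPoly_setupCommon.seq ((isPoly_of_small rfl rfl).seq ((isPoly_of_small rfl rfl).seq
    ((isPoly_set _ _).seq ((isPoly_of_small rfl rfl).seq ((isPoly_set _ _).seq ((isPoly_set _ _).seq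
    ((isPoly_set _ _).seq (isPoly_set _ _))))))))
  fixed := rfl
  loops := rfl
  loops' := rfl
  bound := by decide
  small := rfl
  fixed' := rfl
  writes := rfl

end Stmt
end LoopLang

/-! ### From a local search program to an approximation algorithm -/

namespace SubsetEdgeSeparator
open WordRAM LoopLang LoopLang.Stmt

theorem exists_edgeMat {V : Type*} [Fintype V] [DecidableEq V] {M : V → V → ℕ} (hM : IsSym01 M) :
    ∃ S : Finset (Sym2 V), edgeMat S = M := by
  refine ⟨(Finset.univ.filter fun p : V × V => M p.1 p.2 ≠ 0).image fun p => s(p.1, p.2), ?_⟩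
  ext u v
  have hmem : s(u, v) ∈ (Finset.univ.filter fun p : V × V => M p.1 p.2 ≠ 0).image
      (fun p => s(p.1, p.2)) ↔ M u v ≠ 0 := by
    simp only [Finset.mem_image, Finset.mem_filter, Finset.mem_univ, true_and, Prod.exists]
    constructor
    · rintro ⟨a, b, h, hab⟩
      rcases Sym2.eq_iff.1 hab with ⟨rfl, rfl⟩ | ⟨rfl, rfl⟩
      · exact h
      · rwa [hM.symm]
    · exact fun h => ⟨u, v, h, rfl⟩
  have := hM.le u v
  unfold edgeMat
  by_cases h : M u v = 0
  · rw [if_neg (by rw [hmem]; simpa using h), h]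
  · rw [if_pos (hmem.2 h)]; omega

section Input
variable {n : ℕ} (G : SimpleGraph (Fin n)) [DecidableRel G.Adj] (R : Finset (Fin n)) (l : List ℕ)

theorem grid_inputState : grid (inputState G R l) 0 n = adjMat G := by
  ext u v
  simp only [grid, inputState, if_true, adjMat]
  by_cases h : G.Adj u v
  · rw [if_pos ⟨u, v, h, rfl⟩, if_pos h]
  · rw [if_neg, if_neg h]
    rintro ⟨u', v', h', e⟩
    obtain ⟨h1, h2⟩ := (mul_add_inj v.2 v'.2).1 e
    rw [Fin.ext h1, Fin.ext h2] at h
    exact h h'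

theorem row_inputState_le (v : Fin n) : row (inputState G R l) 1 n v ≤ 1 := by
  simp only [row, inputState]
  split_ifs <;> simp

theorem supp_inputState : supp (inputState G R l) 1 n = R := by
  ext v
  rw [mem_supp]
  simp only [inputState, one_ne_zero, if_false, if_true, ne_eq, ite_eq_right_iff, not_forall,
    not_false_iff, exists_prop, and_true]
  constructor
  · rintro ⟨w, hw, h⟩; rwa [Fin.ext h]
  · exact fun h => ⟨v, h, rfl⟩

theorem inputState_le (h : 1 ≤ n) : (inputState G R l).Le (n + l.sum) := by
  refine ⟨fun x => ?_, fun a i => ?_⟩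
  · show (n :: l).getD x 0 ≤ n + l.sum
    rw [List.getD_eq_getElem?_getD]
    rcases hx : (n :: l)[x]? with _ | y
    · simp
    · have := List.single_le_sum (fun _ _ => Nat.zero_le _) y (List.mem_of_getElem? hx)
      simpa using this
  · simp only [inputState]
    split_ifs <;> omega

end Input

/-- A local search program is an approximation algorithm if local optima have the required size.
The number `B` bounds the loops of a decoding of one of the `M` advice strings, and `A g` is the set
of vertices that the advice string `g` describes. -/
theorem solvesWithin_of_admissible {setup dec : Stmt} (h : Admissible setup dec)
    (hk : dec.Keeps) (hd2 : dec.writesArr 2 = false) :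
    ∃ C, ∀ C' ≥ C, ∀ (n k : ℕ) (extra : List ℕ) (G : SimpleGraph (Fin n)) [DecidableRel G.Adj]
      (R : Finset (Fin n)) (α T : ℝ) (adj : Fin n → Fin n → ℕ) (A : ℕ → Finset (Fin n)) (t : State)
      (B M : ℕ), 1 ≤ n → 1 ≤ k → t = setup.den (inputState G R (k :: extra)) →
      SetupSpec n k (adjMat G) adj (inputState G R (k :: extra)) t →
      IsSym01 adj → (∀ u v, adj u v ≤ adjMat G u v) → 1 ≤ t.var 14 →
      t.var 11 * t.var 14 ^ t.var 13 = M → 1 ≤ M → n * n + 1 ≤ B → t.var 13 ≤ B →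
      (∀ g < M, ∀ s : State, s.var 0 = n → s.var 10 = n * n + 1 → s.var 12 = min k n →
        s.var 13 = t.var 13 → s.var 14 = t.var 14 → s.var 28 = g → grid s 3 n = adj →
        supp s 1 n = R → (∀ v, row s 1 n v ≤ 1) → supp (dec.den s) 9 n = A g) →
      (∀ g < M, (A g ∩ R).card ≤ min k n) →
      (∀ S, Separates (adjMat G) adj R (min k n) S → (∀ g < M, StableAt adj S R (A g)) →
        ∀ T, IsSolution G R (min k n) T →
          ((∑ u, ∑ v, S u v : ℕ) : ℝ) ≤ α * (∑ u, ∑ v, edgeMat T u v : ℕ)) →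
      ((C * B ^ C * M : ℕ) : ℝ) ≤ T →
      SolvesWithin ((searchWith setup dec).comp 100) C' G R k extra α T := by
  obtain ⟨C, hC⟩ := h.exec
  refine ⟨C, fun C' hC' n k extra G _ R α T adj A t B M hn hk1 ht hspec ha hle h14 hM hM1 hB h13 hdec
    hA hratio hT => ?_⟩
  set s₀ := inputState G R (k :: extra) with hs₀
  obtain ⟨t0, t10, t12, ta1, tg2, tg3⟩ := hspec
  set X := n + (k :: extra).sum with hX
  have hX2 : 2 ≤ X := by simp [hX]; omega
  have h0 : s₀.var 0 = n := rfl
  have hnB : n ≤ B := by nlinarith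
  obtain ⟨W, τ, s', e1, e2, e3, e4⟩ := hC s₀ X B M hX2 (inputState_le G R _ hn) (by omega) hM1
    (by rw [h0]; exact hnB) (by rw [← ht]; exact h14) (by rw [← ht]; exact h13)
    (by rw [← ht]; exact hM.le) (by rw [← ht, t0]; exact hnB) (by rw [← ht, t10]; exact hB)
    (by rw [← ht, t12]; exact (min_le_right _ _).trans hnB)
  -- the local search starts in the state `p`
  set p := power.den t with hp
  have pv : ∀ x, x ≠ 11 → x ≠ 29 → p.var x = t.var x := fun x hx hx' =>
    den_var (by simp [power, writesVar, hx, hx']) _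
  have pa : ∀ a, p.arr a = t.arr a := fun a => den_arr rfl _
  have p11 : p.var 11 = M := by rw [hp, power_var, hM]
  have pg3 : grid p 3 n = adj := by rw [grid_congr (pa 3), tg3]
  have pg2 : grid p 2 n = adjMat G := by rw [grid_congr (pa 2), tg2]
  have pR : supp p 1 n = R := by
    rw [supp_congr (pa 1), supp_congr ta1, hs₀, supp_inputState]
  have pR1 : ∀ v, row p 1 n v ≤ 1 := fun v => by
    rw [row_congr (pa 1), row_congr ta1, hs₀]; exact row_inputState_le G R _ v
  have hloc := localSearch_spec (n := n) (dec := dec) (s₀ := p) (A := A)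
    (Feas := Separates (adjMat G) adj R (min k n)) hk hd2 (by rw [pv 0 (by omega) (by omega), t0])
    (by rw [pv 10 (by omega) (by omega), t10]) pR1 (by rw [pg3]; exact ha)
    (by rw [pg2]; exact isSym01_adjMat G)
    (fun g hg s hs hsg => by
      rw [p11] at hg
      have hv : ∀ x < 19, x ≠ 11 → s.var x = t.var x := fun x hx hx' => by
        rw [hs.1 x hx, pv x hx' (by omega)]
      refine hdec g hg s (by rw [hv 0 (by omega) (by omega), t0])
        (by rw [hv 10 (by omega) (by omega), t10]) (by rw [hv 12 (by omega) (by omega), t12])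
        (hv 13 (by omega) (by omega)) (hv 14 (by omega) (by omega)) hsg ?_ ?_ fun v => ?_
      · rw [grid_congr hs.2.2.2, pg3]
      · rw [supp_congr hs.2.2.1, pR]
      · rw [row_congr hs.2.2.1]; exact pR1 v)
    (by rw [pg2]; exact separates_self _ _ _ (le_min hk1 hn))
    (fun g hg S W hS hF hW => by
      rw [p11] at hg
      rw [pg3]
      rw [pR] at hW
      refine hF.moveMat (isSym01_adjMat G) hle ((Finset.card_le_card fun v hv => ?_).trans (hA g hg))
      obtain ⟨hv1, hv2⟩ := Finset.mem_inter.1 hv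
      refine Finset.mem_inter.2 ⟨?_, hv2⟩
      by_contra hvA
      exact Finset.disjoint_left.1 hW hv1 (Finset.mem_sdiff.2 ⟨hv2, hvA⟩))
  rw [p11, pg3, pR] at hloc
  obtain ⟨l1, l2, l3⟩ := hloc
  have hfin : (searchWith setup dec).den s₀ = (localSearch dec).den p := by rw [hp, ht]; rfl
  obtain ⟨S, hS⟩ := exists_edgeMat l1
  refine ⟨W, τ, s', e1, le_trans (by exact_mod_cast e3) hT, ?_, S, ⟨?_, fun S' hS' => ?_⟩,
    fun u v => ?_⟩
  · have hT0 : (0 : ℝ) ≤ T := le_trans (Nat.cast_nonneg _) hT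
    have hX1 : (2 : ℝ) ≤ (n : ℝ) + ((k :: extra).sum : ℕ) := by
      exact_mod_cast hX2
    calc (W : ℝ) ≤ (((X + C * B ^ C * M) ^ C : ℕ) : ℝ) := by exact_mod_cast e4
      _ = ((n : ℝ) + ((k :: extra).sum : ℕ) + (C * B ^ C * M : ℕ)) ^ C := by
        rw [hX]; push_cast; ring
      _ ≤ ((n : ℝ) + ((k :: extra).sum : ℕ) + T) ^ C :=
        pow_le_pow_left₀ (by positivity) (by linarith) _
      _ ≤ _ := pow_le_pow_right₀ (by linarith) hC'
  · have := isSolution_of_separates (G := G) (R := R) (S := S) (by rw [hS]; exact l2)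
    have h2 := isSolution_min_iff (G := G) (R := R) (k := k) (T := S)
    rw [Fintype.card_fin] at h2
    exact h2.1 this
  · have h2 := isSolution_min_iff (G := G) (R := R) (k := k) (T := S')
    rw [Fintype.card_fin] at h2
    have h3 := hratio _ l2 l3 S' (h2.2 hS')
    have h4 := isSolution_of_separates (G := G) (R := R) (S := S) (by rw [hS]; exact l2)
    rw [← hS, sum_edgeMat h4.1, sum_edgeMat hS'.1] at h3
    push_cast at h3
    linarith
  · have h5 : s'.arr 2 (u.val * n + v.val) = edgeMat S u v := by
      rw [e2, hfin, hS]; rfl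
    rw [h5, edgeMat]
    split_ifs with h6 <;> simp [h6]

end SubsetEdgeSeparator

/-! ### The three algorithms -/

namespace SubsetEdgeSeparator
open WordRAM LoopLang LoopLang.Stmt

theorem advice_lt {n h N : ℕ} (r : Fin n) (hh : h < N) : r + n * h < n * N := by
  calc r + n * h < n + n * h := Nat.add_lt_add_right r.2 _
    _ = n * (h + 1) := by ring
    _ ≤ n * N := Nat.mul_le_mul_left _ hh

theorem advice_mod {n h : ℕ} (r : Fin n) (hn : 0 < n) :
    (⟨(r + n * h) % n, Nat.mod_lt _ hn⟩ : Fin n) = r :=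
  Fin.ext (by simp [Nat.mod_eq_of_lt r.2])

theorem advice_div {n h : ℕ} (r : Fin n) (hn : 0 < n) : (r + n * h) / n = h := by
  rw [Nat.add_mul_div_left _ _ hn, Nat.div_eq_of_lt r.2, Nat.zero_add]

theorem sq_add_one_le {n : ℕ} (hn : 1 ≤ n) : n * n + 1 ≤ 2 * n ^ 2 := by nlinarith

/-- Local search over all sets of vertices with at most `k` terminals. -/
theorem exists_solvesWithin_tuple : ∃ (P : Prog) (C : ℕ), ∀ (n k : ℕ), 1 ≤ n → 1 ≤ k →
    ∀ (G : SimpleGraph (Fin n)) [DecidableRel G.Adj] (R : Finset (Fin n)),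
      SolvesWithin P C G R k [] 2 (C * (n : ℝ) ^ (k + C)) := by
  obtain ⟨C, hC⟩ := solvesWithin_of_admissible admissible_tuple rfl rfl
  set C' := C * 2 ^ C + 2 * C with hC'
  refine ⟨(searchWith setupTuple decodeTuple).comp 100, C', fun n k hn hk G _ R => ?_⟩
  set s₀ := inputState G R [k] with hs₀
  have hG : grid s₀ 0 n = adjMat G := grid_inputState G R _
  obtain ⟨h1, h11, h13, h14⟩ := setupTuple_spec (n := n) (k := k) (s := s₀) rfl rfl
  rw [hG] at h1
  set K := min k n with hK
  have hKn : K ≤ n := min_le_right _ _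
  refine hC C' (by omega) n k [] G R 2 _ (adjMat G) (fun g => runDigits insertNum n K ∅ g)
    (setupTuple.den s₀) (n * n + 1) (n ^ K) hn hk rfl h1 (isSym01_adjMat G) (fun _ _ => le_rfl)
    (by rw [h14]; exact hn) (by rw [h11, h13, h14, one_mul]) (Nat.pow_pos hn) le_rfl
    (by rw [h13]; nlinarith) (fun g hg s e0 e10 e12 e13 e14 e28 e3 eR eR1 => ?_) (fun g hg => ?_)
    (fun S hS hst T hT => ?_) ?_
  · rw [decodeTuple_spec e0, e12, e28]
  · refine (Finset.card_le_card Finset.inter_subset_left).trans ?_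
    have := runDigits_induct (step := insertNum (n := n)) (β := n)
      (P := fun j A => A.card + j ≤ K) (fun j A q h => by
        have := card_insertNum_le A q
        omega) K ∅ g (by simp)
    exact this
  · have := ratio_of_stable hT hS.le fun O hO => by
      obtain ⟨g, hg, hsub⟩ := exists_runDigits_insertNum hn hO
      refine hst g hg O (Finset.disjoint_left.2 fun v hv hv' => ?_)
      obtain ⟨hv1, hv2⟩ := Finset.mem_sdiff.1 hv'
      exact hv2 (hsub (Finset.mem_inter.2 ⟨hv, hv1⟩))
    exact_mod_cast this
  · have : C * (n * n + 1) ^ C * n ^ K ≤ C' * n ^ (k + C') := by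
      calc C * (n * n + 1) ^ C * n ^ K ≤ C * (2 * n ^ 2) ^ C * n ^ k :=
            Nat.mul_le_mul (Nat.mul_le_mul_left _ (Nat.pow_le_pow_left (sq_add_one_le hn) _))
              (Nat.pow_le_pow_right hn (min_le_left _ _))
        _ = C * 2 ^ C * n ^ (k + 2 * C) := by ring
        _ ≤ C' * n ^ (k + C') := Nat.mul_le_mul (by omega) (Nat.pow_le_pow_right hn (by omega))
    exact_mod_cast this

/-- The number of advice strings for connected sets with at most `k` vertices. -/
theorem expand_base_pow_le {k n : ℕ} (hk : 1 ≤ k) :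
    (3 * min k n * min k n) ^ (min k n - 1) ≤ k ^ (4 * k) := by
  rcases Nat.lt_or_ge k 2 with h | h
  · have : min k n - 1 = 0 := by omega
    rw [this, pow_zero]
    exact Nat.pow_pos hk
  · have h1 : 3 * min k n * min k n ≤ k ^ 4 := by
      have h2 : min k n * min k n ≤ k * k := Nat.mul_le_mul (min_le_left _ _) (min_le_left _ _)
      have h3 : 2 * 2 ≤ k * k := Nat.mul_le_mul h h
      calc 3 * min k n * min k n = 3 * (min k n * min k n) := by ring
        _ ≤ (k * k) * (k * k) := Nat.mul_le_mul (by omega) h2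
        _ = k ^ 4 := by ring
    calc _ ≤ (k ^ 4) ^ (min k n - 1) := Nat.pow_le_pow_left h1 _
      _ ≤ (k ^ 4) ^ k := Nat.pow_le_pow_right (Nat.pow_pos hk) (by omega)
      _ = k ^ (4 * k) := (pow_mul _ _ _).symm

theorem pow_le_two_rpow {k : ℕ} (hk : 1 ≤ k) {ε : ℝ} (hε : 0 < ε) {c : ℝ} (hc : 4 ≤ c) :
    ((k ^ (4 * k) : ℕ) : ℝ) ≤ (2 : ℝ) ^ (c * (k * Real.logb 2 (k / min ε 1))) := by
  have hk0 : (0 : ℝ) < k := by exact_mod_cast hk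
  have hk1 : (1 : ℝ) ≤ k := by exact_mod_cast hk
  have hm : 0 < min ε 1 := lt_min hε one_pos
  have h1 : (k : ℝ) ≤ k / min ε 1 := by
    rw [le_div_iff₀ hm]
    exact mul_le_of_le_one_right hk0.le (min_le_right _ _)
  have h2 : Real.logb 2 k ≤ Real.logb 2 (k / min ε 1) := Real.logb_le_logb_of_le (by norm_num) hk0 h1
  have h3 : 0 ≤ Real.logb 2 k := Real.logb_nonneg (by norm_num) hk1
  have h4 : ((k ^ (4 * k) : ℕ) : ℝ) = (2 : ℝ) ^ (4 * (k * Real.logb 2 k)) := by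
    rw [show 4 * (k * Real.logb 2 k) = Real.logb 2 k * ((4 * k : ℕ) : ℝ) by push_cast; ring,
      Real.rpow_mul (by norm_num), Real.rpow_logb (by norm_num) (by norm_num) hk0, Real.rpow_natCast]
    push_cast; rfl
  rw [h4]
  refine Real.rpow_le_rpow_of_exponent_le (by norm_num) ?_
  exact mul_le_mul hc (mul_le_mul_of_nonneg_left h2 hk0.le) (mul_nonneg hk0.le h3) (by linarith)

/-- Local search over connected sets of at most `k` vertices of small degree. -/
theorem exists_solvesWithin_expand : ∃ (P : Prog) (C : ℕ), ∀ (n k : ℕ) (ε : ℚ), 1 ≤ n → 1 ≤ k →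
    0 < ε → ∀ (G : SimpleGraph (Fin n)) [DecidableRel G.Adj],
      SolvesWithin P C G Finset.univ k (encodeRat ε) (2 + (ε : ℝ))
        (C * (2 : ℝ) ^ (C * (k * Real.logb 2 (k / min (ε : ℝ) 1))) * (n : ℝ) ^ C) := by
  obtain ⟨C, hC⟩ := solvesWithin_of_admissible admissible_expand rfl rfl
  set C' := C * 2 ^ C + 2 * C + 4 with hC'
  refine ⟨(searchWith setupExpand decodeExpand).comp 100, C', fun n k ε hn hk hε G _ => ?_⟩
  set s₀ := inputState G Finset.univ (k :: encodeRat ε) with hs₀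
  have hG : grid s₀ 0 n = adjMat G := grid_inputState G _ _
  obtain ⟨h1, h11, h13, h14⟩ := setupExpand_spec (n := n) (k := k) (s := s₀) rfl rfl
    (by rw [hG]; exact isSym01_adjMat G)
  rw [hG] at h1
  set K := min k n with hK
  have hKn : K ≤ n := min_le_right _ _
  have hK1 : 1 ≤ K := le_min hk hn
  set adj := lowDegree (adjMat G) (3 * (K - 1)) with hadj
  set β := 3 * K * K with hβ
  have hβ1 : 1 ≤ β := by rw [hβ]; nlinarith
  refine hC C' (by omega) n k _ G _ _ _ adj
    (fun g => runDigits (expand adj) β (K - 1) {⟨g % n, Nat.mod_lt _ hn⟩} (g / n))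
    (setupExpand.den s₀) (n * n + 1) (n * β ^ (K - 1)) hn hk rfl h1
    (isSym01_lowDegree (isSym01_adjMat G) _) (lowDegree_le _ _)
    (by rw [h14]; exact hβ1) (by rw [h11, h13, h14]) (Nat.mul_pos hn (Nat.pow_pos hβ1)) le_rfl
    (by rw [h13]; nlinarith [Nat.sub_le K 1]) (fun g hg s e0 e10 e12 e13 e14 e28 e3 eR eR1 => ?_)
    (fun g hg => ?_) (fun S hS hst T hT => ?_) ?_
  · rw [decodeExpand_spec e0 hn, e3]
    simp only [e13, e14, e28, h13, h14]
  · refine (Finset.card_le_card Finset.inter_subset_left).trans ?_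
    have := runDigits_induct (step := expand adj) (β := β)
      (P := fun j A => A.card + j ≤ K) (fun j A q h => by
        have := card_expand_le adj A q
        omega) (K - 1) {⟨g % n, Nat.mod_lt _ hn⟩} (g / n) (by simp only [Finset.card_singleton]; omega)
    exact this
  · have := ratio_of_stable_lowDegree hT hS fun O hO hOK => by
      rcases Finset.eq_empty_or_nonempty O with rfl | ⟨r, hr⟩
      · rw [moveMat_empty]
      obtain ⟨h, hh, hsub⟩ := exists_runDigits_expand (Δ := 3 * (K - 1)) (β := β) hO hOK
        (card_lowDegree_le (isSym01_adjMat G) _)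
        (by rw [hβ, Nat.mul_assoc 3, Nat.mul_left_comm]
            exact Nat.mul_le_mul_left 3 (Nat.mul_le_mul_left K (Nat.sub_le _ _))) hβ1 hr
      refine hst _ (advice_lt r hh) O (Finset.disjoint_left.2 fun v hv hv' => ?_)
      rw [advice_mod r hn, advice_div r hn] at hv'
      exact (Finset.mem_sdiff.1 hv').2 (hsub hv)
    have h2 : ((∑ u, ∑ v, S u v : ℕ) : ℝ) ≤ 2 * (∑ u, ∑ v, edgeMat T u v : ℕ) := by
      exact_mod_cast this
    have hε' : (0 : ℝ) < ε := by exact_mod_cast hε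
    nlinarith [Nat.cast_nonneg (α := ℝ) (∑ u, ∑ v, edgeMat T u v)]
  · have hp := pow_le_two_rpow (ε := ε) (c := C') hk (by exact_mod_cast hε)
      (by exact_mod_cast (show 4 ≤ C' by omega))
    have h3 : C * (n * n + 1) ^ C * (n * β ^ (K - 1)) ≤ C' * k ^ (4 * k) * n ^ C' := by
      calc C * (n * n + 1) ^ C * (n * β ^ (K - 1)) ≤ C * (2 * n ^ 2) ^ C * (n * k ^ (4 * k)) :=
            Nat.mul_le_mul (Nat.mul_le_mul_left _ (Nat.pow_le_pow_left (sq_add_one_le hn) _))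
              (Nat.mul_le_mul_left _ (expand_base_pow_le hk))
        _ = C * 2 ^ C * k ^ (4 * k) * n ^ (2 * C + 1) := by ring
        _ ≤ C' * k ^ (4 * k) * n ^ C' := Nat.mul_le_mul (Nat.mul_le_mul_right _ (by omega))
            (Nat.pow_le_pow_right hn (by omega))
    calc ((C * (n * n + 1) ^ C * (n * β ^ (K - 1)) : ℕ) : ℝ)
        ≤ ((C' * k ^ (4 * k) * n ^ C' : ℕ) : ℝ) := by exact_mod_cast h3
      _ = C' * ((k ^ (4 * k) : ℕ) : ℝ) * (n : ℝ) ^ C' := by push_cast; ring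
      _ ≤ _ := by gcongr

/-- The number of advice strings for connected sets with a small boundary. -/
theorem two_pow_le_two_rpow {k K d p q b : ℕ} (hK1 : 1 ≤ K) (hKk : K ≤ k) (hp : 0 < p) {ε : ℝ}
    (hε : ε = p / q) (hq : 0 < q) (hb : b = 2 * K * d * q / p) :
    (((if b = 0 then 1 else 2) ^ (3 * b + 2 * K + 2) : ℕ) : ℝ) ≤
      (2 : ℝ) ^ (14 * ((k : ℝ) ^ 2 * d / ε)) := by
  have hp' : (0 : ℝ) < p := by exact_mod_cast hp
  have hq' : (0 : ℝ) < q := by exact_mod_cast hq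
  have hε0 : 0 < ε := by rw [hε]; positivity
  split_ifs with h0
  · rw [one_pow, Nat.cast_one]
    exact Real.one_le_rpow (by norm_num) (by positivity)
  have hK1' : (1 : ℝ) ≤ K := by exact_mod_cast hK1
  have hKk' : (K : ℝ) ≤ k := by exact_mod_cast hKk
  -- `b ≤ 2 * K * d / ε`, and `1 ≤ b`
  have h1 : (b : ℝ) ≤ 2 * (K * d / ε) := by
    have h2 : b * p ≤ 2 * K * d * q := by rw [hb]; exact Nat.div_mul_le_self _ _
    have h3 : (b : ℝ) * p ≤ 2 * K * d * q := by exact_mod_cast h2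
    rw [hε, show 2 * ((K : ℝ) * d / (p / q)) = 2 * K * d * q / p by field_simp, le_div_iff₀ hp']
    exact h3
  have h2 : (1 : ℝ) ≤ b := by exact_mod_cast Nat.one_le_iff_ne_zero.2 h0
  set y := (K : ℝ) * d / ε with hy
  have hy0 : 0 ≤ y := by positivity
  have hz : k * y ≤ (k : ℝ) ^ 2 * d / ε := by
    rw [hy, show (k : ℝ) * (K * d / ε) = (k * K * d) / ε by ring]
    gcongr
    nlinarith
  have hD : ((3 * b + 2 * K + 2 : ℕ) : ℝ) ≤ 14 * ((k : ℝ) ^ 2 * d / ε) := by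
    push_cast
    nlinarith
  push_cast
  rw [← Real.rpow_natCast]
  exact Real.rpow_le_rpow_of_exponent_le (by norm_num) hD

theorem sum_adjMat_eq_degree {V : Type*} [Fintype V] (G : SimpleGraph V) [DecidableRel G.Adj] (u : V) :
    ∑ v, adjMat G u v = G.degree u := by
  rw [← SimpleGraph.card_neighborFinset_eq_degree, SimpleGraph.neighborFinset_eq_filter,
    Finset.card_filter]
  refine Finset.sum_congr rfl fun v _ => ?_
  unfold adjMat
  split_ifs <;> rfl

/-- Local search over connected sets with at most `k` terminals and a small boundary. -/
theorem exists_solvesWithin_search : ∃ (P : Prog) (C : ℕ), ∀ (n k : ℕ) (ε : ℚ), 1 ≤ n → 1 ≤ k →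
    0 < ε → ∀ (G : SimpleGraph (Fin n)) [DecidableRel G.Adj] (R : Finset (Fin n)),
      SolvesWithin P C G R k (encodeRat ε) (2 + (ε : ℝ))
        (C * (2 : ℝ) ^ (C * ((k : ℝ) ^ 2 * G.maxDegree / (ε : ℝ))) * (n : ℝ) ^ C) := by
  obtain ⟨C, hC⟩ := solvesWithin_of_admissible admissible_search rfl rfl
  set C' := C * 6 ^ C + 2 * C + 14 * (C + 1) with hC'
  refine ⟨(searchWith setupSearch decodeSearch).comp 100, C', fun n k ε hn hk hε G _ R => ?_⟩
  set s₀ := inputState G R (k :: encodeRat ε) with hs₀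
  have hG : grid s₀ 0 n = adjMat G := grid_inputState G _ _
  set d := Finset.univ.sup fun u => ∑ v, adjMat G u v with hd
  set p := ε.num.toNat with hp
  set q := ε.den with hq
  set K := min k n with hK
  obtain ⟨b, hb⟩ : ∃ b, b = 2 * K * d * q / p := ⟨_, rfl⟩
  obtain ⟨h1, h11, h13, h14⟩ := setupSearch_spec (n := n) (k := k) (p := p) (q := q) (s := s₀) rfl rfl
    rfl rfl (by rw [hG]; exact isSym01_adjMat G) (b := b) (by rw [hb, hd, hG])
  rw [hG] at h1
  have hKn : K ≤ n := min_le_right _ _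
  have hK1 : 1 ≤ K := le_min hk hn
  have hq0 : 0 < q := ε.den_pos
  have hnum : 0 < ε.num := Rat.num_pos.2 hε
  have hp0 : 0 < p := by omega
  have hεpq : (ε : ℝ) = p / q := by
    have : (p : ℤ) = ε.num := Int.toNat_of_nonneg hnum.le
    have h2 : (p : ℝ) = (ε.num : ℝ) := by rw [← this]; simp
    rw [h2, Rat.cast_def]
  set D := 3 * b + 2 * K + 2 with hD
  set β := if b = 0 then 1 else 2 with hβ
  have hβ1 : 1 ≤ β := by rw [hβ]; split_ifs <;> omega
  set N := β ^ D with hN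
  have hN1 : 1 ≤ N := Nat.pow_pos hβ1
  have hNif : N = if b = 0 then 1 else 2 ^ D := by
    rw [hN, hβ]; split_ifs <;> simp
  refine hC C' (by omega) n k _ G _ _ _ (adjMat G)
    (fun g => searchResult (adjMat G) R K D ⟨g % n, Nat.mod_lt _ hn⟩ (g / n))
    (setupSearch.den s₀) (n * n + 1 + D) (n * N) hn hk rfl h1 (isSym01_adjMat G) (fun _ _ => le_rfl)
    (by rw [h14]; exact hβ1) (by rw [h11, h13, h14]) (Nat.mul_pos hn hN1)
    (Nat.le_add_right _ _) (by rw [h13]; omega)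
    (fun g hg s e0 e10 e12 e13 e14 e28 e3 eR eR1 => ?_)
    (fun g hg => ?_) (fun S hS hst T hT => ?_) ?_
  · rw [decodeSearch_spec e0 hn e10 eR1 (by rw [e3]; exact isSym01_adjMat G), e3, eR]
    simp only [e12, e13, e28, h13, ← hK]
  · simp only [searchResult]
    split_ifs with h
    · exact h
    · simp
  · have := ratio_of_stable_small (b := b) (d := d) (p := p) (q := q) hT hS.le
      (fun u => Finset.le_sup (f := fun u => ∑ v, adjMat G u v) (Finset.mem_univ u))
      (by rw [hb]; exact (Nat.lt_mul_div_succ _ hp0).le)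
      (fun O hO hOb hOK => by
        rcases Finset.eq_empty_or_nonempty O with rfl | ⟨r, hr⟩
        · rw [moveMat_empty]
        obtain ⟨h, hh, hsub, hR⟩ := exists_runDigits_searchStep (isSym01_adjMat G).symm hO hr hOb hOK
        rw [← hD, ← hNif] at hh
        refine hst _ (advice_lt r hh) O (Finset.disjoint_left.2 fun v hv hv' => ?_)
        rw [advice_mod r hn, advice_div r hn] at hv'
        simp only [searchResult] at hv'
        rw [← hD] at hR hsub
        rw [if_pos (by rw [hR]; exact hOK)] at hv'
        exact (Finset.mem_sdiff.1 hv').2 (hsub hv))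
      fun O hO => hst 0 (Nat.mul_pos hn hN1) O (hO.mono_right Finset.sdiff_subset)
    have h2 : (q : ℝ) * ((∑ u, ∑ v, S u v : ℕ) : ℝ) ≤
        (2 * q + p) * (∑ u, ∑ v, edgeMat T u v : ℕ) := by exact_mod_cast this
    have hq' : (0 : ℝ) < q := by exact_mod_cast hq0
    rw [hεpq, show (2 + (p : ℝ) / q) = (2 * q + p) / q by field_simp, div_mul_eq_mul_div,
      le_div_iff₀ hq']
    linarith
  · have hdeg : d = G.maxDegree := by
      refine le_antisymm (Finset.sup_le fun u _ => ?_)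
        (SimpleGraph.maxDegree_le_of_forall_degree_le _ _ fun u => ?_)
      · rw [sum_adjMat_eq_degree]; exact G.degree_le_maxDegree u
      · rw [← sum_adjMat_eq_degree]
        exact Finset.le_sup (f := fun u => ∑ v, adjMat G u v) (Finset.mem_univ u)
    have hNr := two_pow_le_two_rpow (k := k) hK1 (min_le_left _ _) hp0 hεpq hq0 hb
    rw [← hβ, ← hD, ← hN, hdeg] at hNr
    have hB : n * n + 1 + D ≤ 6 * n ^ 2 * N := by
      have hnn : n ≤ n * n := Nat.le_mul_self n
      rw [hNif]
      split_ifs with h0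
      · rw [hD, h0, sq]; omega
      · have h2 : D < 2 ^ D := Nat.lt_two_pow_self
        have h3 : 1 ≤ n * n := Nat.mul_pos hn hn
        rw [sq]
        nlinarith
    have h3 : C * (n * n + 1 + D) ^ C * (n * N) ≤ C' * N ^ (C + 1) * n ^ C' := by
      calc C * (n * n + 1 + D) ^ C * (n * N) ≤ C * (6 * n ^ 2 * N) ^ C * (n * N) :=
            Nat.mul_le_mul_right _ (Nat.mul_le_mul_left _ (Nat.pow_le_pow_left hB _))
        _ = C * 6 ^ C * N ^ (C + 1) * n ^ (2 * C + 1) := by ring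
        _ ≤ C' * N ^ (C + 1) * n ^ C' := Nat.mul_le_mul (Nat.mul_le_mul_right _ (by omega))
            (Nat.pow_le_pow_right hn (by omega))
    set z := (k : ℝ) ^ 2 * G.maxDegree / (ε : ℝ) with hz
    have hz0 : 0 ≤ z := by
      have : (0 : ℝ) < ε := by exact_mod_cast hε
      positivity
    have h4 : (N : ℝ) ^ (C + 1) ≤ (2 : ℝ) ^ (C' * z) := by
      calc (N : ℝ) ^ (C + 1) ≤ ((2 : ℝ) ^ (14 * z)) ^ (C + 1) :=
            pow_le_pow_left₀ (Nat.cast_nonneg _) hNr _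
        _ = (2 : ℝ) ^ (14 * z * ((C + 1 : ℕ) : ℝ)) := by
            rw [← Real.rpow_natCast, ← Real.rpow_mul (by norm_num)]
        _ ≤ _ := by
            refine Real.rpow_le_rpow_of_exponent_le (by norm_num) ?_
            have : ((14 * (C + 1) : ℕ) : ℝ) ≤ C' := by exact_mod_cast (by omega : 14 * (C + 1) ≤ C')
            calc 14 * z * ((C + 1 : ℕ) : ℝ) = ((14 * (C + 1) : ℕ) : ℝ) * z := by push_cast; ring
              _ ≤ _ := mul_le_mul_of_nonneg_right this hz0
    calc ((C * (n * n + 1 + D) ^ C * (n * N) : ℕ) : ℝ)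
        ≤ ((C' * N ^ (C + 1) * n ^ C' : ℕ) : ℝ) := by exact_mod_cast h3
      _ = C' * (N : ℝ) ^ (C + 1) * (n : ℝ) ^ C' := by push_cast; ring
      _ ≤ _ := by gcongr

end SubsetEdgeSeparator

open SubsetEdgeSeparator in
theorem theorem6 :
    -- (a) `R = V(G)`: ratio `2 + ε`, time `2^{O(k log (k / min ε 1))} n^{O(1)}`
    (∃ (P : WordRAM.Prog) (C : ℕ), ∀ (n k : ℕ) (ε : ℚ), 1 ≤ n → 1 ≤ k → 0 < ε →
      ∀ (G : SimpleGraph (Fin n)) [DecidableRel G.Adj],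
        SolvesWithin P C G Finset.univ k (encodeRat ε) (2 + (ε : ℝ))
          (C * (2 : ℝ) ^ (C * (k * Real.logb 2 (k / min (ε : ℝ) 1))) * (n : ℝ) ^ C)) ∧
    -- (b) ratio `2`, time `n^{k + O(1)}`
    (∃ (P : WordRAM.Prog) (C : ℕ), ∀ (n k : ℕ), 1 ≤ n → 1 ≤ k →
      ∀ (G : SimpleGraph (Fin n)) [DecidableRel G.Adj] (R : Finset (Fin n)),
        SolvesWithin P C G R k [] 2 (C * (n : ℝ) ^ (k + C))) ∧
    -- (c) ratio `2 + ε`, time `2^{O(k² deg(G) / ε)} n^{O(1)}`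
    (∃ (P : WordRAM.Prog) (C : ℕ), ∀ (n k : ℕ) (ε : ℚ), 1 ≤ n → 1 ≤ k → 0 < ε →
      ∀ (G : SimpleGraph (Fin n)) [DecidableRel G.Adj] (R : Finset (Fin n)),
        SolvesWithin P C G R k (encodeRat ε) (2 + (ε : ℝ))
          (C * (2 : ℝ) ^ (C * ((k : ℝ) ^ 2 * G.maxDegree / (ε : ℝ))) * (n : ℝ) ^ C)) := by
  exact ⟨exists_solvesWithin_expand, exists_solvesWithin_tuple, exists_solvesWithin_search⟩
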